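/- Let $(\varepsilon_{i,t})_{i\ge 1,\,t\in\mathbb Z}$ be independent real random variables with $\mathbb E\,\varepsilon_{i,t}=0$, $\mathbb E\,\varepsilon_{i,t}^2=1$ and $\sup_{i,t}\mathbb E\,\varepsilon_{i,t}^4<\infty$ (for instance i.i.d. with a finite fourth moment). Let $(\phi_k)_{k\ge0}$ be real with $\sum_k|\phi_k|<\infty$, and put $X_{it}=\sum_{k\ge0}\phi_k\,\varepsilon_{i,t-k}$. Let $p=p(n)$ with $p/n\to c\in(0,\infty)$ as $n\to\infty$, let $\mathbf X_t=(X_{1t},\dots,X_{pt})^\top$ and $S_n=\frac1n\sum_{t=1}^n\mathbf X_t\mathbf X_t^\top$. Let the limiting spectral distribution $F$ be the non-random probability distribution to which the empirical distribution of the eigenvalues of $S_n$ converges weakly, almost surely. Let $$f(\lambda)=\frac1{2\pi}\Big|\sum_{k\ge0}\phi_k e^{ik\lambda}\Big|^2$$ be the spectral density, assumed infinitely differentiable, let $a$ and $b$ be the minimum and the maximum of $2\pi f$ on $[0,2\pi]$, and assume $a>0$. For real $s\ne0$, $s\notin[-\frac1{ac},-\frac1{bc}]$, put $$g(s)=-\frac1s+\frac1{2\pi}\int_0^{2\pi}\frac{d\lambda}{cs+\{2\pi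 f(\lambda)\}^{-1}} .$$ Then there are $0\le x_1<x_2<\infty$ and a function $h\ge0$ on $\mathbb R$ vanishing outside $[x_1,x_2]$ such that: 1. The measure $h(x)\,dx$ has support exactly $[x_1,x_2]$. The function $h$ is continuous on $[x_1,x_2]$ if $c\neq1$, and on $[x_1,x_2]\setminus\{0\}$ if $c=1$. If $c\le1$, then $F(dx)=h(x)\,dx$; if $c>1$, then $F(dx)=(1-\frac1c)\,\delta_0(dx)+h(x)\,dx$. 2. If $c>1$, there are $s_1\in(-\infty,-\frac1{ac})$, the unique point where $g$ attains its maximum on $(-\infty,-\frac1{ac})$, and $s_2\in(-\frac1{bc},0)$, the unique point where $g$ attains its minimum on $(-\frac1{bc},0)$. The points $s_1,s_2$ are the only local extrema of $g$ on its domain, and $x_1=g(s_1)$, $x_2=g(s_2)$. 3. If $c<1$, there are $s_1\in(0,\infty)$, the unique point where $g$ attains its maximum on $(0,\infty)$, and $s_2\in(-\frac1{bc},0)$, the unique point where $g$ attains its minimum on $(-\frac1{bc},0)$. The points $s_1,s_2$ are the only local extrema of $g$ on its domain, and $x_1=g(s_1)$, $x_2=g(s_2)$. -/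

import Mathlib

open MeasureTheory ProbabilityTheory Filter Topology Set
open scoped BoundedContinuousFunction ENNReal

noncomputable section

/-- The coordinate processes `X_{i,t} = ∑_{k ≥ 0} φ_k ε_{i,t-k}` of the linear time series. -/
def linearProcess {Ω : Type*} (φ : ℕ → ℝ) (ε : ℕ → ℤ → Ω → ℝ) (i : ℕ) (t : ℤ) (ω : Ω) : ℝ :=
  ∑' k : ℕ, φ k * ε i (t - (k : ℤ)) ω

/-- The `p × n` data matrix whose columns are the observations at the epochs `t = 1, …, n`. -/
def dataMatrix {Ω : Type*} (φ : ℕ → ℝ) (ε : ℕ → ℤ → Ω → ℝ) (p n : ℕ) (ω : Ω) :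
    Matrix (Fin p) (Fin n) ℝ :=
  Matrix.of fun i j => linearProcess φ ε (i : ℕ) (((j : ℕ) : ℤ) + 1) ω

/-- The sample covariance matrix `S_n = (1/n) ∑_{j=1}^n X_j X_jᵀ`. -/
def sampleCov {Ω : Type*} (φ : ℕ → ℝ) (ε : ℕ → ℤ → Ω → ℝ) (p n : ℕ) (ω : Ω) :
    Matrix (Fin p) (Fin p) ℝ :=
  (1 / (n : ℝ)) • (dataMatrix φ ε p n ω * (dataMatrix φ ε p n ω).transpose)

theorem sampleCov_isHermitian {Ω : Type*} (φ : ℕ → ℝ) (ε : ℕ → ℤ → Ω → ℝ) (p n : ℕ) (ω : Ω) :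
    (sampleCov φ ε p n ω).IsHermitian := by
  unfold sampleCov Matrix.IsHermitian
  simp [Matrix.conjTranspose_eq_transpose_of_trivial,
    Matrix.transpose_mul]

/-- The empirical spectral distribution of a real symmetric `p × p` matrix: mass `1/p` at each
eigenvalue, counted with multiplicity. -/
def esd {p : ℕ} {A : Matrix (Fin p) (Fin p) ℝ} (hA : A.IsHermitian) : Measure ℝ :=
  (p : ℝ≥0∞)⁻¹ • ∑ i : Fin p, Measure.dirac (hA.eigenvalues i)

/-- `F` is the limiting spectral distribution: almost surely, the empirical spectral distribution
of the `p(n) × p(n)` sample covariance matrix `S_n` converges weakly to `F`. -/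
def IsLSD {Ω : Type*} [MeasurableSpace Ω] (P : Measure Ω) (φ : ℕ → ℝ) (ε : ℕ → ℤ → Ω → ℝ)
    (p : ℕ → ℕ) (F : Measure ℝ) : Prop :=
  ∀ᵐ ω ∂P, ∀ u : ℝ →ᵇ ℝ,
    Tendsto (fun n : ℕ => ∫ x, u x ∂(esd (sampleCov_isHermitian φ ε (p n) n ω)))
      atTop (𝓝 (∫ x, u x ∂F))

/-- The spectral density `f(θ) = (1/2π) |∑_{k ≥ 0} φ_k e^{ikθ}|²` of the linear process. -/
def spectralDensity (φ : ℕ → ℝ) (θ : ℝ) : ℝ :=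
  1 / (2 * Real.pi) * ‖∑' k : ℕ, (φ k : ℂ) * Complex.exp (Complex.I * (k : ℂ) * (θ : ℂ))‖ ^ 2

/-- The map `g(s) = -1/s + (1/2π) ∫_0^{2π} dθ / (c s + 1/(2π f(θ)))` at real `s`. -/
def gMap (f : ℝ → ℝ) (c s : ℝ) : ℝ :=
  -1 / s + 1 / (2 * Real.pi) *
    ∫ θ in (0 : ℝ)..(2 * Real.pi), 1 / (c * s + 1 / (2 * Real.pi * f θ))

/-- The real domain of `g`: `s ≠ 0` and `s ∉ [-1/(ac), -1/(bc)]`. -/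
def gDomain (a b c : ℝ) : Set ℝ :=
  {s | s ≠ 0 ∧ s ∉ Icc (-1 / (a * c)) (-1 / (b * c))}

end

/-! Put w = -1/s. Then g(s) becomes H(w) = w + ∫ ((w - t)⁻¹ + t⁻¹) dρ(t) (`subMap`), where ρ
(`symbolMeasure`) is a finite measure on [ac, bc]. Everything about F follows from one fact: the
reciprocal W = 1/G of its Cauchy transform G(z) = ∫ (z - t)⁻¹ dF(t) satisfies H(W(z)) = z.

The analytic half rests on Im H(w) = Im w · (1 - ψ(w)), where ψ(w) = ∫ |w - t|⁻² dρ(t). Let D be the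
set Im w ≥ 0, ψ(w) ≤ 1. On D the map H is injective, by the equality case of Cauchy–Schwarz
(`subMap_injOn`), and proper, because H(w) - w is bounded there; regularity of f keeps D away from
[ac, bc] (`isSeparated_symbolMeasure`). So H embeds D as a closed set containing the upper half
plane, hence also the real line, and W extends continuously to the real line (`exists_inverse`).
Stieltjes inversion gives the density h = -Im(1/W)/π off the origin, and the limit of z G(z) at 0
gives the atom, 1 - ψ(0) = 1 - 1/c if c ≥ 1. The real points of D form two rays (-∞, u₁] and [u₂, ∞)
with ψ(u₁) = ψ(u₂) = 1, that is H' = 0 at their ends. H maps them onto (-∞, x₁] and [x₂, ∞), and W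
is non-real exactly in between. Hence the support is [x₁, x₂], and its ends are the critical values
of g at s = -1/u₁ and s = -1/u₂. The case c = 1 is u₁ = 0: then W(0) = 0 and continuity of h at the
origin is not guaranteed.

The probabilistic half proves g(s) = -x for s = ∫ (t + x)⁻¹ dF(t), x > 0
(`IsLSD.gMap_integral_inv_add`); analytic continuation turns this into H(W(z)) = z. The data matrix
is replaced by Z C, with Z the innovations and C a circulant matrix, at a negligible cost in mean
(`integral_abs_sub_periodized_le`); its rows are independent with covariance Γ = CᵀC. Since F is
given as a limit, the normalized resolvent trace is known to converge to s, and only the equation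
for s has to be found. A leave-one-out expansion tested against B = (1 + csΓ)⁻¹Γ yields n⁻¹ tr B ≈
1/s - x (`abs_trace_testMatrix_sub_le`), because the quadratic forms of the rows concentrate around
traces (`integral_abs_looForm_sub_le`). Roots of unity diagonalize Γ, so n⁻¹ tr B is a Riemann sum
whose limit is g(s) + 1/s. -/

set_option linter.unusedSectionVars false

/-! ### Cauchy transforms of finite measures on the line -/

/-- The Cauchy transform `z ↦ ∫ (z - t)⁻¹ dμ(t)` of a measure on the line. -/
noncomputable def cauchyTransform (μ : Measure ℝ) (z : ℂ) : ℂ := ∫ t, (z - (t : ℂ))⁻¹ ∂μ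

theorem exists_pos_le_norm_sub {S : Set ℝ} (hS : IsClosed S) {z : ℂ}
    (hz : ∀ t ∈ S, z ≠ (t : ℂ)) : ∃ δ > 0, ∀ t ∈ S, δ ≤ ‖z - (t : ℂ)‖ := by
  have hcl : IsClosed ((fun t : ℝ => (t : ℂ)) '' S) :=
    Complex.isometry_ofReal.isClosedEmbedding.isClosedMap S hS
  have hmem : ((fun t : ℝ => (t : ℂ)) '' S)ᶜ ∈ 𝓝 z := by
    refine hcl.isOpen_compl.mem_nhds ?_
    rintro ⟨t, ht, rfl⟩
    exact hz t ht rfl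
  obtain ⟨δ, hδ, h⟩ := Metric.mem_nhds_iff.1 hmem
  refine ⟨δ, hδ, fun t ht => ?_⟩
  by_contra! hlt
  refine @h (t : ℂ) ?_ ⟨t, ht, rfl⟩
  rwa [Metric.mem_ball, dist_comm, dist_eq_norm]

theorem integrable_of_norm_le_on {μ : Measure ℝ} [IsFiniteMeasure μ] {S : Set ℝ}
    (hμ : μ Sᶜ = 0) {E : Type*} [NormedAddCommGroup E]
    {f : ℝ → E} (hf : AEStronglyMeasurable f μ) (K : ℝ)
    (h : ∀ t ∈ S, ‖f t‖ ≤ K) : Integrable f μ :=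
  Integrable.of_bound hf K ((measure_eq_zero_iff_ae_notMem.1 hμ).mono fun t ht =>
    h t (by simpa using ht))

theorem hasDerivAt_cauchyTransform {μ : Measure ℝ} [IsFiniteMeasure μ] {S : Set ℝ}
    (hS : IsClosed S) (hμ : μ Sᶜ = 0) {z : ℂ} (hz : ∀ t ∈ S, z ≠ (t : ℂ)) :
    HasDerivAt (cauchyTransform μ) (-∫ t, ((z - (t : ℂ)) ^ 2)⁻¹ ∂μ) z := by
  obtain ⟨δ, hδ, hsep⟩ := exists_pos_le_norm_sub hS hz
  have hae : ∀ᵐ t ∂μ, t ∈ S := (measure_eq_zero_iff_ae_notMem.1 hμ).mono fun t ht => by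
    simpa using ht
  have hball : ∀ w ∈ Metric.ball z (δ / 2), ∀ t ∈ S, δ / 2 ≤ ‖w - (t : ℂ)‖ := by
    intro w hw t ht
    have h1 := hsep t ht
    have h2 : ‖z - w‖ < δ / 2 := by rwa [Metric.mem_ball, dist_comm, dist_eq_norm] at hw
    have h3 : ‖z - (t : ℂ)‖ ≤ ‖z - w‖ + ‖w - t‖ := by
      have := norm_add_le (z - w) (w - t)
      simpa using this
    linarith
  have key := hasDerivAt_integral_of_dominated_loc_of_deriv_le
    (F := fun (w : ℂ) (t : ℝ) => (w - (t : ℂ))⁻¹)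
    (F' := fun (w : ℂ) (t : ℝ) => -((w - (t : ℂ)) ^ 2)⁻¹) (μ := μ) (x₀ := z)
    (bound := fun _ => ((δ / 2) ^ 2)⁻¹) (s := Metric.ball z (δ / 2))
    (Metric.ball_mem_nhds z (by positivity))
    (Eventually.of_forall fun w => (by fun_prop : Measurable _).aestronglyMeasurable)
    (integrable_of_norm_le_on hμ (by fun_prop : Measurable _).aestronglyMeasurable δ⁻¹ (by
      intro t ht
      rw [norm_inv]
      exact inv_anti₀ hδ (hsep t ht)))
    (by fun_prop : Measurable _).aestronglyMeasurable
    (hae.mono fun t ht w hw => by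
      rw [norm_neg, norm_inv, norm_pow]
      exact inv_anti₀ (by positivity) (pow_le_pow_left₀ (by positivity) (hball w hw t ht) 2))
    (integrable_const _)
    (hae.mono fun t ht w hw => by
      have hne : w - (t : ℂ) ≠ 0 := by
        have := hball w hw t ht
        rw [← norm_pos_iff]; linarith
      have := ((hasDerivAt_id w).sub_const (t : ℂ)).inv hne
      refine this.congr_deriv ?_
      simp [div_eq_mul_inv])
  have := key.2
  rw [integral_neg] at this
  exact this

/-! ### The map `w ↦ w + ∫ ((w - t)⁻¹ + t⁻¹) dρ(t)` -/

/-- The subordination map `w ↦ w + ∫ ((w - t)⁻¹ + t⁻¹) dρ(t)`. -/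
noncomputable def subMap (ρ : Measure ℝ) (w : ℂ) : ℂ :=
  w + (cauchyTransform ρ w + ∫ t, (t : ℂ)⁻¹ ∂ρ)

/-- The function `w ↦ ∫ |w - t|⁻² dρ(t)`. -/
noncomputable def subPsi (ρ : Measure ℝ) (w : ℂ) : ℝ := ∫ t, (‖w - (t : ℂ)‖ ^ 2)⁻¹ ∂ρ

/-- A finite measure on `[A, B] ⊆ (0, ∞)` such that `∫ |w - t|⁻² dρ(t) ≤ 1` only for `w` at
distance at least `δ` from `[A, B]`. -/
structure IsSeparated (ρ : Measure ℝ) (A B δ : ℝ) : Prop where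
  finite : IsFiniteMeasure ρ
  A_pos : 0 < A
  A_le_B : A ≤ B
  supp : ρ (Icc A B)ᶜ = 0
  δ_pos : 0 < δ
  sep : ∀ w : ℂ, (∀ t ∈ Icc A B, w ≠ (t : ℂ)) → subPsi ρ w ≤ 1 →
    ∀ t ∈ Icc A B, δ ≤ ‖w - (t : ℂ)‖

namespace IsSeparated

variable {ρ : Measure ℝ} {A B δ : ℝ}

theorem ae_mem (h : IsSeparated ρ A B δ) : ∀ᵐ t ∂ρ, t ∈ Icc A B :=
  (measure_eq_zero_iff_ae_notMem.1 h.supp).mono fun t ht => by simpa using ht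

theorem integrable_inv (h : IsSeparated ρ A B δ) {w : ℂ} (hw : ∀ t ∈ Icc A B, w ≠ (t : ℂ)) :
    Integrable (fun t : ℝ => (w - (t : ℂ))⁻¹) ρ := by
  have := h.finite
  obtain ⟨d, hd, hsep⟩ := exists_pos_le_norm_sub isClosed_Icc hw
  refine integrable_of_norm_le_on h.supp (by fun_prop : Measurable _).aestronglyMeasurable d⁻¹
    fun t ht => ?_
  rw [norm_inv]
  exact inv_anti₀ hd (hsep t ht)

theorem zero_ne (h : IsSeparated ρ A B δ) : ∀ t ∈ Icc A B, (0 : ℂ) ≠ (t : ℂ) := by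
  intro t ht h0
  have h1 : (t : ℝ) = 0 := by exact_mod_cast h0.symm
  have := h.A_pos
  linarith [ht.1]

theorem integrable_inv_mul (h : IsSeparated ρ A B δ) {w w' : ℂ}
    (hw : ∀ t ∈ Icc A B, w ≠ (t : ℂ)) (hw' : ∀ t ∈ Icc A B, w' ≠ (t : ℂ)) :
    Integrable (fun t : ℝ => (w - (t : ℂ))⁻¹ * (w' - (t : ℂ))⁻¹) ρ := by
  have := h.finite
  obtain ⟨d, hd, hsep⟩ := exists_pos_le_norm_sub isClosed_Icc hw
  obtain ⟨d', hd', hsep'⟩ := exists_pos_le_norm_sub isClosed_Icc hw'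
  refine integrable_of_norm_le_on h.supp (by fun_prop : Measurable _).aestronglyMeasurable
    (d⁻¹ * d'⁻¹) fun t ht => ?_
  rw [norm_mul, norm_inv, norm_inv]
  gcongr
  · exact hsep t ht
  · exact hsep' t ht

theorem integrable_psi (h : IsSeparated ρ A B δ) {w : ℂ} (hw : ∀ t ∈ Icc A B, w ≠ (t : ℂ)) :
    Integrable (fun t : ℝ => (‖w - (t : ℂ)‖ ^ 2)⁻¹) ρ := by
  refine (h.integrable_inv_mul hw hw).norm.congr (Eventually.of_forall fun t => ?_)
  simp [pow_two]

/-- By partial fractions. It turns a coincidence of two values into an integral equal to 1, the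
starting point of injectivity. -/
theorem subMap_sub (h : IsSeparated ρ A B δ) {w w' : ℂ}
    (hw : ∀ t ∈ Icc A B, w ≠ (t : ℂ)) (hw' : ∀ t ∈ Icc A B, w' ≠ (t : ℂ)) :
    subMap ρ w - subMap ρ w' =
      (w - w') * (1 - ∫ t : ℝ, (w - (t : ℂ))⁻¹ * (w' - (t : ℂ))⁻¹ ∂ρ) := by
  have h1 : cauchyTransform ρ w - cauchyTransform ρ w' =
      (w' - w) * ∫ t : ℝ, (w - (t : ℂ))⁻¹ * (w' - (t : ℂ))⁻¹ ∂ρ := by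
    unfold cauchyTransform
    rw [← integral_sub (h.integrable_inv hw) (h.integrable_inv hw'), ← integral_const_mul]
    refine integral_congr_ae (h.ae_mem.mono fun t ht => ?_)
    have e1 := sub_ne_zero.2 (hw t ht)
    have e2 := sub_ne_zero.2 (hw' t ht)
    simp only
    field_simp
    ring
  unfold subMap
  linear_combination h1

theorem subMap_zero (ρ : Measure ℝ) : subMap ρ 0 = 0 := by
  unfold subMap cauchyTransform
  simp only [zero_sub, zero_add, ← neg_inv, integral_neg]
  ring

/-- The difference formula with second point 0, a zero of the map. This factored form serves the
comparison with g and the linear bound at the origin. -/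
theorem subMap_eq_mul (h : IsSeparated ρ A B δ) {w : ℂ} (hw : ∀ t ∈ Icc A B, w ≠ (t : ℂ)) :
    subMap ρ w = w * (1 + ∫ t : ℝ, (w - (t : ℂ))⁻¹ * (t : ℂ)⁻¹ ∂ρ) := by
  have := h.subMap_sub hw h.zero_ne
  rw [subMap_zero, sub_zero, sub_zero] at this
  rw [this]
  simp only [zero_sub, ← neg_inv, mul_neg, integral_neg]
  ring

theorem hasDerivAt_subMap (h : IsSeparated ρ A B δ) {w : ℂ}
    (hw : ∀ t ∈ Icc A B, w ≠ (t : ℂ)) :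
    HasDerivAt (subMap ρ) (1 - ∫ t : ℝ, ((w - (t : ℂ)) ^ 2)⁻¹ ∂ρ) w := by
  have := h.finite
  have := (hasDerivAt_id w).add
    ((hasDerivAt_cauchyTransform isClosed_Icc h.supp hw).add_const (∫ t : ℝ, (t : ℂ)⁻¹ ∂ρ))
  rw [← sub_eq_add_neg] at this
  exact this

theorem ne_of_im_ne_zero {w : ℂ} (hw : w.im ≠ 0) (S : Set ℝ) : ∀ t ∈ S, w ≠ (t : ℂ) := by
  rintro t - rfl
  simp at hw

/-- The reason for the condition `subPsi ρ w ≤ 1`: a point with Im w > 0 has its image in the upper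
half plane exactly when `subPsi ρ w < 1`. -/
theorem im_subMap (h : IsSeparated ρ A B δ) {w : ℂ} (hw : ∀ t ∈ Icc A B, w ≠ (t : ℂ)) :
    (subMap ρ w).im = w.im * (1 - subPsi ρ w) := by
  have h1 : (cauchyTransform ρ w).im = - (w.im * subPsi ρ w) := by
    unfold cauchyTransform subPsi
    have := integral_im (𝕜 := ℂ) (h.integrable_inv hw)
    simp only [RCLike.im_to_complex] at this
    rw [← this, ← integral_const_mul, ← integral_neg]
    refine integral_congr_ae (Eventually.of_forall fun t => ?_)
    simp only [Complex.inv_im, Complex.sub_im, Complex.ofReal_im, sub_zero,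
      Complex.normSq_eq_norm_sq]
    ring
  have h2 : (∫ t : ℝ, (t : ℂ)⁻¹ ∂ρ).im = 0 := by
    have : (∫ t : ℝ, (t : ℂ)⁻¹ ∂ρ) = ((∫ t : ℝ, t⁻¹ ∂ρ : ℝ) : ℂ) := by
      rw [← integral_complex_ofReal]
      simp
    rw [this, Complex.ofReal_im]
  simp only [subMap, Complex.add_im, h1, h2]
  ring

/-- The closed domain on which the subordination map is injective. -/
def closedDomain (ρ : Measure ℝ) (A B : ℝ) : Set ℂ :=
  {w | 0 ≤ w.im ∧ (∀ t ∈ Icc A B, w ≠ (t : ℂ)) ∧ subPsi ρ w ≤ 1}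

/-- Equal values at w ≠ w' force ∫ (w - t)⁻¹(w' - t)⁻¹ dρ = 1, while both functions have L² norm at
most 1. This is equality in Cauchy–Schwarz, so (w - t)⁻¹ is the conjugate of (w' - t)⁻¹ almost
everywhere and w is the conjugate of w'. Both have nonnegative imaginary part, so both are real and
equal. -/
theorem subMap_injOn (h : IsSeparated ρ A B δ) : InjOn (subMap ρ) (closedDomain ρ A B) := by
  rintro w ⟨hi, hw, hp⟩ w' ⟨hi', hw', hp'⟩ heq
  by_contra hne
  have hsub := h.subMap_sub hw hw'
  rw [heq, sub_self] at hsub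
  have hq : ∫ t : ℝ, (w - (t : ℂ))⁻¹ * (w' - (t : ℂ))⁻¹ ∂ρ = 1 := by
    rcases mul_eq_zero.1 hsub.symm with h0 | h0
    · exact absurd (sub_eq_zero.1 h0) hne
    · exact (sub_eq_zero.1 h0).symm
  have hre : ∫ t : ℝ, ((w - (t : ℂ))⁻¹ * (w' - (t : ℂ))⁻¹).re ∂ρ = 1 := by
    have := integral_re (𝕜 := ℂ) (h.integrable_inv_mul hw hw')
    simp only [RCLike.re_to_complex] at this
    rw [this, hq, Complex.one_re]
  have hpt : ∀ t : ℝ, ‖(w - (t : ℂ))⁻¹ - (starRingEnd ℂ) (w' - (t : ℂ))⁻¹‖ ^ 2 =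
      (‖w - (t : ℂ)‖ ^ 2)⁻¹ + (‖w' - (t : ℂ)‖ ^ 2)⁻¹ -
        2 * ((w - (t : ℂ))⁻¹ * (w' - (t : ℂ))⁻¹).re := by
    intro t
    have e : ∀ x y : ℂ, ‖x - (starRingEnd ℂ) y‖ ^ 2 =
        ‖x‖ ^ 2 + ‖y‖ ^ 2 - 2 * (x * y).re := by
      intro x y
      rw [← Complex.normSq_eq_norm_sq, ← Complex.normSq_eq_norm_sq, ← Complex.normSq_eq_norm_sq]
      simp only [Complex.normSq_apply, Complex.sub_re, Complex.sub_im, Complex.conj_re,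
        Complex.conj_im, Complex.mul_re]
      ring
    rw [e, norm_inv, norm_inv, inv_pow, inv_pow]
  have hint : Integrable (fun t : ℝ => (‖w - (t : ℂ)‖ ^ 2)⁻¹ + (‖w' - (t : ℂ)‖ ^ 2)⁻¹ -
        2 * ((w - (t : ℂ))⁻¹ * (w' - (t : ℂ))⁻¹).re) ρ :=
    ((h.integrable_psi hw).add (h.integrable_psi hw')).sub
      (((h.integrable_inv_mul hw hw').re).const_mul 2)
  have hzero : ∫ t : ℝ, ‖(w - (t : ℂ))⁻¹ - (starRingEnd ℂ) (w' - (t : ℂ))⁻¹‖ ^ 2 ∂ρ ≤ 0 := by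
    simp only [hpt]
    have hre' := ((h.integrable_inv_mul hw hw').re).const_mul 2
    simp only [RCLike.re_to_complex] at hre'
    rw [integral_sub (f := fun t : ℝ => (‖w - (t : ℂ)‖ ^ 2)⁻¹ + (‖w' - (t : ℂ)‖ ^ 2)⁻¹)
      ((h.integrable_psi hw).add (h.integrable_psi hw')) hre', integral_add (h.integrable_psi hw)
      (h.integrable_psi hw'), integral_const_mul, hre]
    have e1 : ∫ t : ℝ, (‖w - (t : ℂ)‖ ^ 2)⁻¹ ∂ρ ≤ 1 := hp
    have e2 : ∫ t : ℝ, (‖w' - (t : ℂ)‖ ^ 2)⁻¹ ∂ρ ≤ 1 := hp'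
    linarith
  have hae := (integral_eq_zero_iff_of_nonneg (fun t => by positivity)
    (hint.congr (Eventually.of_forall fun t => (hpt t).symm))).1
    (le_antisymm hzero (integral_nonneg fun t => by positivity))
  -- An almost everywhere statement yields an actual point t only if the measure is nonzero.
  have hne0 : ρ ≠ 0 := by
    rintro rfl
    simp at hq
  have : ∃ t ∈ Icc A B, (w - (t : ℂ))⁻¹ = (starRingEnd ℂ) (w' - (t : ℂ))⁻¹ := by
    have := ae_neBot.2 hne0
    obtain ⟨t, ht, ht'⟩ := (h.ae_mem.and hae).exists
    refine ⟨t, ht, ?_⟩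
    simpa [sub_eq_zero] using ht'
  obtain ⟨t, ht, hconj⟩ := this
  rw [map_inv₀, inv_inj, map_sub, Complex.conj_ofReal, sub_left_inj] at hconj
  have him := congrArg Complex.im hconj
  rw [Complex.conj_im] at him
  have h0 : w'.im = 0 := by linarith
  exact hne (by rw [hconj]; exact Complex.ext (by simp) (by simp [h0]))

theorem le_norm_sub_of_mem (h : IsSeparated ρ A B δ) {w : ℂ} (hw : w ∈ closedDomain ρ A B) :
    ∀ t ∈ Icc A B, δ ≤ ‖w - (t : ℂ)‖ := h.sep w hw.2.1 hw.2.2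

theorem continuousAt_subPsi (h : IsSeparated ρ A B δ) {w : ℂ}
    (hw : ∀ t ∈ Icc A B, w ≠ (t : ℂ)) : ContinuousAt (subPsi ρ) w := by
  have := h.finite
  obtain ⟨d, hd, hsep⟩ := exists_pos_le_norm_sub isClosed_Icc hw
  refine continuousAt_of_dominated (bound := fun _ => ((d / 2) ^ 2)⁻¹)
    (Eventually.of_forall fun w => (by fun_prop : Measurable _).aestronglyMeasurable)
    ?_ (integrable_const _) ?_
  · filter_upwards [Metric.ball_mem_nhds w (half_pos hd)] with w' hw'
    filter_upwards [h.ae_mem] with t ht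
    have h2 : ‖w - w'‖ < d / 2 := by rwa [Metric.mem_ball, dist_comm, dist_eq_norm] at hw'
    have h3 : ‖w - (t : ℂ)‖ ≤ ‖w - w'‖ + ‖w' - t‖ := by
      simpa using norm_add_le (w - w') (w' - t)
    have h1 := hsep t ht
    rw [Real.norm_of_nonneg (by positivity)]
    exact inv_anti₀ (by positivity) (pow_le_pow_left₀ (by positivity) (by linarith) 2)
  · filter_upwards [h.ae_mem] with t ht
    have e : ‖w - (t : ℂ)‖ ^ 2 ≠ 0 := by
      have := hsep t ht
      have : 0 < ‖w - (t : ℂ)‖ := by linarith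
      positivity
    exact ContinuousAt.inv₀ (by fun_prop) e

/-- Separation keeps limit points off [A, B], and off that interval `subPsi` is continuous. -/
theorem isClosed_closedDomain (h : IsSeparated ρ A B δ) : IsClosed (closedDomain ρ A B) := by
  refine isClosed_of_closure_subset fun w hw => ?_
  have hfar : ∀ t ∈ Icc A B, δ ≤ ‖w - (t : ℂ)‖ := by
    intro t ht
    have hc : IsClosed {z : ℂ | δ ≤ ‖z - (t : ℂ)‖} :=
      isClosed_le continuous_const (by fun_prop)
    exact closure_minimal (fun z hz => h.le_norm_sub_of_mem hz t ht) hc hw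
  have hne : ∀ t ∈ Icc A B, w ≠ (t : ℂ) := by
    rintro t ht rfl
    have := hfar t ht
    rw [sub_self, norm_zero] at this
    linarith [h.δ_pos]
  refine ⟨?_, hne, ?_⟩
  · exact closure_minimal (t := {z : ℂ | 0 ≤ z.im}) (fun z hz => hz.1)
      (isClosed_le continuous_const Complex.continuous_im) hw
  · have := mem_closure_iff_frequently.1 hw
    exact le_of_tendsto_of_frequently (h.continuousAt_subPsi hne) (this.mono fun z hz => hz.2.2)

theorem continuousOn_subMap (h : IsSeparated ρ A B δ) :
    ContinuousOn (subMap ρ) (closedDomain ρ A B) := fun _ hw =>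
  (h.hasDerivAt_subMap hw.2.1).continuousAt.continuousWithinAt

/-- On the domain the map is a bounded perturbation of the identity, because |w - t| ≥ δ there. This
gives properness and the values far out on the real axis. -/
theorem norm_subMap_sub_le (h : IsSeparated ρ A B δ) :
    ∃ K : ℝ, ∀ w ∈ closedDomain ρ A B, ‖subMap ρ w - w‖ ≤ K := by
  have := h.finite
  refine ⟨δ⁻¹ * ρ.real univ + ‖∫ t : ℝ, (t : ℂ)⁻¹ ∂ρ‖, fun w hw => ?_⟩
  have h1 : ‖cauchyTransform ρ w‖ ≤ δ⁻¹ * ρ.real univ := by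
    refine norm_integral_le_of_norm_le_const (h.ae_mem.mono fun t ht => ?_)
    rw [norm_inv]
    exact inv_anti₀ h.δ_pos (h.le_norm_sub_of_mem hw t ht)
  unfold subMap
  rw [add_sub_cancel_left]
  exact (norm_add_le _ _).trans (by linarith)

theorem norm_le_of_mem (h : IsSeparated ρ A B δ) :
    ∃ K : ℝ, ∀ w ∈ closedDomain ρ A B, ‖w‖ ≤ ‖subMap ρ w‖ + K := by
  obtain ⟨K, hK⟩ := h.norm_subMap_sub_le
  refine ⟨K, fun w hw => ?_⟩
  have h1 := norm_sub_le (subMap ρ w) (subMap ρ w - w)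
  rw [sub_sub_cancel] at h1
  linarith [hK w hw]

/-- Applied to w = W(z) it reads |z| ≤ K|W(z)|, which limits the blow-up of 1/W at the origin to
order 1/|z|. -/
theorem norm_subMap_le_mul (h : IsSeparated ρ A B δ) :
    ∃ K > 0, ∀ w ∈ closedDomain ρ A B, ‖subMap ρ w‖ ≤ K * ‖w‖ := by
  have := h.finite
  have hA := h.A_pos
  have hδ := h.δ_pos
  refine ⟨1 + δ⁻¹ * A⁻¹ * ρ.real univ, by positivity, fun w hw => ?_⟩
  rw [h.subMap_eq_mul hw.2.1, norm_mul, mul_comm]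
  gcongr
  refine (norm_add_le _ _).trans ?_
  rw [norm_one]
  gcongr
  refine norm_integral_le_of_norm_le_const (h.ae_mem.mono fun t ht => ?_)
  rw [norm_mul, norm_inv, norm_inv, Complex.norm_real, Real.norm_of_nonneg (hA.le.trans ht.1)]
  have := h.le_norm_sub_of_mem hw t ht
  have := ht.1
  have : 0 ≤ t⁻¹ := inv_nonneg.2 (hA.le.trans ht.1)
  gcongr

/-- A continuous injection that sends infinity to infinity on a closed set is proper, hence closed.
-/
theorem isClosedEmbedding_subMap (h : IsSeparated ρ A B δ) :
    IsClosedEmbedding (fun w : closedDomain ρ A B => subMap ρ w) := by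
  have hcont : Continuous (fun w : closedDomain ρ A B => subMap ρ w) :=
    continuousOn_iff_continuous_domRestrict.1 h.continuousOn_subMap
  have hinj : Function.Injective (fun w : closedDomain ρ A B => subMap ρ w) := fun x y hxy =>
    Subtype.ext (h.subMap_injOn x.2 y.2 hxy)
  refine IsClosedEmbedding.of_continuous_injective_isClosedMap hcont hinj ?_
  have : IsProperMap (fun w : closedDomain ρ A B => subMap ρ w) := by
    refine isProperMap_iff_tendsto_cocompact.2 ⟨hcont, ?_⟩
    obtain ⟨K, hK⟩ := h.norm_le_of_mem
    have h1 : Tendsto (fun w : closedDomain ρ A B => ‖(w : ℂ)‖)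
        (cocompact (closedDomain ρ A B)) atTop :=
      (tendsto_norm_cocompact_atTop (E := ℂ)).comp
        (h.isClosed_closedDomain.isClosedEmbedding_subtypeVal.tendsto_cocompact)
    rw [← Metric.cobounded_eq_cocompact (α := ℂ), ← tendsto_norm_atTop_iff_cobounded]
    refine tendsto_atTop_mono (f := fun w : closedDomain ρ A B => ‖(w : ℂ)‖ - K) (fun w => ?_)
      (tendsto_atTop_add_const_right _ (-K) h1)
    have := hK w w.2
    linarith
  exact this.isClosedMap

end IsSeparated

namespace IsSeparated

variable {ρ : Measure ℝ} {A B δ : ℝ}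

/-! ### The subordination map on the real line -/

theorem ofReal_ne {u : ℝ} (hu : u < A ∨ B < u) : ∀ t ∈ Icc A B, (u : ℂ) ≠ (t : ℂ) := by
  intro t ht h0
  have : u = t := by exact_mod_cast h0
  rcases hu with hu | hu
  · linarith [ht.1]
  · linarith [ht.2]

theorem subMap_ofReal (h : IsSeparated ρ A B δ) {u : ℝ} (hu : u < A ∨ B < u) :
    subMap ρ (u : ℂ) = ((subMap ρ (u : ℂ)).re : ℂ) := by
  refine Complex.ext (by simp) ?_
  rw [h.im_subMap (ofReal_ne hu)]
  simp

theorem hasDerivAt_subMap_re (h : IsSeparated ρ A B δ) {u : ℝ} (hu : u < A ∨ B < u) :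
    HasDerivAt (fun x : ℝ => (subMap ρ (x : ℂ)).re) (1 - subPsi ρ (u : ℂ)) u := by
  refine (h.hasDerivAt_subMap (ofReal_ne hu)).real_of_complex.congr_deriv ?_
  have : ∫ t : ℝ, (((u : ℂ) - (t : ℂ)) ^ 2)⁻¹ ∂ρ = ((subPsi ρ (u : ℂ) : ℝ) : ℂ) := by
    unfold subPsi
    rw [← integral_complex_ofReal]
    refine integral_congr_ae (Eventually.of_forall fun t => ?_)
    simp only
    rw [← Complex.ofReal_sub, Complex.norm_real, Real.norm_eq_abs, sq_abs]
    push_cast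
    rfl
  rw [this]
  simp

theorem norm_ofReal_sub (u t : ℝ) : ‖(u : ℂ) - (t : ℂ)‖ ^ 2 = (u - t) ^ 2 := by
  rw [← Complex.ofReal_sub, Complex.norm_real, Real.norm_eq_abs, sq_abs]

/-- The contrapositive of separation, tested at the endpoint of [A, B] nearest to u. -/
theorem one_lt_subPsi (h : IsSeparated ρ A B δ) {u : ℝ} (hu : u < A ∨ B < u)
    (hd : A - δ < u ∧ u < B + δ) : 1 < subPsi ρ (u : ℂ) := by
  by_contra! hle
  have key := h.sep u (ofReal_ne hu) hle
  have e : ∀ t : ℝ, ‖(u : ℂ) - (t : ℂ)‖ = |u - t| := fun t => by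
    rw [← Complex.ofReal_sub, Complex.norm_real, Real.norm_eq_abs]
  rcases hu with hu | hu
  · have := key A ⟨le_rfl, h.A_le_B⟩
    rw [e, abs_of_neg (by linarith)] at this
    linarith [hd.1]
  · have := key B ⟨h.A_le_B, le_rfl⟩
    rw [e, abs_of_pos (by linarith)] at this
    linarith [hd.2]

theorem ne_zero (h : IsSeparated ρ A B δ) : ρ ≠ 0 := by
  rintro rfl
  have := h.one_lt_subPsi (u := B + δ / 2) (Or.inr (by linarith [h.δ_pos]))
    ⟨by linarith [h.δ_pos, h.A_le_B], by linarith [h.δ_pos]⟩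
  norm_num [subPsi] at this

theorem subPsi_lt_subPsi (h : IsSeparated ρ A B δ) {u u' : ℝ} (hu : u < A ∨ B < u)
    (hu' : u' < A ∨ B < u') (hlt : ∀ t ∈ Icc A B, (u - t) ^ 2 < (u' - t) ^ 2) :
    subPsi ρ (u' : ℂ) < subPsi ρ (u : ℂ) := by
  have hlt' : ∀ t ∈ Icc A B, (‖(u' : ℂ) - (t : ℂ)‖ ^ 2)⁻¹ < (‖(u : ℂ) - (t : ℂ)‖ ^ 2)⁻¹ := by
    intro t ht
    rw [norm_ofReal_sub, norm_ofReal_sub]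
    have : u - t ≠ 0 := by
      rcases hu with hu | hu
      · linarith [ht.1]
      · linarith [ht.2]
    exact inv_strictAnti₀ (by positivity) (hlt t ht)
  rw [← sub_pos, subPsi, subPsi, ← integral_sub (h.integrable_psi (ofReal_ne hu))
    (h.integrable_psi (ofReal_ne hu')), integral_pos_iff_support_of_nonneg_ae
    (h.ae_mem.mono fun t ht => sub_nonneg.2 (hlt' t ht).le) ((h.integrable_psi (ofReal_ne hu)).sub
    (h.integrable_psi (ofReal_ne hu'))), pos_iff_ne_zero]
  intro h0
  have := ae_neBot.2 h.ne_zero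
  have h1 := measure_eq_zero_iff_ae_notMem.1 h0
  obtain ⟨t, ht, ht'⟩ := (h.ae_mem.and h1).exists
  exact ht' (sub_pos.2 (hlt' t ht)).ne'

theorem strictMonoOn_subPsi (h : IsSeparated ρ A B δ) :
    StrictMonoOn (fun u : ℝ => subPsi ρ (u : ℂ)) (Iio A) := by
  intro u hu u' hu' hlt
  refine h.subPsi_lt_subPsi (Or.inl hu') (Or.inl hu) fun t ht => ?_
  have h1 : u' < A := hu'
  have := ht.1
  nlinarith

theorem strictAntiOn_subPsi (h : IsSeparated ρ A B δ) :
    StrictAntiOn (fun u : ℝ => subPsi ρ (u : ℂ)) (Ioi B) := by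
  intro u hu u' hu' hlt
  refine h.subPsi_lt_subPsi (Or.inr hu) (Or.inr hu') fun t ht => ?_
  have h1 : B < u := hu
  have := ht.2
  nlinarith

theorem subPsi_le_one_of_far (h : IsSeparated ρ A B δ) {u : ℝ}
    (hu : ∀ t ∈ Icc A B, ρ.real univ + 1 ≤ |u - t|) : subPsi ρ (u : ℂ) ≤ 1 := by
  have := h.finite
  have h0 : 0 ≤ ρ.real univ := measureReal_nonneg
  have h1 : ‖subPsi ρ (u : ℂ)‖ ≤ (ρ.real univ + 1)⁻¹ * ρ.real univ := by
    refine norm_integral_le_of_norm_le_const (h.ae_mem.mono fun t ht => ?_)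
    rw [norm_ofReal_sub, Real.norm_of_nonneg (by positivity), ← sq_abs]
    refine inv_anti₀ (by positivity) ?_
    have := hu t ht
    nlinarith
  refine (le_abs_self _).trans (h1.trans ?_)
  rw [inv_mul_le_one₀ (by positivity)]
  linarith

theorem continuousAt_subPsi_ofReal (h : IsSeparated ρ A B δ) {u : ℝ} (hu : u < A ∨ B < u) :
    ContinuousAt (fun u : ℝ => subPsi ρ (u : ℂ)) u :=
  ContinuousAt.comp (f := fun u : ℝ => (u : ℂ)) (h.continuousAt_subPsi (ofReal_ne hu))
    Complex.continuous_ofReal.continuousAt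

/-- Intermediate values: `subPsi` is at most 1 far away and exceeds 1 at distance δ/2 from A. -/
theorem exists_left_edge (h : IsSeparated ρ A B δ) : ∃ u < A, subPsi ρ (u : ℂ) = 1 := by
  have := h.finite
  have hδ := h.δ_pos
  have hAB := h.A_le_B
  have h0 : 0 ≤ ρ.real univ := measureReal_nonneg
  -- Distance at least mass + 1 makes `subPsi` at most 1; the extra δ guarantees l ≤ A - δ/2.
  set l := A - δ - (ρ.real univ + 1) with hl
  have h1 : subPsi ρ (l : ℂ) ≤ 1 := h.subPsi_le_one_of_far fun t ht => by
    rw [abs_of_neg (by linarith [ht.1])]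
    linarith [ht.1]
  have h2 : 1 < subPsi ρ ((A - δ / 2 : ℝ) : ℂ) :=
    h.one_lt_subPsi (Or.inl (by linarith)) ⟨by linarith, by linarith⟩
  obtain ⟨u, hu, hu1⟩ := intermediate_value_Icc (f := fun u : ℝ => subPsi ρ (u : ℂ))
    (a := l) (b := A - δ / 2) (by linarith) (fun u hu => (h.continuousAt_subPsi_ofReal
      (Or.inl (by linarith [hu.2]))).continuousWithinAt) ⟨h1, h2.le⟩
  exact ⟨u, by linarith [hu.2], hu1⟩

theorem exists_right_edge (h : IsSeparated ρ A B δ) : ∃ u > B, subPsi ρ (u : ℂ) = 1 := by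
  have := h.finite
  have hδ := h.δ_pos
  have hAB := h.A_le_B
  have h0 : 0 ≤ ρ.real univ := measureReal_nonneg
  set l := B + δ + (ρ.real univ + 1) with hl
  have h1 : subPsi ρ (l : ℂ) ≤ 1 := h.subPsi_le_one_of_far fun t ht => by
    rw [abs_of_pos (by linarith [ht.2])]
    linarith [ht.2]
  have h2 : 1 < subPsi ρ ((B + δ / 2 : ℝ) : ℂ) :=
    h.one_lt_subPsi (Or.inr (by linarith)) ⟨by linarith, by linarith⟩
  obtain ⟨u, hu, hu1⟩ := intermediate_value_Icc' (f := fun u : ℝ => subPsi ρ (u : ℂ))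
    (a := B + δ / 2) (b := l) (by linarith) (fun u hu => (h.continuousAt_subPsi_ofReal
      (Or.inr (by linarith [hu.1]))).continuousWithinAt) ⟨h1, h2.le⟩
  exact ⟨u, by linarith [hu.1], hu1⟩

theorem continuousOn_subMap_re (h : IsSeparated ρ A B δ) :
    ContinuousOn (fun x : ℝ => (subMap ρ (x : ℂ)).re) {u | u < A ∨ B < u} := fun _ hu =>
  (h.hasDerivAt_subMap_re hu).continuousAt.continuousWithinAt

/-- The derivative is 1 - ψ, and ψ increases strictly on (-∞, A): the map rises up to u₁ and falls
afterwards. -/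
theorem subMap_re_lt_left (h : IsSeparated ρ A B δ) {u₁ : ℝ} (hu₁ : u₁ < A)
    (hψ : subPsi ρ (u₁ : ℂ) = 1) {u : ℝ} (hu : u < A) (hne : u ≠ u₁) :
    (subMap ρ (u : ℂ)).re < (subMap ρ (u₁ : ℂ)).re := by
  rcases lt_or_gt_of_ne hne with hlt | hgt
  · have : StrictMonoOn (fun x : ℝ => (subMap ρ (x : ℂ)).re) (Iic u₁) := by
      refine strictMonoOn_of_deriv_pos (convex_Iic _)
        (h.continuousOn_subMap_re.mono fun x hx => Or.inl (lt_of_le_of_lt hx hu₁)) ?_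
      intro x hx
      rw [interior_Iic] at hx
      have hx' : x < A := lt_trans hx hu₁
      rw [(h.hasDerivAt_subMap_re (Or.inl hx')).deriv, sub_pos, ← hψ]
      exact h.strictMonoOn_subPsi hx' hu₁ hx
    exact this hlt.le (mem_Iic.2 le_rfl) hlt
  · have : StrictAntiOn (fun x : ℝ => (subMap ρ (x : ℂ)).re) (Ico u₁ A) := by
      refine strictAntiOn_of_deriv_neg (convex_Ico _ _)
        (h.continuousOn_subMap_re.mono fun x hx => Or.inl hx.2) ?_
      intro x hx
      rw [interior_Ico] at hx
      rw [(h.hasDerivAt_subMap_re (Or.inl hx.2)).deriv, sub_neg, ← hψ]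
      exact h.strictMonoOn_subPsi hu₁ hx.2 hx.1
    exact this ⟨le_rfl, hu₁⟩ ⟨hgt.le, hu⟩ hgt

theorem subMap_re_lt_right (h : IsSeparated ρ A B δ) {u₂ : ℝ} (hu₂ : B < u₂)
    (hψ : subPsi ρ (u₂ : ℂ) = 1) {u : ℝ} (hu : B < u) (hne : u ≠ u₂) :
    (subMap ρ (u₂ : ℂ)).re < (subMap ρ (u : ℂ)).re := by
  rcases lt_or_gt_of_ne hne with hlt | hgt
  · have : StrictAntiOn (fun x : ℝ => (subMap ρ (x : ℂ)).re) (Ioc B u₂) := by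
      refine strictAntiOn_of_deriv_neg (convex_Ioc _ _)
        (h.continuousOn_subMap_re.mono fun x hx => Or.inr hx.1) ?_
      intro x hx
      rw [interior_Ioc] at hx
      rw [(h.hasDerivAt_subMap_re (Or.inr hx.1)).deriv, sub_neg, ← hψ]
      exact h.strictAntiOn_subPsi hx.1 hu₂ hx.2
    exact this ⟨hu, hlt.le⟩ ⟨hu₂, le_rfl⟩ hlt
  · have : StrictMonoOn (fun x : ℝ => (subMap ρ (x : ℂ)).re) (Ici u₂) := by
      refine strictMonoOn_of_deriv_pos (convex_Ici _)
        (h.continuousOn_subMap_re.mono fun x hx => Or.inr (lt_of_lt_of_le hu₂ hx)) ?_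
      intro x hx
      rw [interior_Ici] at hx
      have hx' : B < x := lt_trans hu₂ hx
      rw [(h.hasDerivAt_subMap_re (Or.inr hx')).deriv, sub_pos, ← hψ]
      exact h.strictAntiOn_subPsi hu₂ hx' hx
    exact this (mem_Ici.2 le_rfl) hgt.le hgt

theorem ofReal_mem_closedDomain_left (h : IsSeparated ρ A B δ) {u₁ : ℝ} (hu₁ : u₁ < A)
    (hψ : subPsi ρ (u₁ : ℂ) = 1) {u : ℝ} (hu : u ≤ u₁) : (u : ℂ) ∈ closedDomain ρ A B := by
  refine ⟨by simp, ofReal_ne (Or.inl (by linarith)), ?_⟩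
  rw [← hψ]
  exact h.strictMonoOn_subPsi.monotoneOn (by simp; linarith) hu₁ hu

theorem ofReal_mem_closedDomain_right (h : IsSeparated ρ A B δ) {u₂ : ℝ} (hu₂ : B < u₂)
    (hψ : subPsi ρ (u₂ : ℂ) = 1) {u : ℝ} (hu : u₂ ≤ u) : (u : ℂ) ∈ closedDomain ρ A B := by
  refine ⟨by simp, ofReal_ne (Or.inr (by linarith)), ?_⟩
  rw [← hψ]
  exact h.strictAntiOn_subPsi.antitoneOn hu₂ (by simp; linarith) hu

theorem le_or_le_of_ofReal_mem (h : IsSeparated ρ A B δ) {u₁ u₂ : ℝ} (hu₁ : u₁ < A)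
    (hψ₁ : subPsi ρ (u₁ : ℂ) = 1) (hu₂ : B < u₂) (hψ₂ : subPsi ρ (u₂ : ℂ) = 1) {u : ℝ}
    (hu : (u : ℂ) ∈ closedDomain ρ A B) : u ≤ u₁ ∨ u₂ ≤ u := by
  have hout : u < A ∨ B < u := by
    by_contra! hcon
    exact hu.2.1 u hcon rfl
  rcases hout with hA | hB
  · left
    refine (h.strictMonoOn_subPsi.le_iff_le hA hu₁).1 ?_
    rw [hψ₁]
    exact hu.2.2
  · right
    refine (h.strictAntiOn_subPsi.le_iff_ge hB hu₂).1 ?_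
    rw [hψ₂]
    exact hu.2.2

/-- Intermediate values on the ray: since the displacement is at most K, the point x - K, or u₁ if
smaller, has its image at or below x. -/
theorem exists_subMap_eq_left (h : IsSeparated ρ A B δ) {u₁ : ℝ} (hu₁ : u₁ < A)
    (hψ : subPsi ρ (u₁ : ℂ) = 1) {x : ℝ} (hx : x ≤ (subMap ρ (u₁ : ℂ)).re) :
    ∃ u ≤ u₁, subMap ρ (u : ℂ) = (x : ℂ) := by
  obtain ⟨K, hK⟩ := h.norm_subMap_sub_le
  set l := min u₁ (x - K)
  have hl : l ≤ u₁ := min_le_left _ _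
  have h1 := (Complex.abs_re_le_norm _).trans
    (hK l (h.ofReal_mem_closedDomain_left hu₁ hψ hl))
  rw [Complex.sub_re, Complex.ofReal_re] at h1
  have h2 := (abs_le.1 h1).2
  have h3 : l ≤ x - K := min_le_right _ _
  obtain ⟨u, hu, hu'⟩ := intermediate_value_Icc (f := fun x : ℝ => (subMap ρ (x : ℂ)).re) hl
    (h.continuousOn_subMap_re.mono fun y hy => Or.inl (lt_of_le_of_lt hy.2 hu₁))
    (show x ∈ Icc _ _ from ⟨by linarith, hx⟩)
  refine ⟨u, hu.2, ?_⟩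
  rw [h.subMap_ofReal (Or.inl (lt_of_le_of_lt hu.2 hu₁))]
  exact_mod_cast hu'

theorem exists_subMap_eq_right (h : IsSeparated ρ A B δ) {u₂ : ℝ} (hu₂ : B < u₂)
    (hψ : subPsi ρ (u₂ : ℂ) = 1) {x : ℝ} (hx : (subMap ρ (u₂ : ℂ)).re ≤ x) :
    ∃ u ≥ u₂, subMap ρ (u : ℂ) = (x : ℂ) := by
  obtain ⟨K, hK⟩ := h.norm_subMap_sub_le
  set l := max u₂ (x + K)
  have hl : u₂ ≤ l := le_max_left _ _
  have h1 := (Complex.abs_re_le_norm _).trans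
    (hK l (h.ofReal_mem_closedDomain_right hu₂ hψ hl))
  rw [Complex.sub_re, Complex.ofReal_re] at h1
  have h2 := (abs_le.1 h1).1
  have h3 : x + K ≤ l := le_max_right _ _
  obtain ⟨u, hu, hu'⟩ := intermediate_value_Icc (f := fun x : ℝ => (subMap ρ (x : ℂ)).re) hl
    (h.continuousOn_subMap_re.mono fun y hy => Or.inr (lt_of_lt_of_le hu₂ hy.1))
    (show x ∈ Icc _ _ from ⟨hx, by linarith⟩)
  refine ⟨u, hu.1, ?_⟩
  rw [h.subMap_ofReal (Or.inr (lt_of_lt_of_le hu₂ hu.1))]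
  exact_mod_cast hu'

/-- Otherwise the value at u₂ would also be attained on the left ray, against injectivity. -/
theorem edge_lt_edge (h : IsSeparated ρ A B δ) {u₁ u₂ : ℝ} (hu₁ : u₁ < A)
    (hψ₁ : subPsi ρ (u₁ : ℂ) = 1) (hu₂ : B < u₂) (hψ₂ : subPsi ρ (u₂ : ℂ) = 1) :
    (subMap ρ (u₁ : ℂ)).re < (subMap ρ (u₂ : ℂ)).re := by
  by_contra! hle
  obtain ⟨u, hu, hu'⟩ := h.exists_subMap_eq_left hu₁ hψ₁ hle
  have := h.subMap_injOn (h.ofReal_mem_closedDomain_left hu₁ hψ₁ hu)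
    (h.ofReal_mem_closedDomain_right hu₂ hψ₂ le_rfl)
    (hu'.trans (h.subMap_ofReal (Or.inr hu₂)).symm)
  have h1 : u = u₂ := by exact_mod_cast this
  linarith [h.A_le_B]

end IsSeparated

/-! ### Cauchy transforms of probability measures on the half line -/

section CauchyProb

variable {F : Measure ℝ}

theorem im_cauchyTransform (F : Measure ℝ) [IsFiniteMeasure F] {z : ℂ} (hz : z.im ≠ 0) :
    (cauchyTransform F z).im = -(z.im * ∫ t : ℝ, (‖z - (t : ℂ)‖ ^ 2)⁻¹ ∂F) := by
  obtain ⟨d, hd, hsep⟩ := exists_pos_le_norm_sub isClosed_univ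
    (IsSeparated.ne_of_im_ne_zero hz univ)
  have hint : Integrable (fun t : ℝ => (z - (t : ℂ))⁻¹) F := by
    refine integrable_of_norm_le_on (S := univ) (by simp)
      (by fun_prop : Measurable _).aestronglyMeasurable d⁻¹ fun t ht => ?_
    rw [norm_inv]
    exact inv_anti₀ hd (hsep t ht)
  unfold cauchyTransform
  have := integral_im (𝕜 := ℂ) hint
  simp only [RCLike.im_to_complex] at this
  rw [← this, ← integral_const_mul, ← integral_neg]
  refine integral_congr_ae (Eventually.of_forall fun t => ?_)
  simp only [Complex.inv_im, Complex.sub_im, Complex.ofReal_im, sub_zero,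
    Complex.normSq_eq_norm_sq]
  ring

theorem integral_inv_norm_sq_pos (F : Measure ℝ) [IsProbabilityMeasure F] {z : ℂ}
    (hz : z.im ≠ 0) : 0 < ∫ t : ℝ, (‖z - (t : ℂ)‖ ^ 2)⁻¹ ∂F := by
  obtain ⟨d, hd, hsep⟩ := exists_pos_le_norm_sub isClosed_univ
    (IsSeparated.ne_of_im_ne_zero hz univ)
  have hint : Integrable (fun t : ℝ => (‖z - (t : ℂ)‖ ^ 2)⁻¹) F := by
    refine integrable_of_norm_le_on (S := univ) (by simp)
      (by fun_prop : Measurable _).aestronglyMeasurable (d ^ 2)⁻¹ fun t ht => ?_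
    rw [Real.norm_of_nonneg (by positivity)]
    exact inv_anti₀ (by positivity) (pow_le_pow_left₀ hd.le (hsep t ht) 2)
  rw [integral_pos_iff_support_of_nonneg (fun t => by positivity) hint]
  have : Function.support (fun t : ℝ => (‖z - (t : ℂ)‖ ^ 2)⁻¹) = univ := by
    refine eq_univ_of_forall fun t => ?_
    have : 0 < ‖z - (t : ℂ)‖ := hd.trans_le (hsep t trivial)
    exact (by positivity : (0 : ℝ) < (‖z - (t : ℂ)‖ ^ 2)⁻¹).ne'
  rw [this]
  simp

theorem cauchyTransform_neg_ofReal (F : Measure ℝ) {x : ℝ} :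
    cauchyTransform F ((-x : ℝ) : ℂ) = ((-∫ t, (t + x)⁻¹ ∂F : ℝ) : ℂ) := by
  unfold cauchyTransform
  rw [← integral_neg, ← integral_complex_ofReal]
  refine integral_congr_ae (Eventually.of_forall fun t => ?_)
  simp only
  rw [← Complex.ofReal_sub, ← Complex.ofReal_inv]
  congr 1
  rw [← inv_neg]
  congr 1
  ring

theorem integral_inv_add_pos (F : Measure ℝ) [IsProbabilityMeasure F] (hF : F (Iio 0) = 0)
    {x : ℝ} (hx : 0 < x) : 0 < ∫ t, (t + x)⁻¹ ∂F := by
  have hae : ∀ᵐ t ∂F, 0 ≤ t := (measure_eq_zero_iff_ae_notMem.1 hF).mono fun t ht => by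
    simpa using ht
  have hint : Integrable (fun t : ℝ => (t + x)⁻¹) F := by
    refine Integrable.of_bound (by fun_prop : Measurable _).aestronglyMeasurable x⁻¹
      (hae.mono fun t ht => ?_)
    rw [Real.norm_of_nonneg (by positivity)]
    exact inv_anti₀ hx (by linarith)
  rw [integral_pos_iff_support_of_nonneg_ae (hae.mono fun t ht => by
    simp only [Pi.zero_apply]; positivity) hint]
  have : F (Function.support fun t : ℝ => (t + x)⁻¹)ᶜ = 0 := by
    refine measure_eq_zero_iff_ae_notMem.2 (hae.mono fun t ht => ?_)
    have : 0 < (t + x)⁻¹ := by positivity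
    simpa using by linarith
  have h1 := measure_univ_le_add_compl (μ := F) (Function.support fun t : ℝ => (t + x)⁻¹)
  rw [this, add_zero, measure_univ] at h1
  exact lt_of_lt_of_le one_pos h1

theorem neg_mem_slitPlane {z : ℂ} (hz : -z ∈ Complex.slitPlane) : z.im ≠ 0 ∨ z.re < 0 := by
  rcases hz with hz | hz
  · right; simpa using hz
  · left; simpa using hz

/-- Off [0, ∞) the point 1/G(z) stays where `subMap` is holomorphic: Im G ≠ 0 off the real axis, and
G < 0 on the negative half line. -/
theorem inv_cauchyTransform_of_neg [IsProbabilityMeasure F] (hF : F (Iio 0) = 0) {z : ℂ}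
    (hz : -z ∈ Complex.slitPlane) :
    cauchyTransform F z ≠ 0 ∧ ∀ A B : ℝ, 0 < A → ∀ t ∈ Icc A B, (cauchyTransform F z)⁻¹ ≠ (t : ℂ) := by
  by_cases him : z.im = 0
  · have hre := (neg_mem_slitPlane hz).resolve_left (by simpa using him)
    have hzx : z = ((-(-z.re) : ℝ) : ℂ) := Complex.ext (by simp) (by simp [him])
    have hpos := integral_inv_add_pos F hF (x := -z.re) (by linarith)
    rw [hzx, cauchyTransform_neg_ofReal]
    refine ⟨by exact_mod_cast (neg_neg_of_pos hpos).ne, fun A B hA t ht h0 => ?_⟩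
    rw [← Complex.ofReal_inv] at h0
    have h1 : (-∫ t, (t + -z.re)⁻¹ ∂F)⁻¹ = t := by exact_mod_cast h0
    have h2 : (-∫ t, (t + -z.re)⁻¹ ∂F)⁻¹ < 0 := inv_lt_zero.2 (by linarith)
    linarith [ht.1]
  · have him' : (cauchyTransform F z).im ≠ 0 := by
      rw [im_cauchyTransform F him]
      exact neg_ne_zero.2 (mul_ne_zero him (integral_inv_norm_sq_pos F him).ne')
    have hne : cauchyTransform F z ≠ 0 := by
      intro h0
      rw [h0] at him'
      simp at him'
    refine ⟨hne, fun A B _ => IsSeparated.ne_of_im_ne_zero ?_ _⟩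
    rw [Complex.inv_im]
    exact div_ne_zero (neg_ne_zero.2 him') (by simpa using hne)

theorem differentiableAt_cauchyTransform_of_neg [IsProbabilityMeasure F] (hF : F (Iio 0) = 0)
    {z : ℂ} (hz : -z ∈ Complex.slitPlane) : DifferentiableAt ℂ (cauchyTransform F) z := by
  refine (hasDerivAt_cauchyTransform (S := Ici 0) isClosed_Ici (by simpa using hF)
    ?_).differentiableAt
  rintro t ht rfl
  have := neg_mem_slitPlane hz
  simp only [Complex.ofReal_im, ne_eq, not_true_eq_false, Complex.ofReal_re, false_or] at this
  exact absurd ht (not_le.2 this)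

variable {ρ : Measure ℝ} {A B δ : ℝ}

/-- Identity theorem on the connected set ℂ \ [0, ∞), where both sides are holomorphic. -/
theorem IsSeparated.subMap_inv_cauchyTransform (h : IsSeparated ρ A B δ) [IsProbabilityMeasure F]
    (hF : F (Iio 0) = 0)
    (hfun : ∀ x : ℝ, 0 < x → subMap ρ (cauchyTransform F ((-x : ℝ) : ℂ))⁻¹ = ((-x : ℝ) : ℂ))
    {z : ℂ} (hz : 0 < z.im) : subMap ρ (cauchyTransform F z)⁻¹ = z := by
  set U : Set ℂ := (fun z : ℂ => -z) ⁻¹' Complex.slitPlane with hU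
  have hUo : IsOpen U := Complex.isOpen_slitPlane.preimage continuous_neg
  have hUc : IsPreconnected U := by
    have : U = (fun z : ℂ => -z) '' Complex.slitPlane := by
      ext z
      simp [U]
    rw [this]
    have hs : IsPreconnected Complex.slitPlane :=
      (Complex.starConvex_one_slitPlane.isPathConnected
        Complex.one_mem_slitPlane).isConnected.isPreconnected
    exact hs.image _ continuous_neg.continuousOn
  have hd : DifferentiableOn ℂ (fun z => subMap ρ (cauchyTransform F z)⁻¹) U := by
    intro z hz
    obtain ⟨h0, h1⟩ := inv_cauchyTransform_of_neg hF hz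
    exact (DifferentiableAt.comp z (h.hasDerivAt_subMap (h1 A B h.A_pos)).differentiableAt
      ((differentiableAt_cauchyTransform_of_neg hF hz).inv h0)).differentiableWithinAt
  have ha := hd.analyticOnNhd hUo
  have hid : AnalyticOnNhd ℂ (fun z : ℂ => z) U := fun z _ => analyticAt_id
  have hm1 : (-1 : ℂ) ∈ U := by simp [U]
  have := ha.eqOn_of_preconnected_of_frequently_eq hid hUc hm1 ?_
  · exact this (show -z ∈ Complex.slitPlane from Or.inr (by simpa using hz.ne'))
  -- The points of agreement accumulate at -1, approached along the reals below -1.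
  · have ht : Tendsto (fun x : ℝ => ((-x : ℝ) : ℂ)) (𝓝[>] 1) (𝓝[≠] (-1 : ℂ)) := by
      refine tendsto_nhdsWithin_iff.2 ⟨?_, ?_⟩
      · have : Tendsto (fun x : ℝ => ((-x : ℝ) : ℂ)) (𝓝 1) (𝓝 ((-1 : ℝ) : ℂ)) :=
          (by fun_prop : Continuous fun x : ℝ => ((-x : ℝ) : ℂ)).tendsto 1
        simpa using this.mono_left nhdsWithin_le_nhds
      · filter_upwards [self_mem_nhdsWithin] with x hx h0
        have h1 : ((-x : ℝ) : ℂ) = ((-1 : ℝ) : ℂ) := by simpa using h0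
        have : -x = -1 := by exact_mod_cast h1
        have hx' : 1 < x := hx
        linarith
    refine ht.frequently (Eventually.frequently ?_)
    filter_upwards [self_mem_nhdsWithin] with x hx
    exact hfun x (lt_trans one_pos hx)

/-- With w = 1/G(z), both Im w and Im z = Im w · (1 - ψ(w)) are positive, so ψ(w) < 1. -/
theorem IsSeparated.inv_cauchyTransform_mem (h : IsSeparated ρ A B δ) [IsProbabilityMeasure F]
    (hF : F (Iio 0) = 0)
    (hfun : ∀ x : ℝ, 0 < x → subMap ρ (cauchyTransform F ((-x : ℝ) : ℂ))⁻¹ = ((-x : ℝ) : ℂ))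
    {z : ℂ} (hz : 0 < z.im) : (cauchyTransform F z)⁻¹ ∈ closedDomain ρ A B := by
  have him : (cauchyTransform F z).im < 0 := by
    rw [im_cauchyTransform F hz.ne']
    exact neg_neg_of_pos (mul_pos hz (integral_inv_norm_sq_pos F hz.ne'))
  have hw : 0 < ((cauchyTransform F z)⁻¹).im := by
    rw [Complex.inv_im]
    refine div_pos (by linarith) (Complex.normSq_pos.2 ?_)
    intro h0
    rw [h0] at him
    simp at him
  have hne := ne_of_im_ne_zero hw.ne' (Icc A B)
  refine ⟨hw.le, hne, ?_⟩
  have h1 := h.im_subMap hne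
  rw [h.subMap_inv_cauchyTransform hF hfun hz] at h1
  by_contra! hgt
  nlinarith

/-- The range of the closed embedding is closed and contains the open upper half plane, hence also
the real axis. The inverse of the embedding is therefore a continuous extension of 1/G to the
boundary. -/
theorem IsSeparated.exists_inverse (h : IsSeparated ρ A B δ) [IsProbabilityMeasure F]
    (hF : F (Iio 0) = 0)
    (hfun : ∀ x : ℝ, 0 < x → subMap ρ (cauchyTransform F ((-x : ℝ) : ℂ))⁻¹ = ((-x : ℝ) : ℂ)) :
    ∃ W : ℂ → ℂ, (∀ z, 0 ≤ z.im → W z ∈ closedDomain ρ A B ∧ subMap ρ (W z) = z) ∧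
      ContinuousOn W {z | 0 ≤ z.im} ∧ ∀ z, 0 < z.im → W z = (cauchyTransform F z)⁻¹ := by
  have hemb := h.isClosedEmbedding_subMap
  have hsub : {z : ℂ | 0 ≤ z.im} ⊆ range (fun w : closedDomain ρ A B => subMap ρ w) := by
    have h1 : {z : ℂ | 0 < z.im} ⊆ range (fun w : closedDomain ρ A B => subMap ρ w) :=
      fun z hz => ⟨⟨_, h.inv_cauchyTransform_mem hF hfun hz⟩,
        h.subMap_inv_cauchyTransform hF hfun hz⟩
    have h2 := closure_minimal h1 hemb.isClosed_range
    rwa [Complex.closure_setOfPred_lt_im] at h2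
  have : Nonempty (closedDomain ρ A B) :=
    ⟨⟨_, h.inv_cauchyTransform_mem hF hfun (z := Complex.I) (by simp)⟩⟩
  have hsub' : ∀ z : ℂ, 0 ≤ z.im → ∃ w : closedDomain ρ A B, subMap ρ w = z := fun z hz => hsub hz
  choose! V hV using hsub'
  refine ⟨fun z => (V z : ℂ), fun z hz => ⟨(V z).2, hV z hz⟩, ?_, fun z hz => ?_⟩
  · rw [continuousOn_iff_continuous_domRestrict]
    refine continuous_subtype_val.comp
      (hemb.isEmbedding.isInducing.continuous_iff.2 ?_ :
        Continuous fun z : {z : ℂ | 0 ≤ z.im} => V z)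
    refine continuous_subtype_val.congr fun z => ?_
    exact (hV z z.2).symm
  · exact h.subMap_injOn (V z).2 (h.inv_cauchyTransform_mem hF hfun hz)
      ((hV z hz.le).trans (h.subMap_inv_cauchyTransform hF hfun hz).symm)

end CauchyProb

/-! ### Stieltjes inversion -/

theorem im_inv_sub_ofReal (x η t : ℝ) :
    ((((x : ℂ) + η * Complex.I) - (t : ℂ))⁻¹).im = -(η / ((x - t) ^ 2 + η ^ 2)) := by
  rw [Complex.inv_im, Complex.normSq_apply]
  simp
  ring

theorem integrable_inv_cauchyTransform_aux (F : Measure ℝ) [IsFiniteMeasure F] {x η : ℝ}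
    (hη : 0 < η) : Integrable (fun t : ℝ => (((x : ℂ) + η * Complex.I) - (t : ℂ))⁻¹) F := by
  refine Integrable.of_bound (by fun_prop : Measurable _).aestronglyMeasurable η⁻¹
    (Eventually.of_forall fun t => ?_)
  rw [norm_inv]
  refine inv_anti₀ hη ?_
  refine le_trans ?_ (Complex.abs_im_le_norm _)
  simp [abs_of_pos hη]

theorem neg_im_cauchyTransform (F : Measure ℝ) [IsFiniteMeasure F] {x η : ℝ} (hη : 0 < η) :
    -(cauchyTransform F ((x : ℂ) + η * Complex.I)).im =
      ∫ t : ℝ, η / ((x - t) ^ 2 + η ^ 2) ∂F := by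
  unfold cauchyTransform
  have := integral_im (𝕜 := ℂ) (integrable_inv_cauchyTransform_aux F (x := x) hη)
  simp only [RCLike.im_to_complex] at this
  rw [← this, ← integral_neg]
  refine integral_congr_ae (Eventually.of_forall fun t => ?_)
  simp only
  rw [im_inv_sub_ofReal, neg_neg]

/-- Substituting x = t + ηy moves η from the kernel into the test function, so that dominated
convergence applies as η → 0. -/
theorem integral_mul_poisson (ψ : ℝ → ℝ) {η : ℝ} (hη : 0 < η) (t : ℝ) :
    ∫ x, ψ x * (η / ((x - t) ^ 2 + η ^ 2)) = ∫ y, ψ (t + η * y) * (1 + y ^ 2)⁻¹ := by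
  rw [← integral_add_left_eq_self (fun x => ψ x * (η / ((x - t) ^ 2 + η ^ 2))) t]
  have h := Measure.integral_comp_mul_left
    (fun x => ψ (t + x) * (η / ((t + x - t) ^ 2 + η ^ 2))) η
  have h2 : ∫ y, ψ (t + η * y) * (1 + y ^ 2)⁻¹ =
      η * ∫ x, ψ (t + η * x) * (η / ((t + η * x - t) ^ 2 + η ^ 2)) := by
    rw [← integral_const_mul]
    congr 1
    ext y
    rw [add_sub_cancel_left]
    have : 1 + y ^ 2 ≠ 0 := by positivity
    have : (η * y) ^ 2 + η ^ 2 ≠ 0 := by positivity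
    field_simp
    ring
  rw [h2, h, abs_of_pos (by positivity), smul_eq_mul, ← mul_assoc, mul_inv_cancel₀ hη.ne', one_mul]

theorem integral_mul_neg_im_cauchyTransform (F : Measure ℝ) [IsFiniteMeasure F] {ψ : ℝ → ℝ}
    (hψ : Continuous ψ) (hs : HasCompactSupport ψ) {η : ℝ} (hη : 0 < η) :
    ∫ x, ψ x * -(cauchyTransform F ((x : ℂ) + η * Complex.I)).im =
      ∫ t, (∫ y, ψ (t + η * y) * (1 + y ^ 2)⁻¹) ∂F := by
  have hint : Integrable (Function.uncurry fun x t : ℝ => ψ x * (η / ((x - t) ^ 2 + η ^ 2)))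
      (volume.prod F) := by
    have h1 : Integrable (fun q : ℝ × ℝ => ψ q.1) (volume.prod F) :=
      (hψ.integrable_of_hasCompactSupport hs).comp_fst F
    refine (h1.mul_bdd (c := η⁻¹) (g := fun q : ℝ × ℝ => η / ((q.1 - q.2) ^ 2 + η ^ 2))
      (by fun_prop : Measurable _).aestronglyMeasurable (Eventually.of_forall fun q => ?_))
    rw [Real.norm_of_nonneg (by positivity), div_le_iff₀ (by positivity), inv_mul_eq_div,
      le_div_iff₀ hη]
    nlinarith [sq_nonneg (q.1 - q.2)]
  simp only [neg_im_cauchyTransform F hη, ← integral_const_mul]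
  rw [integral_integral_swap hint]
  simp only [integral_mul_poisson ψ hη]

theorem tendsto_integral_mul_neg_im_cauchyTransform (F : Measure ℝ) [IsFiniteMeasure F]
    {ψ : ℝ → ℝ} (hψ : Continuous ψ) (hs : HasCompactSupport ψ) :
    Tendsto (fun η : ℝ => ∫ x, ψ x * -(cauchyTransform F ((x : ℂ) + η * Complex.I)).im)
      (𝓝[>] 0) (𝓝 (∫ t, ψ t * Real.pi ∂F)) := by
  obtain ⟨K, hK⟩ := hψ.bounded_above_of_compact_support hs
  have hK0 : 0 ≤ K := (norm_nonneg _).trans (hK 0)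
  have hlim : Tendsto (fun η : ℝ => ∫ t, (∫ y, ψ (t + η * y) * (1 + y ^ 2)⁻¹) ∂F)
      (𝓝[>] 0) (𝓝 (∫ t, ψ t * Real.pi ∂F)) := by
    refine tendsto_integral_filter_of_dominated_convergence (fun _ => K * Real.pi)
      (Eventually.of_forall fun η => ?_) (Eventually.of_forall fun η => ?_)
      (integrable_const _) (Eventually.of_forall fun t => ?_)
    · have : StronglyMeasurable (Function.uncurry fun t y : ℝ =>
          ψ (t + η * y) * (1 + y ^ 2)⁻¹) := by
        refine Continuous.stronglyMeasurable ?_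
        refine Continuous.mul (by fun_prop) (Continuous.inv₀ (by fun_prop) fun q => ?_)
        positivity
      exact this.integral_prod_right.aestronglyMeasurable
    · refine Eventually.of_forall fun t => ?_
      rw [← integral_univ_inv_one_add_sq, ← integral_const_mul]
      refine norm_integral_le_of_norm_le (integrable_inv_one_add_sq.const_mul K)
        (Eventually.of_forall fun y => ?_)
      rw [norm_mul, Real.norm_of_nonneg (by positivity : (0 : ℝ) ≤ (1 + y ^ 2)⁻¹)]
      exact mul_le_mul_of_nonneg_right (hK _) (by positivity)
    · rw [← integral_univ_inv_one_add_sq, ← integral_const_mul]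
      refine tendsto_integral_filter_of_dominated_convergence (fun y => K * (1 + y ^ 2)⁻¹)
        (Eventually.of_forall fun η => ?_) (Eventually.of_forall fun η => ?_)
        (integrable_inv_one_add_sq.const_mul K) (Eventually.of_forall fun y => ?_)
      · refine Continuous.aestronglyMeasurable ?_
        refine Continuous.mul (by fun_prop) (Continuous.inv₀ (by fun_prop) fun q => ?_)
        positivity
      · refine Eventually.of_forall fun y => ?_
        rw [norm_mul, Real.norm_of_nonneg (by positivity : (0 : ℝ) ≤ (1 + y ^ 2)⁻¹)]
        exact mul_le_mul_of_nonneg_right (hK _) (by positivity)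
      · refine Tendsto.mul_const _ ?_
        have : Tendsto (fun η : ℝ => ψ (t + η * y)) (𝓝 0) (𝓝 (ψ (t + 0 * y))) :=
          (by fun_prop : Continuous fun η : ℝ => ψ (t + η * y)).tendsto 0
        rw [zero_mul, add_zero] at this
        exact this.mono_left nhdsWithin_le_nhds
  refine hlim.congr' ?_
  filter_upwards [self_mem_nhdsWithin] with η hη
  exact (integral_mul_neg_im_cauchyTransform F hψ hs hη).symm

/-- The integrand iη/(iη - t) is bounded by 1 and tends to the indicator of t = 0. -/
theorem tendsto_mul_cauchyTransform_zero (F : Measure ℝ) [IsFiniteMeasure F] :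
    Tendsto (fun η : ℝ => (η * Complex.I) * cauchyTransform F (η * Complex.I))
      (𝓝[>] 0) (𝓝 (F.real {0} : ℂ)) := by
  have h1 : (F.real {0} : ℂ) = ∫ t : ℝ, ({0} : Set ℝ).indicator (fun _ => (1 : ℂ)) t ∂F := by
    rw [integral_indicator (measurableSet_singleton 0)]
    simp [Measure.real]
  rw [h1]
  simp only [cauchyTransform, ← integral_const_mul]
  refine tendsto_integral_filter_of_dominated_convergence (fun _ => 1)
    (Eventually.of_forall fun η => (by fun_prop : Measurable _).aestronglyMeasurable)
    ?_ (integrable_const _) (Eventually.of_forall fun t => ?_)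
  · filter_upwards [self_mem_nhdsWithin] with η hη
    have hη' : 0 < η := hη
    refine Eventually.of_forall fun t => ?_
    rw [norm_mul, norm_inv, ← div_eq_mul_inv]
    refine div_le_one_of_le₀ ?_ (norm_nonneg _)
    refine le_trans ?_ (Complex.abs_im_le_norm _)
    simp
  · by_cases ht : t = 0
    · subst ht
      refine (tendsto_const_nhds (x := (1 : ℂ))).congr' ?_ |>.trans (by simp)
      filter_upwards [self_mem_nhdsWithin] with η hη
      have hη' : (η : ℂ) ≠ 0 := by exact_mod_cast (ne_of_gt hη)
      rw [Complex.ofReal_zero, sub_zero, mul_inv_cancel₀ (mul_ne_zero hη' Complex.I_ne_zero)]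
    · rw [indicator_of_notMem (by simpa using ht)]
      have ht' : (t : ℂ) ≠ 0 := by exact_mod_cast ht
      have hc : ContinuousAt (fun η : ℝ => (η * Complex.I) * (η * Complex.I - (t : ℂ))⁻¹) 0 := by
        refine ContinuousAt.mul (by fun_prop) (ContinuousAt.inv₀ (by fun_prop) ?_)
        simpa using ht'
      have := hc.tendsto
      simp only [Complex.ofReal_zero, zero_mul] at this
      exact this.mono_left nhdsWithin_le_nhds

/-- Dividing by the weight x² recovers each measure away from 0. Stieltjes inversion can thus be run
with weighted test functions, which tolerate the singularity of 1/W at the origin. -/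
theorem restrict_compl_zero_eq_of_withDensity_sq {F ν : Measure ℝ} [SFinite F] [SFinite ν] (hν : ν {0} = 0)
    (h : F.withDensity (fun x => ENNReal.ofReal (x ^ 2)) =
      ν.withDensity (fun x => ENNReal.ofReal (x ^ 2))) : F.restrict {0}ᶜ = ν := by
  have key : ∀ μ : Measure ℝ, (μ.withDensity (fun x => ENNReal.ofReal (x ^ 2))).withDensity
      (fun x => ENNReal.ofReal ((x ^ 2)⁻¹)) = μ.restrict {0}ᶜ := by
    intro μ
    rw [← withDensity_mul μ (by fun_prop) (by fun_prop),
      ← withDensity_indicator_one (measurableSet_singleton 0).compl]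
    congr 1
    ext x
    simp only [Pi.mul_apply]
    rw [← ENNReal.ofReal_mul (by positivity)]
    by_cases hx : x = 0
    · simp [hx]
    · rw [mul_inv_cancel₀ (by positivity)]
      simp [hx]
  rw [← key F, h, key ν]
  refine Measure.restrict_eq_self_of_ae_mem ?_
  exact (measure_eq_zero_iff_ae_notMem.1 hν)

/-! ### The density of a measure with a given subordination map -/

namespace IsSeparated

variable {ρ F : Measure ℝ} {A B δ : ℝ}

theorem zero_mem_closedDomain_iff (h : IsSeparated ρ A B δ) :
    (0 : ℂ) ∈ closedDomain ρ A B ↔ subPsi ρ 0 ≤ 1 :=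
  ⟨fun hz => hz.2.2, fun hz => ⟨by simp, h.zero_ne, hz⟩⟩

theorem tendsto_vertical (x : ℝ) :
    Tendsto (fun η : ℝ => (x : ℂ) + η * Complex.I) (𝓝[>] 0) (𝓝[{z | 0 ≤ z.im}] (x : ℂ)) := by
  refine tendsto_nhdsWithin_iff.2 ⟨?_, ?_⟩
  · have : Tendsto (fun η : ℝ => (x : ℂ) + η * Complex.I) (𝓝 0) (𝓝 ((x : ℂ) + (0 : ℝ) * Complex.I)) :=
      (by fun_prop : Continuous fun η : ℝ => (x : ℂ) + η * Complex.I).tendsto 0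
    rw [Complex.ofReal_zero, zero_mul, add_zero] at this
    exact this.mono_left nhdsWithin_le_nhds
  · filter_upwards [self_mem_nhdsWithin] with η hη
    simpa using le_of_lt hη

/-- The mass at the origin. -/
theorem measureReal_zero (h : IsSeparated ρ A B δ) [IsProbabilityMeasure F] {W : ℂ → ℂ}
    (hW : ∀ z, 0 ≤ z.im → W z ∈ closedDomain ρ A B ∧ subMap ρ (W z) = z)
    (hWc : ContinuousOn W {z | 0 ≤ z.im})
    (hWF : ∀ z, 0 < z.im → W z = (cauchyTransform F z)⁻¹) :
    F.real {0} = if subPsi ρ 0 ≤ 1 then 1 - subPsi ρ 0 else 0 := by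
  have hv : Tendsto (fun η : ℝ => (η : ℂ) * Complex.I) (𝓝[>] 0) (𝓝[{z | 0 ≤ z.im}] 0) := by
    have := tendsto_vertical 0
    simpa using this
  have hWt : Tendsto (fun η : ℝ => W (η * Complex.I)) (𝓝[>] 0) (𝓝 (W 0)) :=
    (hWc 0 (by simp)).tendsto.comp hv
  have hne : ∀ᶠ η : ℝ in 𝓝[>] 0, W (η * Complex.I) ≠ 0 := by
    filter_upwards [self_mem_nhdsWithin] with η hη h0
    have h1 := (hW (η * Complex.I) (by simpa using le_of_lt hη)).2
    rw [h0, subMap_zero] at h1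
    have : (η : ℂ) ≠ 0 := by exact_mod_cast (ne_of_gt hη)
    exact mul_ne_zero this Complex.I_ne_zero h1.symm
  -- This is z G(z), rewritten with z = H(W(z)) and G(z) = 1/W(z).
  have hlim : Tendsto (fun η : ℝ => subMap ρ (W (η * Complex.I)) / W (η * Complex.I)) (𝓝[>] 0)
      (𝓝 (F.real {0} : ℂ)) := by
    refine (tendsto_mul_cauchyTransform_zero F).congr' ?_
    filter_upwards [self_mem_nhdsWithin] with η hη
    rw [(hW (η * Complex.I) (by simpa using le_of_lt hη)).2,
      hWF (η * Complex.I) (by simpa using hη), div_inv_eq_mul]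
  split_ifs with hψ
  -- When 0 lies in the domain, W(0) = 0 and the quotient is a difference quotient of H at 0, with
  -- limit H'(0) = 1 - ψ(0).
  · have hW0 : W 0 = 0 := h.subMap_injOn (hW 0 (by simp)).1 (h.zero_mem_closedDomain_iff.2 hψ)
      ((hW 0 (by simp)).2.trans (subMap_zero ρ).symm)
    have hd := (h.hasDerivAt_subMap h.zero_ne).tendsto_slope
    have hWt' : Tendsto (fun η : ℝ => W (η * Complex.I)) (𝓝[>] 0) (𝓝[≠] 0) :=
      tendsto_nhdsWithin_iff.2 ⟨by rwa [hW0] at hWt, hne⟩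
    have h2 := hd.comp hWt'
    have h3 := tendsto_nhds_unique hlim (h2.congr fun η => by
      simp [slope_def_field, subMap_zero])
    have h4 : ∫ t : ℝ, (((0 : ℂ) - (t : ℂ)) ^ 2)⁻¹ ∂ρ = ((subPsi ρ 0 : ℝ) : ℂ) := by
      unfold subPsi
      rw [← integral_complex_ofReal]
      refine integral_congr_ae (Eventually.of_forall fun t => ?_)
      simp
    rw [h4] at h3
    exact_mod_cast h3
  -- When 0 is outside the domain, W(0) ≠ 0 and the quotient z/W(z) simply tends to 0.
  · have hW0 : W 0 ≠ 0 := by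
      intro h0
      have := (hW 0 (by simp)).1
      rw [h0] at this
      exact hψ this.2.2
    have h1 : Tendsto (fun η : ℝ => subMap ρ (W (η * Complex.I))) (𝓝[>] 0) (𝓝 0) := by
      refine (hv.mono_right nhdsWithin_le_nhds).congr' ?_
      filter_upwards [self_mem_nhdsWithin] with η hη
      exact ((hW (η * Complex.I) (by simpa using le_of_lt hη)).2).symm
    have h2 := tendsto_nhds_unique hlim (h1.div hWt hW0)
    rw [zero_div] at h2
    exact_mod_cast h2

/-- W vanishes at most at the origin, where |x| ≤ K|W(x)| bounds x²/|W(x)| by K|x|. -/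
theorem continuous_sq_mul_density (h : IsSeparated ρ A B δ) {W : ℂ → ℂ}
    (hW : ∀ z, 0 ≤ z.im → W z ∈ closedDomain ρ A B ∧ subMap ρ (W z) = z)
    (hWc : ContinuousOn W {z | 0 ≤ z.im}) :
    ContinuousOn (fun x : ℝ => ((W x)⁻¹).im) {0}ᶜ ∧
    Continuous fun x : ℝ => x ^ 2 * ((W x)⁻¹).im := by
  have hne : ∀ x : ℝ, x ≠ 0 → W x ≠ 0 := by
    intro x hx h0
    have := (hW x (by simp)).2
    rw [h0, subMap_zero] at this
    exact hx (by exact_mod_cast this.symm)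
  have hWr : Continuous fun x : ℝ => W x :=
    hWc.comp_continuous Complex.continuous_ofReal fun x => by simp
  have hc : ∀ x : ℝ, x ≠ 0 → ContinuousAt (fun x : ℝ => ((W x)⁻¹).im) x := fun x hx =>
    Complex.continuous_im.continuousAt.comp (hWr.continuousAt.inv₀ (hne x hx))
  refine ⟨fun x hx => (hc x hx).continuousWithinAt, continuous_iff_continuousAt.2 fun x => ?_⟩
  by_cases hx : x = 0
  · subst hx
    obtain ⟨K, hK0, hK⟩ := h.norm_subMap_le_mul
    have hb : ∀ x : ℝ, ‖x ^ 2 * ((W x)⁻¹).im‖ ≤ K * |x| := by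
      intro x
      by_cases hx : x = 0
      · simp [hx]
      · have h1 := hK (W x) (hW x (by simp)).1
        rw [(hW x (by simp)).2, Complex.norm_real, Real.norm_eq_abs] at h1
        have h2 : 0 < ‖W x‖ := norm_pos_iff.2 (hne x hx)
        have h3 : |((W x)⁻¹).im| ≤ ‖W x‖⁻¹ := by
          rw [← norm_inv]
          exact Complex.abs_im_le_norm _
        rw [norm_mul, norm_pow, Real.norm_eq_abs, Real.norm_eq_abs]
        calc |x| ^ 2 * |((W x)⁻¹).im| ≤ |x| ^ 2 * ‖W x‖⁻¹ := by gcongr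
          _ = |x| * (|x| / ‖W x‖) := by ring
          _ ≤ |x| * K := by
            gcongr
            rwa [div_le_iff₀ h2]
          _ = K * |x| := mul_comm _ _
    have h0 : Tendsto (fun x : ℝ => K * |x|) (𝓝 0) (𝓝 0) := by
      have : Tendsto (fun x : ℝ => K * |x|) (𝓝 0) (𝓝 (K * |(0 : ℝ)|)) :=
        (by fun_prop : Continuous fun x : ℝ => K * |x|).tendsto 0
      simpa using this
    have := squeeze_zero_norm hb h0
    simpa [ContinuousAt] using this
  · exact ContinuousAt.mul (by fun_prop) (hc x hx)

/-- Both sides, multiplied by x², are compared on compactly supported functions. The integrals of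
-Im G(x + iη) against x²φ(x) have two limits as η → 0: one from the Poisson kernel, one from the
continuity of W up to the real axis. -/
theorem restrict_compl_zero (h : IsSeparated ρ A B δ) [IsProbabilityMeasure F] {W : ℂ → ℂ}
    (hW : ∀ z, 0 ≤ z.im → W z ∈ closedDomain ρ A B ∧ subMap ρ (W z) = z)
    (hWc : ContinuousOn W {z | 0 ≤ z.im})
    (hWF : ∀ z, 0 < z.im → W z = (cauchyTransform F z)⁻¹) :
    F.restrict {0}ᶜ =
      volume.withDensity fun x : ℝ => ENNReal.ofReal (-((W x)⁻¹).im / Real.pi) := by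
  obtain ⟨hc1, hc2⟩ := h.continuous_sq_mul_density hW hWc
  have hmeas : Measurable fun x : ℝ => -((W x)⁻¹).im / Real.pi := by
    have hWr : Continuous fun x : ℝ => W x :=
      hWc.comp_continuous Complex.continuous_ofReal fun x => by simp
    exact ((Complex.measurable_im.comp hWr.measurable.inv).neg).div_const _
  have hnn : ∀ x : ℝ, 0 ≤ -((W x)⁻¹).im / Real.pi := by
    intro x
    have e : -((W x)⁻¹).im / Real.pi = (W x).im / Complex.normSq (W x) / Real.pi := by
      rw [Complex.inv_im]
      ring
    rw [e]
    have := (hW x (by simp)).1.1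
    have := Complex.normSq_nonneg (W x)
    positivity
  refine restrict_compl_zero_eq_of_withDensity_sq
    ((withDensity_absolutelyContinuous _ _) (by simp)) ?_
  rw [← withDensity_mul volume (by fun_prop) (by fun_prop)]
  have hprod : ((fun x : ℝ => ENNReal.ofReal (-((W x)⁻¹).im / Real.pi)) *
      fun x : ℝ => ENNReal.ofReal (x ^ 2)) =
      fun x : ℝ => ENNReal.ofReal (-(x ^ 2 * ((W x)⁻¹).im) / Real.pi) := by
    ext x
    rw [Pi.mul_apply, ← ENNReal.ofReal_mul (hnn x)]
    congr 1
    ring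
  rw [hprod]
  have hlf1 : IsLocallyFiniteMeasure (F.withDensity fun x => ENNReal.ofReal (x ^ 2)) :=
    IsLocallyFiniteMeasure.withDensity_ofReal (by fun_prop)
  have hlf2 : IsLocallyFiniteMeasure (volume.withDensity fun x : ℝ =>
      ENNReal.ofReal (-(x ^ 2 * ((W x)⁻¹).im) / Real.pi)) :=
    IsLocallyFiniteMeasure.withDensity_ofReal (by fun_prop)
  refine Measure.ext_of_integral_eq_on_compactlySupported fun φ => ?_
  rw [integral_withDensity_eq_integral_toReal_smul (by fun_prop) (by simp),
    integral_withDensity_eq_integral_toReal_smul (by fun_prop) (by simp)]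
  have hnn2 : ∀ x : ℝ, 0 ≤ -(x ^ 2 * ((W x)⁻¹).im) / Real.pi := fun x => by
    have e : -(x ^ 2 * ((W x)⁻¹).im) / Real.pi = x ^ 2 * (-((W x)⁻¹).im / Real.pi) := by ring
    rw [e]
    exact mul_nonneg (sq_nonneg x) (hnn x)
  simp only [ENNReal.toReal_ofReal (sq_nonneg _), ENNReal.toReal_ofReal (hnn2 _), smul_eq_mul]
  have hφ := φ.continuous
  have hφs := φ.hasCompactSupport
  have hψs : HasCompactSupport fun x : ℝ => x ^ 2 * φ x := hφs.mul_left
  have hlim1 := tendsto_integral_mul_neg_im_cauchyTransform F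
    (by fun_prop : Continuous fun x : ℝ => x ^ 2 * φ x) hψs
  obtain ⟨K, hK0, hK⟩ := h.norm_subMap_le_mul
  have hlim2 : Tendsto (fun η : ℝ => ∫ x, (x ^ 2 * φ x) *
      -(cauchyTransform F ((x : ℂ) + η * Complex.I)).im) (𝓝[>] 0)
      (𝓝 (∫ x : ℝ, (x ^ 2 * φ x) * -((W x)⁻¹).im)) := by
    -- The majorant comes from |x| ≤ |z| ≤ K|W(z)|: one factor |x| absorbs 1/|W(z)|, uniformly in η.
    refine tendsto_integral_filter_of_dominated_convergence (fun x => |x| * ‖φ x‖ * K)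
      ?_ ?_ ?_ ?_
    · filter_upwards [self_mem_nhdsWithin] with η hη
      have hη' : (0 : ℝ) < η := hη
      refine AEStronglyMeasurable.mul (by fun_prop) ?_
      have : Continuous fun x : ℝ => W ((x : ℂ) + η * Complex.I) :=
        hWc.comp_continuous (by fun_prop) fun x => by simpa using hη'.le
      have h3 : Measurable fun x : ℝ => -((W ((x : ℂ) + η * Complex.I))⁻¹).im :=
        (Complex.measurable_im.comp this.measurable.inv).neg
      refine h3.aestronglyMeasurable.congr (Eventually.of_forall fun x => ?_)
      simp only
      rw [hWF _ (by simpa using hη'), inv_inv]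
    · filter_upwards [self_mem_nhdsWithin] with η hη
      have hη' : (0 : ℝ) < η := hη
      refine Eventually.of_forall fun x => ?_
      set z : ℂ := (x : ℂ) + η * Complex.I
      have hz : 0 < z.im := by simpa [z] using hη'
      have h1 := hK (W z) (hW z hz.le).1
      rw [(hW z hz.le).2] at h1
      have hz0 : 0 < ‖z‖ := norm_pos_iff.2 fun h0 => by simp [h0] at hz
      have hw0 : 0 < ‖W z‖ := by
        by_contra! hle
        nlinarith
      have h2 : |x| ≤ ‖z‖ := by
        have := Complex.abs_re_le_norm z
        simpa [z] using this
      have h3 : cauchyTransform F z = (W z)⁻¹ := by rw [hWF z hz, inv_inv]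
      have h4 : |((W z)⁻¹).im| ≤ ‖W z‖⁻¹ := by
        rw [← norm_inv]
        exact Complex.abs_im_le_norm _
      rw [h3, norm_mul, norm_mul, norm_pow, norm_neg, Real.norm_eq_abs, Real.norm_eq_abs (Complex.im _)]
      calc |x| ^ 2 * ‖φ x‖ * |((W z)⁻¹).im| ≤ |x| ^ 2 * ‖φ x‖ * ‖W z‖⁻¹ := by gcongr
        _ = |x| * ‖φ x‖ * (|x| / ‖W z‖) := by ring
        _ ≤ |x| * ‖φ x‖ * K := by
          gcongr
          rw [div_le_iff₀ hw0]
          linarith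
    · refine Integrable.mul_const ?_ K
      have : HasCompactSupport fun x : ℝ => |x| * ‖φ x‖ := hφs.norm.mul_left
      exact (by fun_prop : Continuous fun x : ℝ => |x| * ‖φ x‖).integrable_of_hasCompactSupport this
    · refine Eventually.of_forall fun x => ?_
      by_cases hx : x = 0
      · simp [hx]
      · refine Tendsto.const_mul _ ?_
        have hne : W x ≠ 0 := by
          intro h0
          have := (hW x (by simp)).2
          rw [h0, subMap_zero] at this
          exact hx (by exact_mod_cast this.symm)
        have h1 : Tendsto (fun η : ℝ => W ((x : ℂ) + η * Complex.I)) (𝓝[>] 0) (𝓝 (W x)) :=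
          (hWc x (by simp)).tendsto.comp (tendsto_vertical x)
        have h2 := ((Complex.continuous_im.tendsto _).comp (h1.inv₀ hne)).neg
        refine h2.congr' ?_
        filter_upwards [self_mem_nhdsWithin] with η hη
        simp only [Function.comp]
        rw [hWF _ (by simpa using hη), inv_inv]
  have heq := tendsto_nhds_unique hlim1 hlim2
  rw [integral_mul_const] at heq
  rw [eq_div_of_mul_eq Real.pi_ne_zero heq, ← integral_div]
  congr 1
  ext x
  ring

end IsSeparated

/-! ### Existence of the density and location of its support -/

namespace IsSeparated

variable {ρ F : Measure ℝ} {A B δ : ℝ}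

/-- The density is Im W/(π|W|²), so its support is decided by where W is real. At real x ≤ x₁ or x ≥
x₂ injectivity identifies W(x) with a real preimage; strictly between, a real W(x) would lie on one
of the two rays, whose images avoid (x₁, x₂). -/
theorem exists_density (h : IsSeparated ρ A B δ) [IsProbabilityMeasure F]
    (hF : F (Iio 0) = 0)
    (hfun : ∀ x : ℝ, 0 < x → subMap ρ (cauchyTransform F ((-x : ℝ) : ℂ))⁻¹ = ((-x : ℝ) : ℂ))
    {u₁ u₂ x₁ x₂ : ℝ} (hu₁ : u₁ < A) (hψ₁ : subPsi ρ (u₁ : ℂ) = 1) (hu₂ : B < u₂)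
    (hψ₂ : subPsi ρ (u₂ : ℂ) = 1) (hx₁ : x₁ = (subMap ρ (u₁ : ℂ)).re)
    (hx₂ : x₂ = (subMap ρ (u₂ : ℂ)).re) :
    ∃ g : ℝ → ℝ, 0 ≤ x₁ ∧ x₁ < x₂ ∧ (∀ x, 0 ≤ g x) ∧ (∀ x, x ∉ Icc x₁ x₂ → g x = 0) ∧
      (subPsi ρ 0 ≠ 1 → ContinuousOn g (Icc x₁ x₂)) ∧ ContinuousOn g (Icc x₁ x₂ \ {0}) ∧
      (volume.withDensity fun x => ENNReal.ofReal (g x)).support = Icc x₁ x₂ ∧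
      F = ENNReal.ofReal (if subPsi ρ 0 ≤ 1 then 1 - subPsi ρ 0 else 0) • Measure.dirac 0 +
        volume.withDensity fun x => ENNReal.ofReal (g x) := by
  obtain ⟨W, hW, hWc, hWF⟩ := h.exists_inverse hF hfun
  have hlt : x₁ < x₂ := by rw [hx₁, hx₂]; exact h.edge_lt_edge hu₁ hψ₁ hu₂ hψ₂
  -- x₁ is the strict maximum of the map on (-∞, A), a ray containing 0, where the value is 0.
  have hx₁0 : u₁ ≠ 0 → 0 < x₁ := by
    intro hne
    have := h.subMap_re_lt_left hu₁ hψ₁ h.A_pos hne.symm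
    rw [Complex.ofReal_zero, subMap_zero, Complex.zero_re] at this
    rwa [hx₁]
  have hx₁nn : 0 ≤ x₁ := by
    by_cases hne : u₁ = 0
    · rw [hx₁, hne, Complex.ofReal_zero, subMap_zero, Complex.zero_re]
    · exact (hx₁0 hne).le
  have hWl : ∀ x : ℝ, x ≤ x₁ → (W x).im = 0 := by
    intro x hx
    obtain ⟨u, hu, hu'⟩ := h.exists_subMap_eq_left hu₁ hψ₁ (hx₁ ▸ hx)
    have := h.subMap_injOn (hW x (by simp)).1 (h.ofReal_mem_closedDomain_left hu₁ hψ₁ hu)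
      ((hW x (by simp)).2.trans hu'.symm)
    rw [this, Complex.ofReal_im]
  have hWr : ∀ x : ℝ, x₂ ≤ x → (W x).im = 0 := by
    intro x hx
    obtain ⟨u, hu, hu'⟩ := h.exists_subMap_eq_right hu₂ hψ₂ (hx₂ ▸ hx)
    have := h.subMap_injOn (hW x (by simp)).1 (h.ofReal_mem_closedDomain_right hu₂ hψ₂ hu)
      ((hW x (by simp)).2.trans hu'.symm)
    rw [this, Complex.ofReal_im]
  have hWm : ∀ x : ℝ, x ∈ Ioo x₁ x₂ → 0 < (W x).im := by
    intro x hx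
    refine lt_of_le_of_ne (hW x (by simp)).1.1 fun him => ?_
    have hre : W x = ((W x).re : ℂ) := Complex.ext (by simp) (by simp [← him])
    have hmem := (hW x (by simp)).1
    have hval := (hW x (by simp)).2
    rw [hre] at hmem hval
    have hval' := congrArg Complex.re hval
    rw [Complex.ofReal_re] at hval'
    rcases h.le_or_le_of_ofReal_mem hu₁ hψ₁ hu₂ hψ₂ hmem with hle | hle
    · rcases eq_or_ne (W x).re u₁ with he | he
      · rw [he, ← hx₁] at hval'
        exact hx.1.ne hval'
      · have := h.subMap_re_lt_left hu₁ hψ₁ (lt_of_le_of_lt hle hu₁) he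
        rw [hval', ← hx₁] at this
        exact lt_asymm this hx.1
    · rcases eq_or_ne (W x).re u₂ with he | he
      · rw [he, ← hx₂] at hval'
        exact hx.2.ne hval'.symm
      · have := h.subMap_re_lt_right hu₂ hψ₂ (lt_of_lt_of_le hu₂ hle) he
        rw [hval', ← hx₂] at this
        exact lt_asymm this hx.2
  have hg : ∀ x : ℝ, -((W x)⁻¹).im / Real.pi = (W x).im / Complex.normSq (W x) / Real.pi := by
    intro x
    rw [Complex.inv_im]
    ring
  set g : ℝ → ℝ := fun x => -((W x)⁻¹).im / Real.pi with hgdef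
  have hg0 : ∀ x, 0 ≤ g x := fun x => by
    simp only [hgdef]
    rw [hg]
    have := (hW x (by simp)).1.1
    have := Complex.normSq_nonneg (W x)
    positivity
  have hgz : ∀ x, x ∉ Ioo x₁ x₂ → g x = 0 := by
    intro x hx
    simp only [hgdef]
    rw [hg]
    have : (W x).im = 0 := by
      by_contra hne
      refine hx ⟨?_, ?_⟩
      · by_contra! hle
        exact hne (hWl x hle)
      · by_contra! hle
        exact hne (hWr x hle)
    rw [this]
    simp
  have hgpos : ∀ x ∈ Ioo x₁ x₂, 0 < g x := by
    intro x hx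
    have h1 := hWm x hx
    have h2 : 0 < Complex.normSq (W x) := Complex.normSq_pos.2 fun h0 => by simp [h0] at h1
    simp only [hgdef]
    rw [hg]
    positivity
  have hcont : ContinuousOn g {0}ᶜ :=
    ((h.continuous_sq_mul_density hW hWc).1.neg).div_const _
  have hgm : Measurable g := by
    have hWr : Continuous fun x : ℝ => W x :=
      hWc.comp_continuous Complex.continuous_ofReal fun x => by simp
    exact ((Complex.measurable_im.comp hWr.measurable.inv).neg).div_const _
  refine ⟨g, hx₁nn, hlt, hg0, fun x hx => hgz x fun hx' => hx (Ioo_subset_Icc_self hx'), ?_,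
    hcont.mono fun x hx => hx.2, ?_, ?_⟩
  -- ψ(0) ≠ 1 means u₁ ≠ 0, hence x₁ > 0, so the origin, the only possible discontinuity, lies
  -- outside the interval.
  · intro hne
    have hu0 : u₁ ≠ 0 := by
      rintro rfl
      exact hne (by simpa using hψ₁)
    refine hcont.mono fun x hx => ?_
    have := hx₁0 hu0
    exact (by linarith [hx.1] : 0 < x).ne'
  · refine Subset.antisymm ?_ ?_
    · refine Measure.support_subset_of_isClosed isClosed_Icc ?_
      rw [mem_ae_iff, withDensity_apply _ measurableSet_Icc.compl,
        setLIntegral_congr_fun (g := fun _ => 0) measurableSet_Icc.compl]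
      · simp
      · intro x hx
        simp only
        rw [hgz x fun hx' => hx (Ioo_subset_Icc_self hx'), ENNReal.ofReal_zero]
    · rw [← closure_Ioo hlt.ne]
      refine closure_minimal ?_ Measure.isClosed_support
      intro x hx
      rw [Measure.mem_support_iff_forall]
      intro U hU
      have hU' : U ∩ Ioo x₁ x₂ ∈ 𝓝 x := inter_mem hU (Ioo_mem_nhds hx.1 hx.2)
      obtain ⟨V, hVU, hVo, hxV⟩ := mem_nhds_iff.1 hU'
      refine lt_of_lt_of_le ?_ (measure_mono (hVU.trans inter_subset_left))
      rw [withDensity_apply _ hVo.measurableSet, setLIntegral_pos_iff (by fun_prop)]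
      have : Function.support (fun x => ENNReal.ofReal (g x)) ∩ V = V := by
        refine inter_eq_right.2 fun y hy => ?_
        simp only [Function.mem_support, ne_eq, ENNReal.ofReal_eq_zero, not_le]
        exact hgpos y (hVU hy).2
      rw [this]
      exact hVo.measure_pos _ ⟨x, hxV⟩
  · rw [← h.restrict_compl_zero hW hWc hWF, ← h.measureReal_zero hW hWc hWF]
    have h1 := Measure.restrict_add_restrict_compl (μ := F) (measurableSet_singleton (0 : ℝ))
    rw [Measure.restrict_singleton] at h1
    rw [Measure.real, ENNReal.ofReal_toReal (measure_ne_top _ _), h1]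

end IsSeparated

/-! ### The measure attached to a spectral density -/

/-- The image under `θ ↦ c·2πf(θ)` of the measure with density `c(2πf(θ))²/(2π)` on `[0, 2π]`. -/
noncomputable def symbolMeasure (f : ℝ → ℝ) (c : ℝ) : Measure ℝ :=
  ((volume.restrict (Ioc 0 (2 * Real.pi))).withDensity fun θ =>
    ENNReal.ofReal ((c * (2 * Real.pi * f θ)) ^ 2 / (2 * Real.pi * c))).map
    fun θ => c * (2 * Real.pi * f θ)

theorem integral_symbolMeasure {f : ℝ → ℝ} (hf : Continuous f) {c : ℝ} (hc : 0 < c)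
    {E : Type*} [NormedAddCommGroup E] [NormedSpace ℝ E] {k : ℝ → E}
    (hk : StronglyMeasurable k) :
    ∫ t, k t ∂(symbolMeasure f c) = ∫ θ in (0 : ℝ)..(2 * Real.pi),
      ((c * (2 * Real.pi * f θ)) ^ 2 / (2 * Real.pi * c)) • k (c * (2 * Real.pi * f θ)) := by
  have hpi := Real.pi_pos
  rw [symbolMeasure, integral_map (by fun_prop) hk.aestronglyMeasurable,
    integral_withDensity_eq_integral_toReal_smul (by fun_prop) (by simp),
    intervalIntegral.integral_of_le (by positivity)]
  refine integral_congr_ae (Eventually.of_forall fun θ => ?_)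
  simp only
  rw [ENNReal.toReal_ofReal (by positivity)]

/-- As f is Lipschitz, an interval of length d next to a preimage of t is mapped within Ld of t, so
ρ puts mass at least const · d there. If |w - t| = d, this mass lies within (1 + L)d of w and forces
ψ(w) ≥ const/d; hence ψ(w) ≤ 1 excludes small d. -/
theorem isSeparated_symbolMeasure {f : ℝ → ℝ} (hf : Continuous f) {K : ℝ} (hK0 : 0 ≤ K)
    (hK : ∀ θ ∈ Icc 0 (2 * Real.pi), ∀ θ' ∈ Icc 0 (2 * Real.pi), |f θ - f θ'| ≤ K * |θ - θ'|)
    {a b : ℝ} (ha : IsLeast ((fun θ => 2 * Real.pi * f θ) '' Icc 0 (2 * Real.pi)) a)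
    (hb : IsGreatest ((fun θ => 2 * Real.pi * f θ) '' Icc 0 (2 * Real.pi)) b)
    (ha0 : 0 < a) {c : ℝ} (hc : 0 < c) :
    ∃ δ, IsSeparated (symbolMeasure f c) (a * c) (b * c) δ := by
  have hpi := Real.pi_pos
  set V : ℝ → ℝ := fun θ => c * (2 * Real.pi * f θ) with hV
  have hVc : Continuous V := by fun_prop
  have hVmem : ∀ θ ∈ Icc 0 (2 * Real.pi), V θ ∈ Icc (a * c) (b * c) := by
    intro θ hθ
    have h1 := ha.2 (mem_image_of_mem _ hθ)
    have h2 := hb.2 (mem_image_of_mem _ hθ)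
    constructor <;> simp only [hV] <;> nlinarith
  set L := c * (2 * Real.pi * K) with hL
  have hL0 : 0 ≤ L := by positivity
  have hVL : ∀ θ ∈ Icc 0 (2 * Real.pi), ∀ θ' ∈ Icc 0 (2 * Real.pi),
      |V θ - V θ'| ≤ L * |θ - θ'| := by
    intro θ hθ θ' hθ'
    have : V θ - V θ' = c * (2 * Real.pi) * (f θ - f θ') := by simp only [hV]; ring
    rw [this, abs_mul, abs_of_pos (by positivity : 0 < c * (2 * Real.pi))]
    have := mul_le_mul_of_nonneg_left (hK θ hθ θ' hθ') (by positivity : 0 ≤ c * (2 * Real.pi))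
    refine this.trans_eq ?_
    simp only [hL]
    ring
  have hfin : IsFiniteMeasure (symbolMeasure f c) := by
    have : IsFiniteMeasure ((volume.restrict (Ioc 0 (2 * Real.pi))).withDensity fun θ =>
        ENNReal.ofReal ((c * (2 * Real.pi * f θ)) ^ 2 / (2 * Real.pi * c))) := by
      refine isFiniteMeasure_withDensity_ofReal ?_
      exact ((by fun_prop : Continuous fun θ => (c * (2 * Real.pi * f θ)) ^ 2 /
        (2 * Real.pi * c)).integrableOn_Ioc).2
    unfold symbolMeasure
    infer_instance
  -- The minimal density of the weight over (1 + L)²: exactly the constant for which ψ(w) ≥ δ₁/d.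
  set δ₁ := (a * c) ^ 2 / (2 * Real.pi * c) / (1 + L) ^ 2 with hδ₁
  have hδ₁0 : 0 < δ₁ := by positivity
  have hsupp : symbolMeasure f c (Icc (a * c) (b * c))ᶜ = 0 := by
    rw [symbolMeasure, Measure.map_apply (by fun_prop) measurableSet_Icc.compl,
      withDensity_apply _ (hVc.measurable measurableSet_Icc.compl),
      Measure.restrict_restrict (hVc.measurable measurableSet_Icc.compl)]
    have : ((fun θ => c * (2 * Real.pi * f θ)) ⁻¹' (Icc (a * c) (b * c))ᶜ) ∩
        Ioc 0 (2 * Real.pi) = ∅ := by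
      ext θ
      simp only [mem_inter_iff, mem_preimage, mem_compl_iff, mem_empty_iff_false, iff_false]
      exact fun hθ => hθ.1 (hVmem θ (Ioc_subset_Icc_self hθ.2))
    rw [this]
    simp
  refine ⟨min 1 δ₁, hfin, by positivity, ?_, hsupp, lt_min one_pos hδ₁0, ?_⟩
  · have := hVmem 0 ⟨le_rfl, by positivity⟩
    exact this.1.trans this.2
  · intro w hw hψ t ht
    have hd : 0 < ‖w - (t : ℂ)‖ := norm_pos_iff.2 (sub_ne_zero.2 (hw t ht))
    set d := ‖w - (t : ℂ)‖ with hddef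
    by_contra! hlt
    have hd1 : d < 1 := hlt.trans_le (min_le_left _ _)
    have hd2 : d < δ₁ := hlt.trans_le (min_le_right _ _)
    obtain ⟨θ₀, hθ₀, hVθ₀⟩ : ∃ θ ∈ Icc 0 (2 * Real.pi), V θ = t := by
      obtain ⟨θa, hθa, hfa⟩ := ha.1
      obtain ⟨θb, hθb, hfb⟩ := hb.1
      have := (isPreconnected_Icc (a := (0 : ℝ)) (b := 2 * Real.pi)).intermediate_value hθa hθb
        hVc.continuousOn
      refine this ⟨?_, ?_⟩
      · simp only at hfa
        simp only [hV, hfa]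
        linarith [ht.1]
      · simp only at hfb
        simp only [hV, hfb]
        linarith [ht.2]
    -- The interval is laid to the right of θ₀ or to its left, according to the half of [0, 2π]
    -- containing θ₀; d < 1 makes it fit.
    obtain ⟨l, hl0, hl2, hlθ⟩ : ∃ l : ℝ, 0 ≤ l ∧ l + d ≤ 2 * Real.pi ∧
        ∀ θ ∈ Ioc l (l + d), |θ - θ₀| ≤ d := by
      by_cases hθ : θ₀ ≤ Real.pi
      · refine ⟨θ₀, hθ₀.1, by linarith [Real.pi_gt_three], fun θ hθ => ?_⟩
        rw [abs_le]
        constructor <;> linarith [hθ.1, hθ.2]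
      · refine ⟨θ₀ - d, by linarith [Real.pi_gt_three], by linarith [hθ₀.2], fun θ hθ => ?_⟩
        rw [abs_le]
        constructor <;> linarith [hθ.1, hθ.2]
    have hmass : ENNReal.ofReal ((a * c) ^ 2 / (2 * Real.pi * c) * d) ≤
        symbolMeasure f c {T : ℝ | |T - t| ≤ L * d} := by
      have hms : MeasurableSet {T : ℝ | |T - t| ≤ L * d} :=
        (isClosed_le (by fun_prop) (by fun_prop)).measurableSet
      rw [symbolMeasure, Measure.map_apply (by fun_prop) hms,
        withDensity_apply _ (hVc.measurable hms), Measure.restrict_restrict (hVc.measurable hms)]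
      calc ENNReal.ofReal ((a * c) ^ 2 / (2 * Real.pi * c) * d)
          = ∫⁻ θ in Ioc l (l + d), ENNReal.ofReal ((a * c) ^ 2 / (2 * Real.pi * c)) := by
            rw [setLIntegral_const, Real.volume_Ioc, add_sub_cancel_left,
              ENNReal.ofReal_mul (by positivity)]
        _ ≤ ∫⁻ θ in Ioc l (l + d), ENNReal.ofReal ((c * (2 * Real.pi * f θ)) ^ 2 /
              (2 * Real.pi * c)) := by
            refine setLIntegral_mono (by fun_prop) fun θ hθ => ENNReal.ofReal_le_ofReal ?_
            have h1 := (hVmem θ ⟨by linarith [hθ.1], by linarith [hθ.2]⟩).1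
            have : 0 < a * c := by positivity
            gcongr
        _ ≤ _ := by
            refine lintegral_mono_set fun θ hθ => ?_
            have hθI : θ ∈ Ioc 0 (2 * Real.pi) := ⟨by linarith [hθ.1], by linarith [hθ.2]⟩
            refine ⟨?_, hθI⟩
            change |V θ - t| ≤ L * d
            rw [← hVθ₀]
            refine (hVL θ (Ioc_subset_Icc_self hθI) θ₀ hθ₀).trans ?_
            exact mul_le_mul_of_nonneg_left (hlθ θ hθ) hL0
    have hint : Integrable (fun T : ℝ => (‖w - (T : ℂ)‖ ^ 2)⁻¹) (symbolMeasure f c) := by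
      obtain ⟨e, he, hsep⟩ := exists_pos_le_norm_sub isClosed_Icc hw
      refine integrable_of_norm_le_on hsupp (by fun_prop : Measurable _).aestronglyMeasurable
        (e ^ 2)⁻¹ fun T hT => ?_
      rw [Real.norm_of_nonneg (by positivity)]
      exact inv_anti₀ (by positivity) (pow_le_pow_left₀ he.le (hsep T hT) 2)
    -- Markov's inequality at the level ((1 + L)d)⁻² bounds ψ(w) below by the mass close to t.
    have hmarkov := mul_meas_ge_le_integral_of_nonneg (μ := symbolMeasure f c)
      (f := fun T : ℝ => (‖w - (T : ℂ)‖ ^ 2)⁻¹)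
      (Eventually.of_forall fun T => by simp only [Pi.zero_apply]; positivity) hint
      (((1 + L) * d) ^ 2)⁻¹
    have hsub : {T : ℝ | |T - t| ≤ L * d} ∩ Icc (a * c) (b * c) ⊆
        {T : ℝ | (((1 + L) * d) ^ 2)⁻¹ ≤ (‖w - (T : ℂ)‖ ^ 2)⁻¹} := by
      intro T hT
      have hpos : 0 < ‖w - (T : ℂ)‖ := norm_pos_iff.2 (sub_ne_zero.2 (hw T hT.2))
      have htri : ‖w - (T : ℂ)‖ ≤ ‖w - (t : ℂ)‖ + ‖((t - T : ℝ) : ℂ)‖ := by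
        have := norm_add_le (w - (t : ℂ)) ((t - T : ℝ) : ℂ)
        push_cast at this ⊢
        rwa [sub_add_sub_cancel] at this
      rw [Complex.norm_real, Real.norm_eq_abs, abs_sub_comm] at htri
      have hTd : |T - t| ≤ L * d := hT.1
      refine inv_anti₀ (by positivity) (pow_le_pow_left₀ hpos.le ?_ 2)
      linarith
    have h1 := measureReal_mono (μ := symbolMeasure f c) hsub
    rw [measureReal_def, measure_inter_conull hsupp, ← measureReal_def] at h1
    have h2 : (a * c) ^ 2 / (2 * Real.pi * c) * d ≤
        (symbolMeasure f c).real {T : ℝ | |T - t| ≤ L * d} := by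
      rw [← ENNReal.toReal_ofReal (by positivity : 0 ≤ (a * c) ^ 2 / (2 * Real.pi * c) * d)]
      exact ENNReal.toReal_mono (measure_ne_top _ _) hmass
    have h3 : (((1 + L) * d) ^ 2)⁻¹ * ((a * c) ^ 2 / (2 * Real.pi * c) * d) ≤ 1 :=
      (mul_le_mul_of_nonneg_left (h2.trans h1) (by positivity)).trans (hmarkov.trans hψ)
    have h4 : (((1 + L) * d) ^ 2)⁻¹ * ((a * c) ^ 2 / (2 * Real.pi * c) * d) = δ₁ / d := by
      rw [hδ₁]
      field_simp
    rw [h4, div_le_one₀ hd] at h3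
    linarith

/-! ### Translation to the map `g` -/

/-- With w = -1/s and T = c·2πf, the weight T²/(2πc) turns w(w - T)⁻¹T⁻¹ into (2π)⁻¹(cs +
1/(2πf))⁻¹; this dictates the choice of ρ. -/
theorem subMap_symbolMeasure {f : ℝ → ℝ} (hf : Continuous f) {c : ℝ} (hc : 0 < c)
    {A B δ : ℝ} (hAB : ∀ θ ∈ Icc 0 (2 * Real.pi), c * (2 * Real.pi * f θ) ∈ Icc A B)
    (h : IsSeparated (symbolMeasure f c) A B δ) {s : ℝ} (hs0 : s ≠ 0)
    (hs : -1 / s < A ∨ B < -1 / s) :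
    subMap (symbolMeasure f c) ((-1 / s : ℝ) : ℂ) = (gMap f c s : ℂ) := by
  have hpi := Real.pi_pos
  rw [h.subMap_eq_mul (IsSeparated.ofReal_ne hs)]
  have h1 : ∀ t : ℝ, ((((-1 / s : ℝ) : ℂ) - (t : ℂ))⁻¹ * (t : ℂ)⁻¹) =
      (((-1 / s - t)⁻¹ * t⁻¹ : ℝ) : ℂ) := fun t => by push_cast; rfl
  simp only [h1, integral_complex_ofReal]
  rw [← Complex.ofReal_one, ← Complex.ofReal_add, ← Complex.ofReal_mul]
  congr 1
  rw [integral_symbolMeasure hf hc (by fun_prop : Measurable _).stronglyMeasurable, gMap, mul_add,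
    mul_one, ← intervalIntegral.integral_const_mul, ← intervalIntegral.integral_const_mul]
  congr 1
  refine intervalIntegral.integral_congr fun θ hθ => ?_
  rw [uIcc_of_le (by positivity)] at hθ
  have h2 := hAB θ hθ
  have hV : 0 < c * (2 * Real.pi * f θ) := h.A_pos.trans_le h2.1
  have hf0 : 0 < f θ := by
    by_contra! hle
    have : c * (2 * Real.pi * f θ) ≤ 0 := by
      rw [← mul_assoc]
      exact mul_nonpos_of_nonneg_of_nonpos (by positivity) hle
    linarith
  have h3 : -1 / s - c * (2 * Real.pi * f θ) ≠ 0 := by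
    rcases hs with hs | hs
    · linarith [h2.1]
    · linarith [h2.2]
  have h4 : c * s + 1 / (2 * Real.pi * f θ) ≠ 0 := by
    intro h0
    refine h3 ?_
    field_simp at h0 ⊢
    linarith
  have h5 : c * s * (2 * Real.pi * f θ) + 1 ≠ 0 := by
    intro h0
    refine h4 ?_
    field_simp
    linarith
  have h6 : -1 / s - c * (2 * Real.pi * f θ) =
    -(c * s * (2 * Real.pi * f θ) + 1) / s := by field_simp; ring
  have h7 : c * s + 1 / (2 * Real.pi * f θ) =
    (c * s * (2 * Real.pi * f θ) + 1) / (2 * Real.pi * f θ) := by field_simp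
  simp only [smul_eq_mul]
  rw [h6, h7]
  field_simp

/-- The weight T² cancels |0 - T|⁻², leaving a constant. The position of c relative to 1 thus
decides whether 0 belongs to the domain. -/
theorem subPsi_symbolMeasure_zero {f : ℝ → ℝ} (hf : Continuous f) {c : ℝ} (hc : 0 < c)
    {A B δ : ℝ} (hAB : ∀ θ ∈ Icc 0 (2 * Real.pi), c * (2 * Real.pi * f θ) ∈ Icc A B)
    (h : IsSeparated (symbolMeasure f c) A B δ) : subPsi (symbolMeasure f c) 0 = 1 / c := by
  have hpi := Real.pi_pos
  rw [subPsi, integral_symbolMeasure hf hc (by fun_prop : Measurable _).stronglyMeasurable]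
  rw [intervalIntegral.integral_congr (g := fun _ => 1 / (2 * Real.pi * c))]
  · rw [intervalIntegral.integral_const, smul_eq_mul]
    field_simp
    ring
  · intro θ hθ
    rw [uIcc_of_le (by positivity)] at hθ
    have hV : 0 < c * (2 * Real.pi * f θ) := h.A_pos.trans_le (hAB θ hθ).1
    have hf0 : f θ ≠ 0 := by
      intro h0
      simp [h0] at hV
    simp only [zero_sub, norm_neg, Complex.norm_real, Real.norm_eq_abs, sq_abs, smul_eq_mul]
    field_simp

theorem neg_one_div_mem_iff {a b c s : ℝ} (ha : 0 < a) (hab : a ≤ b) (hc : 0 < c) (hs : s ≠ 0) :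
    (-1 / s < a * c ∨ b * c < -1 / s) ↔ s ∈ gDomain a b c := by
  have hb : 0 < b := ha.trans_le hab
  have e1 : -1 / s < a * c ↔ 0 < s ∨ s < -1 / (a * c) := by
    rcases lt_or_gt_of_ne hs with h | h
    · rw [div_lt_iff_of_neg h, lt_div_iff₀ (by positivity), mul_comm]
      simp [not_lt.2 h.le]
    · have : -1 / s < 0 := div_neg_of_neg_of_pos (by norm_num) h
      simp only [h, true_or, iff_true]
      exact this.trans (by positivity)
  have e2 : b * c < -1 / s ↔ s < 0 ∧ -1 / (b * c) < s := by
    rcases lt_or_gt_of_ne hs with h | h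
    · rw [lt_div_iff_of_neg h, div_lt_iff₀ (by positivity), mul_comm]
      simp [h]
    · have : -1 / s < 0 := div_neg_of_neg_of_pos (by norm_num) h
      simp only [not_lt.2 h.le, false_and, iff_false, not_lt]
      exact this.le.trans (by positivity)
  have e3 : -1 / (b * c) < 0 := div_neg_of_neg_of_pos (by norm_num) (by positivity)
  rw [e1, e2, gDomain, mem_ofPred_eq, mem_Icc, not_and_or, not_le, not_le]
  constructor
  · rintro ((h | h) | h)
    · exact ⟨hs, Or.inr (e3.trans h)⟩
    · exact ⟨hs, Or.inl h⟩
    · exact ⟨hs, Or.inr h.2⟩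
  · rintro ⟨-, h | h⟩
    · exact Or.inl (Or.inr h)
    · rcases lt_or_gt_of_ne hs with h' | h'
      · exact Or.inr ⟨h', h⟩
      · exact Or.inl (Or.inl h')

theorem isOpen_gDomain (a b c : ℝ) : IsOpen (gDomain a b c) := by
  have : gDomain a b c = {0}ᶜ ∩ (Icc (-1 / (a * c)) (-1 / (b * c)))ᶜ := by
    ext s
    simp [gDomain]
  rw [this]
  exact isClosed_singleton.isOpen_compl.inter isClosed_Icc.isOpen_compl

theorem hasDerivAt_gMap {f : ℝ → ℝ} (hf : Continuous f) {a b c δ : ℝ} (hc : 0 < c)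
    (ha0 : 0 < a) (hab : a ≤ b)
    (hAB : ∀ θ ∈ Icc 0 (2 * Real.pi), c * (2 * Real.pi * f θ) ∈ Icc (a * c) (b * c))
    (h : IsSeparated (symbolMeasure f c) (a * c) (b * c) δ) {s : ℝ} (hs : s ∈ gDomain a b c) :
    HasDerivAt (gMap f c)
      ((1 - subPsi (symbolMeasure f c) ((-1 / s : ℝ) : ℂ)) * (s ^ 2)⁻¹) s := by
  have h1 : HasDerivAt (fun s : ℝ => -1 / s) ((s ^ 2)⁻¹) s := by
    have := (hasDerivAt_inv hs.1).neg
    refine (this.congr_deriv (by ring)).congr_of_eventuallyEq (Eventually.of_forall fun s => ?_)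
    simp [neg_div]
  have h2 := h.hasDerivAt_subMap_re ((neg_one_div_mem_iff ha0 hab hc hs.1).2 hs)
  refine (h2.comp s h1).congr_of_eventuallyEq ?_
  filter_upwards [(isOpen_gDomain a b c).mem_nhds hs] with s' hs'
  simp only [Function.comp]
  rw [subMap_symbolMeasure hf hc hAB h hs'.1 ((neg_one_div_mem_iff ha0 hab hc hs'.1).2 hs'),
    Complex.ofReal_re]

/-- The spectral description, from the fixed-point equation on the negative half line. -/
theorem exists_density_of_fixedPoint {f : ℝ → ℝ} (hf : ContDiff ℝ 1 f) {a b c : ℝ}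
    (ha : IsLeast ((fun θ => 2 * Real.pi * f θ) '' Icc 0 (2 * Real.pi)) a)
    (hb : IsGreatest ((fun θ => 2 * Real.pi * f θ) '' Icc 0 (2 * Real.pi)) b)
    (ha0 : 0 < a) (hc : 0 < c) (F : Measure ℝ) [IsProbabilityMeasure F] (hF : F (Iio 0) = 0)
    (hfix : ∀ x : ℝ, 0 < x → gMap f c (∫ t, (t + x)⁻¹ ∂F) = -x) :
    ∃ (x₁ x₂ : ℝ) (h : ℝ → ℝ),
      0 ≤ x₁ ∧ x₁ < x₂ ∧
      (∀ x, 0 ≤ h x) ∧ (∀ x, x ∉ Icc x₁ x₂ → h x = 0) ∧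
      (c ≠ 1 → ContinuousOn h (Icc x₁ x₂)) ∧
      (c = 1 → ContinuousOn h (Icc x₁ x₂ \ {0})) ∧
      (volume.withDensity fun x => ENNReal.ofReal (h x)).support = Icc x₁ x₂ ∧
      (c ≤ 1 → F = volume.withDensity fun x => ENNReal.ofReal (h x)) ∧
      (1 < c → F = ENNReal.ofReal (1 - 1 / c) • Measure.dirac 0 +
        volume.withDensity fun x => ENNReal.ofReal (h x)) ∧
      (1 < c → ∃ s₁ ∈ Iio (-1 / (a * c)), ∃ s₂ ∈ Ioo (-1 / (b * c)) 0,
        (∀ s ∈ Iio (-1 / (a * c)), s ≠ s₁ → gMap f c s < gMap f c s₁) ∧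
        (∀ s ∈ Ioo (-1 / (b * c)) 0, s ≠ s₂ → gMap f c s₂ < gMap f c s) ∧
        (∀ s ∈ gDomain a b c, (IsLocalExtr (gMap f c) s ↔ s = s₁ ∨ s = s₂)) ∧
        x₁ = gMap f c s₁ ∧ x₂ = gMap f c s₂) ∧
      (c < 1 → ∃ s₁ ∈ Ioi (0 : ℝ), ∃ s₂ ∈ Ioo (-1 / (b * c)) 0,
        (∀ s ∈ Ioi (0 : ℝ), s ≠ s₁ → gMap f c s < gMap f c s₁) ∧
        (∀ s ∈ Ioo (-1 / (b * c)) 0, s ≠ s₂ → gMap f c s₂ < gMap f c s) ∧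
        (∀ s ∈ gDomain a b c, (IsLocalExtr (gMap f c) s ↔ s = s₁ ∨ s = s₂)) ∧
        x₁ = gMap f c s₁ ∧ x₂ = gMap f c s₂) := by
  have hpi := Real.pi_pos
  have hfc := hf.continuous
  have hab : a ≤ b := hb.2 ha.1
  have hb0 : 0 < b := ha0.trans_le hab
  -- All the smoothness that is used: a Lipschitz constant from the mean value inequality.
  obtain ⟨K, hK0, hK⟩ : ∃ K : ℝ, 0 ≤ K ∧ ∀ θ ∈ Icc 0 (2 * Real.pi), ∀ θ' ∈ Icc 0 (2 * Real.pi),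
      |f θ - f θ'| ≤ K * |θ - θ'| := by
    obtain ⟨K, hK⟩ := (isCompact_Icc (a := (0 : ℝ)) (b := 2 * Real.pi)).exists_bound_of_continuousOn
      (hf.continuous_deriv le_rfl).continuousOn
    refine ⟨K, (norm_nonneg _).trans (hK 0 ⟨le_rfl, by positivity⟩), fun θ hθ θ' hθ' => ?_⟩
    exact Convex.norm_image_sub_le_of_norm_deriv_le
      (fun x _ => (hf.differentiable one_ne_zero).differentiableAt) hK (convex_Icc _ _) hθ' hθ
  obtain ⟨δ, h⟩ := isSeparated_symbolMeasure hfc hK0 hK ha hb ha0 hc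
  have hAB : ∀ θ ∈ Icc 0 (2 * Real.pi), c * (2 * Real.pi * f θ) ∈ Icc (a * c) (b * c) := by
    intro θ hθ
    have h1 := ha.2 (mem_image_of_mem _ hθ)
    have h2 := hb.2 (mem_image_of_mem _ hθ)
    constructor <;> nlinarith
  set ρ := symbolMeasure f c with hρ
  have hψ0 : subPsi ρ 0 = 1 / c := subPsi_symbolMeasure_zero hfc hc hAB h
  have hdom : ∀ s : ℝ, s ≠ 0 → ((-1 / s < a * c ∨ b * c < -1 / s) ↔ s ∈ gDomain a b c) :=
    fun s hs => neg_one_div_mem_iff ha0 hab hc hs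
  have hg : ∀ s ∈ gDomain a b c, (subMap ρ ((-1 / s : ℝ) : ℂ)).re = gMap f c s := by
    intro s hs
    rw [hρ, subMap_symbolMeasure hfc hc hAB h hs.1 ((hdom s hs.1).2 hs), Complex.ofReal_re]
  -- G(-x) = -s, so 1/G(-x) = -1/s is the variable w, and the fixed-point equation g(s) = -x reads
  -- H(w) = -x.
  have hfun : ∀ x : ℝ, 0 < x →
      subMap ρ (cauchyTransform F ((-x : ℝ) : ℂ))⁻¹ = ((-x : ℝ) : ℂ) := by
    intro x hx
    have hs := integral_inv_add_pos F hF hx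
    have hneg : -1 / (∫ t, (t + x)⁻¹ ∂F) < 0 := div_neg_of_neg_of_pos (by norm_num) hs
    have h1 := subMap_symbolMeasure hfc hc hAB h hs.ne' (Or.inl (hneg.trans h.A_pos))
    rw [hfix x hx] at h1
    rw [cauchyTransform_neg_ofReal, ← Complex.ofReal_inv, ← h1]
    congr 2
    rw [← neg_inv, neg_div, one_div]
  obtain ⟨u₁, hu₁, hψ₁⟩ := h.exists_left_edge
  obtain ⟨u₂, hu₂, hψ₂⟩ := h.exists_right_edge
  obtain ⟨k, h1, h2, h3, h4, h5, h6, h7, h8⟩ :=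
    h.exists_density hF hfun hu₁ hψ₁ hu₂ hψ₂ rfl rfl
  have hu₂0 : 0 < u₂ := lt_trans (by positivity) hu₂
  -- It holds at u = 0 as well, since division by 0 is 0.
  have hinv : ∀ u : ℝ, -1 / (-1 / u) = u := fun u => by
    rcases eq_or_ne u 0 with rfl | hu
    · simp
    · field_simp
  have hinj : ∀ s u : ℝ, -1 / s = u → s = -1 / u := fun s u hsu => by rw [← hsu, hinv]
  have hs₂ : -1 / u₂ ∈ Ioo (-1 / (b * c)) 0 := by
    refine ⟨?_, div_neg_of_neg_of_pos (by norm_num) hu₂0⟩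
    rw [neg_div, neg_div, neg_lt_neg_iff]
    exact one_div_lt_one_div_of_lt (by positivity) hu₂
  have hright : ∀ s ∈ Ioo (-1 / (b * c)) 0, b * c < -1 / s := by
    intro s hs
    rw [lt_div_iff_of_neg hs.2]
    have := (div_lt_iff₀ (by positivity)).1 hs.1
    linarith
  have hs₂' : -1 / u₂ ∈ gDomain a b c :=
    (hdom _ hs₂.2.ne).1 (Or.inr (hright _ hs₂))
  have hmin : ∀ s ∈ Ioo (-1 / (b * c)) 0, s ≠ -1 / u₂ → gMap f c (-1 / u₂) < gMap f c s := by
    intro s hs hne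
    have := h.subMap_re_lt_right hu₂ hψ₂ (hright s hs) fun h0 => hne (hinj _ _ h0)
    rwa [hg s ((hdom s hs.2.ne).1 (Or.inr (hright s hs))), ← hinv u₂, hg _ hs₂'] at this
  have hx₂ : (subMap ρ (u₂ : ℂ)).re = gMap f c (-1 / u₂) := by
    rw [← hg _ hs₂', hinv]
  have hmax : u₁ ≠ 0 → ∀ s, s ≠ 0 → -1 / s < a * c → s ≠ -1 / u₁ →
      gMap f c s < gMap f c (-1 / u₁) := by
    intro hu0 s hs0 hs hne
    have := h.subMap_re_lt_left hu₁ hψ₁ hs fun h0 => hne (hinj _ _ h0)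
    have hs₁' : -1 / u₁ ∈ gDomain a b c :=
      (hdom _ (div_ne_zero (by norm_num) hu0)).1 (Or.inl (by rwa [hinv]))
    rwa [hg s ((hdom s hs0).1 (Or.inl hs)), ← hinv u₁, hg _ hs₁'] at this
  have hx₁ : u₁ ≠ 0 → (subMap ρ (u₁ : ℂ)).re = gMap f c (-1 / u₁) := by
    intro hu0
    rw [← hg _ ((hdom _ (div_ne_zero (by norm_num) hu0)).1 (Or.inl (by rwa [hinv]))), hinv]
  -- The derivative of g is (1 - ψ(-1/s))/s², and ψ is strictly monotone on each side of [ac, bc],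
  -- so it takes the value 1 only at u₁ and u₂.
  have hextr : u₁ ≠ 0 → ∀ s ∈ gDomain a b c,
      (IsLocalExtr (gMap f c) s ↔ s = -1 / u₁ ∨ s = -1 / u₂) := by
    intro hu0 s hs
    constructor
    · intro hloc
      have hd := hloc.hasDerivAt_eq_zero (hasDerivAt_gMap hfc hc ha0 hab hAB h hs)
      have hψ : subPsi ρ ((-1 / s : ℝ) : ℂ) = 1 := by
        rcases mul_eq_zero.1 hd with h0 | h0
        · linarith
        · exact absurd h0 (inv_ne_zero (pow_ne_zero 2 hs.1))
      rcases (hdom s hs.1).2 hs with hlt | hlt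
      · left
        exact hinj _ _ (h.strictMonoOn_subPsi.injOn hlt hu₁ (hψ.trans hψ₁.symm))
      · right
        exact hinj _ _ (h.strictAntiOn_subPsi.injOn hlt hu₂ (hψ.trans hψ₂.symm))
    · rintro (rfl | rfl)
      · refine Or.inr ?_
        have hc1 : ContinuousAt (fun s : ℝ => -1 / s) (-1 / u₁) :=
          continuousAt_const.div continuousAt_id hs.1
        have hc2 : ∀ᶠ s in 𝓝 (-1 / u₁), -1 / s < a * c :=
          hc1.eventually_lt continuousAt_const (by rwa [hinv])
        filter_upwards [hc2, isOpen_ne.mem_nhds hs.1] with s hs1 hs0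
        rcases eq_or_ne s (-1 / u₁) with rfl | hne
        · exact le_rfl
        · exact (hmax hu0 s hs0 hs1 hne).le
      · refine Or.inl ?_
        filter_upwards [Ioo_mem_nhds hs₂.1 hs₂.2] with s hs1
        rcases eq_or_ne s (-1 / u₂) with rfl | hne
        · exact le_rfl
        · exact (hmin s hs1 hne).le
  refine ⟨_, _, k, h1, h2, h3, h4, fun hc1 => h5 ?_, fun _ => h6, h7, fun hc1 => ?_,
    fun hc1 => ?_, fun hc1 => ?_, fun hc1 => ?_⟩
  · rw [hψ0]
    intro h0
    exact hc1 (by rw [div_eq_one_iff_eq hc.ne'] at h0; exact h0.symm)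
  · have e : (if subPsi ρ 0 ≤ 1 then 1 - subPsi ρ 0 else 0) ≤ 0 := by
      have : 1 ≤ subPsi ρ 0 := by rw [hψ0]; exact (one_le_div hc).2 hc1
      split_ifs
      · linarith
      · exact le_rfl
    rw [ENNReal.ofReal_of_nonpos e, zero_smul, zero_add] at h8
    exact h8
  · have e : subPsi ρ 0 ≤ 1 := by rw [hψ0]; exact (div_le_one hc).2 hc1.le
    rw [if_pos e, hψ0] at h8
    exact h8
  -- For c > 1, ψ(0) = 1/c < 1 = ψ(u₁), so u₁ ∈ (0, ac) and s₁ = -1/u₁ lies left of -1/(ac).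
  · have hu0 : 0 < u₁ := by
      refine (h.strictMonoOn_subPsi.lt_iff_lt h.A_pos hu₁).1 ?_
      simp only [Complex.ofReal_zero]
      rw [hψ₁, hψ0]
      exact (div_lt_one hc).2 hc1
    refine ⟨-1 / u₁, ?_, -1 / u₂, hs₂, fun s hs hne => ?_, hmin, hextr hu0.ne', hx₁ hu0.ne', hx₂⟩
    · rw [mem_Iio, neg_div, neg_div, neg_lt_neg_iff]
      exact one_div_lt_one_div_of_lt hu0 hu₁
    · have hs0 : s < 0 := lt_trans hs (div_neg_of_neg_of_pos (by norm_num) (by positivity))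
      refine hmax hu0.ne' s hs0.ne ?_ hne
      rw [div_lt_iff_of_neg hs0]
      have := (lt_div_iff₀ (by positivity : 0 < a * c)).1 (mem_Iio.1 hs)
      linarith
  -- For c < 1, ψ(0) > 1, so u₁ is negative and s₁ = -1/u₁ is positive.
  · have hu0 : u₁ < 0 := by
      refine (h.strictMonoOn_subPsi.lt_iff_lt hu₁ h.A_pos).1 ?_
      simp only [Complex.ofReal_zero]
      rw [hψ₁, hψ0]
      exact (one_lt_div hc).2 hc1
    refine ⟨-1 / u₁, div_pos_of_neg_of_neg (by norm_num) hu0, -1 / u₂, hs₂, fun s hs hne => ?_,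
      hmin, hextr hu0.ne, hx₁ hu0.ne, hx₂⟩
    have hs0 : 0 < s := hs
    have hs1 : -1 / s < 0 := div_neg_of_neg_of_pos (by norm_num) hs0
    exact hmax hu0.ne s hs0.ne' (hs1.trans (by positivity)) hne

/-! ### Resolvents of Gram matrices -/

section Resolvent

open Matrix
open scoped Matrix.Norms.L2Operator

variable {ι κ : Type*} [Fintype ι] [DecidableEq ι] [Fintype κ] [DecidableEq κ]

theorem norm_toLp_sq (v : κ → ℝ) : ‖WithLp.toLp 2 v‖ ^ 2 = v ⬝ᵥ v := by
  rw [EuclideanSpace.norm_sq_eq]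
  simp [dotProduct, pow_two]

theorem mulVec_dotProduct_self_le (M : Matrix κ κ ℝ) (v : κ → ℝ) :
    (M *ᵥ v) ⬝ᵥ (M *ᵥ v) ≤ ‖M‖ ^ 2 * (v ⬝ᵥ v) := by
  rw [← norm_toLp_sq, ← norm_toLp_sq, ← mul_pow]
  exact pow_le_pow_left₀ (norm_nonneg _) (M.l2_opNorm_mulVec (WithLp.toLp 2 v)) 2

theorem abs_dotProduct_le (u v : κ → ℝ) :
    |u ⬝ᵥ v| ≤ ‖WithLp.toLp 2 u‖ * ‖WithLp.toLp 2 v‖ := by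
  have := abs_real_inner_le_norm (WithLp.toLp 2 v) (WithLp.toLp 2 u)
  rw [EuclideanSpace.inner_eq_star_dotProduct] at this
  simp only [star_trivial] at this
  rwa [mul_comm] at this

theorem abs_dotProduct_mulVec_le (M : Matrix κ κ ℝ) (v : κ → ℝ) :
    |v ⬝ᵥ (M *ᵥ v)| ≤ ‖M‖ * (v ⬝ᵥ v) := by
  refine (abs_dotProduct_le _ _).trans ?_
  have := M.l2_opNorm_mulVec (WithLp.toLp 2 v)
  rw [← norm_toLp_sq]
  calc ‖WithLp.toLp 2 v‖ * ‖WithLp.toLp 2 (M *ᵥ v)‖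
      ≤ ‖WithLp.toLp 2 v‖ * (‖M‖ * ‖WithLp.toLp 2 v‖) :=
        mul_le_mul_of_nonneg_left this (norm_nonneg _)
    _ = _ := by ring

theorem sum_sq_mul_le (M : Matrix ι ι ℝ) (A : Matrix ι κ ℝ) :
    ∑ i, ∑ j, (M * A) i j ^ 2 ≤ ‖M‖ ^ 2 * ∑ i, ∑ j, A i j ^ 2 := by
  rw [Finset.sum_comm, Finset.sum_comm (f := fun i j => A i j ^ 2), Finset.mul_sum]
  refine Finset.sum_le_sum fun j _ => ?_
  have := mulVec_dotProduct_self_le M (fun i => A i j)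
  simpa [dotProduct, mulVec, mul_apply, pow_two] using this

theorem sum_sq_le_card (M : Matrix κ κ ℝ) :
    ∑ i, ∑ j, M i j ^ 2 ≤ Fintype.card κ * ‖M‖ ^ 2 := by
  have := sum_sq_mul_le M (1 : Matrix κ κ ℝ)
  rw [mul_one] at this
  refine this.trans_eq ?_
  rw [mul_comm]
  congr 1
  simp [Matrix.one_apply]

theorem abs_entry_le (M : Matrix κ κ ℝ) (j k : κ) : |M j k| ≤ ‖M‖ := by
  have h := mulVec_dotProduct_self_le M (Pi.single k 1)
  have h1 : (M *ᵥ Pi.single k 1) ⬝ᵥ (M *ᵥ Pi.single k 1) = ∑ i, M i k ^ 2 := by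
    simp [dotProduct, pow_two]
  rw [h1] at h
  have h2 : M j k ^ 2 ≤ ∑ i, M i k ^ 2 :=
    Finset.single_le_sum (f := fun i => M i k ^ 2) (fun i _ => sq_nonneg _) (Finset.mem_univ j)
  have h3 : M j k ^ 2 ≤ ‖M‖ ^ 2 := by
    refine h2.trans (h.trans_eq ?_)
    simp
  exact abs_le_of_sq_le_sq h3 (norm_nonneg _)

theorem abs_trace_le (M : Matrix κ κ ℝ) : |M.trace| ≤ Fintype.card κ * ‖M‖ := by
  refine (Finset.abs_sum_le_sum_abs _ _).trans ?_
  refine (Finset.sum_le_sum fun j _ => abs_entry_le M j j).trans_eq ?_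
  simp

theorem dotProduct_mulVec_resolvent {Y : Matrix κ κ ℝ} (hY : Y.PosSemidef) {x : ℝ}
    (v : κ → ℝ) : x * (v ⬝ᵥ v) ≤ v ⬝ᵥ ((x • (1 : Matrix κ κ ℝ) + Y) *ᵥ v) := by
  have := hY.dotProduct_mulVec_nonneg v
  simp only [star_trivial] at this
  rw [add_mulVec, smul_mulVec, one_mulVec, dotProduct_add, dotProduct_smul, smul_eq_mul]
  linarith

theorem posDef_resolvent {Y : Matrix κ κ ℝ} (hY : Y.PosSemidef) {x : ℝ} (hx : 0 < x) :
    (x • (1 : Matrix κ κ ℝ) + Y).PosDef :=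
  (Matrix.PosDef.one.smul hx).add_posSemidef hY

theorem isUnit_det_resolvent {Y : Matrix κ κ ℝ} (hY : Y.PosSemidef) {x : ℝ} (hx : 0 < x) :
    IsUnit (x • (1 : Matrix κ κ ℝ) + Y).det :=
  (Matrix.isUnit_iff_isUnit_det _).1 (posDef_resolvent hY hx).isUnit

/-- Coercivity: x|y|² ≤ y·(x + Y)y ≤ |y||v| for the solution y of (x + Y)y = v. -/
theorem norm_resolvent_le {Y : Matrix κ κ ℝ} (hY : Y.PosSemidef) {x : ℝ} (hx : 0 < x) :
    ‖(x • (1 : Matrix κ κ ℝ) + Y)⁻¹‖ ≤ x⁻¹ := by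
  rw [l2_opNorm_def]
  refine ContinuousLinearMap.opNorm_le_bound _ (by positivity) fun v => ?_
  set A := x • (1 : Matrix κ κ ℝ) + Y with hA
  change ‖WithLp.toLp 2 (A⁻¹ *ᵥ v.ofLp)‖ ≤ x⁻¹ * ‖v‖
  set y := A⁻¹ *ᵥ v.ofLp with hy
  have h1 : A *ᵥ y = v.ofLp := by
    rw [hy, mulVec_mulVec, mul_nonsing_inv _ (isUnit_det_resolvent hY hx), one_mulVec]
  have h2 := dotProduct_mulVec_resolvent hY (x := x) y
  rw [← hA, h1, ← norm_toLp_sq] at h2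
  have h3 := (le_abs_self _).trans (abs_dotProduct_le y v.ofLp)
  rw [inv_mul_eq_div, le_div_iff₀ hx]
  rcases (norm_nonneg (WithLp.toLp 2 y)).eq_or_lt with h0 | h0
  · rw [← h0]
    simp
  · refine le_of_mul_le_mul_left ?_ h0
    have h4 : ‖WithLp.toLp 2 v.ofLp‖ = ‖v‖ := rfl
    rw [h4] at h3
    nlinarith

theorem resolvent_transpose {Y : Matrix κ κ ℝ} (hY : Y.PosSemidef) {x : ℝ} :
    ((x • (1 : Matrix κ κ ℝ) + Y)⁻¹)ᵀ = (x • (1 : Matrix κ κ ℝ) + Y)⁻¹ := by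
  have : Yᵀ = Y := by
    have := hY.isHermitian
    rwa [IsHermitian, conjTranspose_eq_transpose_of_trivial] at this
  rw [transpose_nonsing_inv]
  simp [this]

/-- The Gram matrix of the rows, normalised by `N`. -/
noncomputable def colGram (N : ℝ) (X : Matrix ι κ ℝ) : Matrix κ κ ℝ := N⁻¹ • (Xᵀ * X)

/-- The resolvent of `colGram` at `-x`. -/
noncomputable def colRes (N x : ℝ) (X : Matrix ι κ ℝ) : Matrix κ κ ℝ :=
  (x • (1 : Matrix κ κ ℝ) + colGram N X)⁻¹

theorem posSemidef_colGram {N : ℝ} (hN : 0 < N) (X : Matrix ι κ ℝ) :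
    (colGram N X).PosSemidef := by
  have := posSemidef_conjTranspose_mul_self X
  rw [conjTranspose_eq_transpose_of_trivial] at this
  exact this.smul (inv_nonneg.2 hN.le)

theorem colGram_eq_updateRow (N : ℝ) (X : Matrix ι κ ℝ) (i : ι) :
    colGram N X = colGram N (X.updateRow i 0) + N⁻¹ • vecMulVec (X i) (X i) := by
  unfold colGram
  rw [← smul_add]
  congr 1
  ext j k
  rw [Matrix.add_apply, mul_apply, mul_apply, ← Finset.add_sum_erase _ _ (Finset.mem_univ i),
    ← Finset.add_sum_erase (f := fun l => (X.updateRow i 0)ᵀ j l * X.updateRow i 0 l k) _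
    (Finset.mem_univ i)]
  simp only [transpose_apply, updateRow_self, Pi.zero_apply, zero_mul, zero_add, vecMulVec_apply]
  rw [add_comm]
  congr 1
  refine Finset.sum_congr rfl fun l hl => ?_
  rw [updateRow_ne (Finset.ne_of_mem_erase hl)]

/-- The quadratic form `N⁻¹ rᵀ G B r` of the `i`-th row in the resolvent without that row. -/
noncomputable def looForm (N x : ℝ) (X : Matrix ι κ ℝ) (B : Matrix κ κ ℝ) (i : ι) : ℝ :=
  N⁻¹ * (X i ⬝ᵥ ((colRes N x (X.updateRow i 0) * B) *ᵥ X i))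

theorem looForm_one_nonneg {N x : ℝ} (hN : 0 < N) (hx : 0 < x) (X : Matrix ι κ ℝ) (i : ι) :
    0 ≤ looForm N x X 1 i := by
  have := (posDef_resolvent (posSemidef_colGram hN (X.updateRow i 0)) hx).inv.posSemidef.dotProduct_mulVec_nonneg
    (X i)
  simp only [star_trivial] at this
  rw [looForm, mul_one]
  exact mul_nonneg (inv_nonneg.2 hN.le) this

/-- Sherman–Morrison: restoring row i is a rank-one change, and the row is an eigenvector of the
correction. -/
theorem colRes_mulVec_row {N x : ℝ} (hN : 0 < N) (hx : 0 < x) (X : Matrix ι κ ℝ) (i : ι) :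
    colRes N x X *ᵥ X i =
      (1 + looForm N x X 1 i)⁻¹ • (colRes N x (X.updateRow i 0) *ᵥ X i) := by
  have hne : 1 + looForm N x X 1 i ≠ 0 := by
    have := looForm_one_nonneg hN hx X i
    positivity
  set y := colRes N x (X.updateRow i 0) *ᵥ X i with hy
  have h1 : (x • (1 : Matrix κ κ ℝ) + colGram N (X.updateRow i 0)) *ᵥ y = X i := by
    rw [hy, colRes, mulVec_mulVec,
      mul_nonsing_inv _ (isUnit_det_resolvent (posSemidef_colGram hN _) hx), one_mulVec]
  have h2 : (x • (1 : Matrix κ κ ℝ) + colGram N X) *ᵥ y = (1 + looForm N x X 1 i) • X i := by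
    rw [colGram_eq_updateRow N X i, ← add_assoc, add_mulVec, h1, smul_mulVec, vecMulVec_mulVec,
      add_smul, one_smul, looForm, mul_one, ← hy]
    congr 1
    ext j
    simp [mul_comm, mul_left_comm]
  have h3 : colRes N x X *ᵥ ((x • (1 : Matrix κ κ ℝ) + colGram N X) *ᵥ y) = y := by
    rw [colRes, mulVec_mulVec,
      nonsing_inv_mul _ (isUnit_det_resolvent (posSemidef_colGram hN _) hx), one_mulVec]
  rw [h2, mulVec_smul] at h3
  rw [← h3, smul_smul, inv_mul_cancel₀ hne, one_smul]

theorem colRes_transpose {N x : ℝ} (hN : 0 < N) (X : Matrix ι κ ℝ) :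
    (colRes N x X)ᵀ = colRes N x X := resolvent_transpose (posSemidef_colGram hN X)

theorem norm_colRes_le {N x : ℝ} (hN : 0 < N) (hx : 0 < x) (X : Matrix ι κ ℝ) :
    ‖colRes N x X‖ ≤ x⁻¹ := norm_resolvent_le (posSemidef_colGram hN X) hx

theorem row_dotProduct_colRes_mul {N x : ℝ} (hN : 0 < N) (hx : 0 < x) (X : Matrix ι κ ℝ)
    (B : Matrix κ κ ℝ) (i : ι) :
    N⁻¹ * (X i ⬝ᵥ ((colRes N x X * B) *ᵥ X i)) =
      (1 + looForm N x X 1 i)⁻¹ * looForm N x X B i := by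
  have e : ∀ Y : Matrix ι κ ℝ, X i ⬝ᵥ ((colRes N x Y * B) *ᵥ X i) =
      (colRes N x Y *ᵥ X i) ⬝ᵥ (B *ᵥ X i) := by
    intro Y
    rw [← mulVec_mulVec, dotProduct_mulVec, ← mulVec_transpose, colRes_transpose hN]
  have h2 : looForm N x X B i = N⁻¹ * ((colRes N x (X.updateRow i 0) *ᵥ X i) ⬝ᵥ (B *ᵥ X i)) := by
    rw [looForm, e]
  rw [h2, e, colRes_mulVec_row hN hx, smul_dotProduct, smul_eq_mul]
  ring

theorem trace_colGram_mul (N : ℝ) (X : Matrix ι κ ℝ) (M : Matrix κ κ ℝ) :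
    (colGram N X * M).trace = ∑ i, N⁻¹ * (X i ⬝ᵥ (M *ᵥ X i)) := by
  rw [colGram, smul_mul_assoc, trace_smul, Matrix.mul_assoc, trace_mul_comm, smul_eq_mul,
    ← Finset.mul_sum]
  congr 1
  refine Finset.sum_congr rfl fun i _ => ?_
  rw [diag_apply, mul_apply, dotProduct_mulVec]
  simp [dotProduct, mul_apply, vecMul]

/-- Trace of (x + Gram)·G·B = B, with the Gram part expanded over rows and each row decoupled from
its resolvent. -/
theorem trace_sub_mul_trace_colRes {N x : ℝ} (hN : 0 < N) (hx : 0 < x) (X : Matrix ι κ ℝ)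
    (B : Matrix κ κ ℝ) :
    B.trace - x * (colRes N x X * B).trace =
      ∑ i, (1 + looForm N x X 1 i)⁻¹ * looForm N x X B i := by
  simp only [← row_dotProduct_colRes_mul hN hx]
  rw [← trace_colGram_mul]
  have h1 : (x • (1 : Matrix κ κ ℝ) + colGram N X) * (colRes N x X * B) = B := by
    rw [colRes, ← Matrix.mul_assoc,
      mul_nonsing_inv _ (isUnit_det_resolvent (posSemidef_colGram hN _) hx), Matrix.one_mul]
  have h2 := congrArg trace h1
  rw [Matrix.add_mul, trace_add, smul_mul_assoc, Matrix.one_mul, trace_smul, smul_eq_mul] at h2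
  linarith

/-- The difference is a rank-one term N⁻¹(1 + q)⁻¹ yᵀAy with y = G r, r the removed row and G the
resolvent without it. Coercivity gives x|y|² ≤ Nq, and q/(1 + q) ≤ 1 removes the dependence on the
row. -/
theorem abs_trace_colRes_sub_le {N x : ℝ} (hN : 0 < N) (hx : 0 < x) (X : Matrix ι κ ℝ)
    (A : Matrix κ κ ℝ) (i : ι) :
    |(colRes N x (X.updateRow i 0) * A).trace - (colRes N x X * A).trace| ≤ ‖A‖ * x⁻¹ := by
  set G := colRes N x (X.updateRow i 0) with hG
  set β := (1 + looForm N x X 1 i)⁻¹ with hβ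
  have hq := looForm_one_nonneg hN hx X i
  set y := G *ᵥ X i with hy
  have hdiff : G - colRes N x X = colRes N x X * (N⁻¹ • vecMulVec (X i) (X i)) * G := by
    have h1 : N⁻¹ • vecMulVec (X i) (X i) = (x • (1 : Matrix κ κ ℝ) + colGram N X) -
        (x • (1 : Matrix κ κ ℝ) + colGram N (X.updateRow i 0)) := by
      rw [colGram_eq_updateRow N X i]
      abel
    rw [h1, Matrix.mul_sub, Matrix.sub_mul, colRes, hG, colRes,
      nonsing_inv_mul _ (isUnit_det_resolvent (posSemidef_colGram hN _) hx), Matrix.one_mul,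
      Matrix.mul_assoc, mul_nonsing_inv _ (isUnit_det_resolvent (posSemidef_colGram hN _) hx),
      Matrix.mul_one]
  have htr : (G * A).trace - (colRes N x X * A).trace = N⁻¹ * β * (y ⬝ᵥ (A *ᵥ y)) := by
    rw [← trace_sub, ← Matrix.sub_mul, hdiff, Matrix.mul_assoc, Matrix.mul_smul, Matrix.smul_mul,
      trace_smul, mul_vecMulVec, colRes_mulVec_row hN hx, vecMulVec_mul, trace_vecMulVec,
      smul_dotProduct, ← hβ, ← hG, ← hy, ← vecMul_vecMul, ← mulVec_transpose, ← mulVec_transpose,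
      hG, colRes_transpose hN, ← hG, ← hy, dotProduct_comm, mulVec_transpose, ← dotProduct_mulVec,
      smul_eq_mul, smul_eq_mul, mul_assoc]
  have hyy : x * (y ⬝ᵥ y) ≤ N * looForm N x X 1 i := by
    have h1 := dotProduct_mulVec_resolvent (posSemidef_colGram hN (X.updateRow i 0)) (x := x) y
    have h2 : (x • (1 : Matrix κ κ ℝ) + colGram N (X.updateRow i 0)) *ᵥ y = X i := by
      rw [hy, hG, colRes, mulVec_mulVec,
        mul_nonsing_inv _ (isUnit_det_resolvent (posSemidef_colGram hN _) hx), one_mulVec]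
    rw [h2] at h1
    rw [dotProduct_comm y (X i)] at h1
    rwa [looForm, mul_one, ← hG, ← hy, ← mul_assoc, mul_inv_cancel₀ hN.ne', one_mul]
  have hβ0 : 0 < β := by positivity
  have hyy0 : 0 ≤ y ⬝ᵥ y := by rw [← norm_toLp_sq]; positivity
  rw [htr, abs_mul, abs_of_pos (by positivity)]
  calc N⁻¹ * β * |y ⬝ᵥ (A *ᵥ y)| ≤ N⁻¹ * β * (‖A‖ * (y ⬝ᵥ y)) :=
        mul_le_mul_of_nonneg_left (abs_dotProduct_mulVec_le A y) (by positivity)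
    _ = ‖A‖ * x⁻¹ * (N⁻¹ * β * (x * (y ⬝ᵥ y))) := by field_simp
    _ ≤ ‖A‖ * x⁻¹ * (N⁻¹ * β * (N * looForm N x X 1 i)) := by gcongr
    _ = ‖A‖ * x⁻¹ * (looForm N x X 1 i / (1 + looForm N x X 1 i)) := by
        rw [hβ]
        field_simp
    _ ≤ ‖A‖ * x⁻¹ * 1 := by
        gcongr
        rw [div_le_one (by positivity)]
        linarith
    _ = ‖A‖ * x⁻¹ := mul_one _

/-- The resolvent of the row covariance matrix at `-x`. -/
noncomputable def rowRes (N x : ℝ) (X : Matrix ι κ ℝ) : Matrix ι ι ℝ :=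
  (x • (1 : Matrix ι ι ℝ) + N⁻¹ • (X * Xᵀ))⁻¹

theorem posSemidef_rowGram {N : ℝ} (hN : 0 < N) (X : Matrix ι κ ℝ) :
    (N⁻¹ • (X * Xᵀ)).PosSemidef := by
  have := posSemidef_self_mul_conjTranspose X
  rw [conjTranspose_eq_transpose_of_trivial] at this
  exact this.smul (inv_nonneg.2 hN.le)

theorem colRes_mul_transpose {N x : ℝ} (hN : 0 < N) (hx : 0 < x) (X : Matrix ι κ ℝ) :
    colRes N x X * Xᵀ = Xᵀ * rowRes N x X := by
  have hu := isUnit_det_resolvent (posSemidef_colGram hN X) hx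
  have hv := isUnit_det_resolvent (posSemidef_rowGram hN X) hx
  have h1 : Xᵀ * (x • (1 : Matrix ι ι ℝ) + N⁻¹ • (X * Xᵀ)) =
      (x • (1 : Matrix κ κ ℝ) + colGram N X) * Xᵀ := by
    simp [Matrix.mul_add, Matrix.add_mul, colGram, Matrix.mul_assoc]
  calc colRes N x X * Xᵀ
      = colRes N x X * (Xᵀ * (x • (1 : Matrix ι ι ℝ) + N⁻¹ • (X * Xᵀ))) * rowRes N x X := by
        rw [rowRes, Matrix.mul_assoc, Matrix.mul_assoc, mul_nonsing_inv _ hv, Matrix.mul_one]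
    _ = Xᵀ * rowRes N x X := by
        rw [h1, ← Matrix.mul_assoc, colRes, nonsing_inv_mul _ hu, Matrix.one_mul]

/-- From 1/(1 + q) = 1 - q/(1 + q), the sum is the number of rows minus tr(Gram · G); the
push-through identity `colRes_mul_transpose` rewrites that trace on the row side. -/
theorem sum_inv_one_add_looForm {N x : ℝ} (hN : 0 < N) (hx : 0 < x) (X : Matrix ι κ ℝ) :
    ∑ i, (1 + looForm N x X 1 i)⁻¹ = x * (rowRes N x X).trace := by
  have h1 : ∀ i, (1 + looForm N x X 1 i)⁻¹ =
      1 - (1 + looForm N x X 1 i)⁻¹ * looForm N x X 1 i := by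
    intro i
    have := looForm_one_nonneg hN hx X i
    field_simp
    ring
  rw [Finset.sum_congr rfl fun i _ => h1 i, Finset.sum_sub_distrib]
  simp only [← row_dotProduct_colRes_mul hN hx, mul_one]
  rw [← trace_colGram_mul, colGram, smul_mul_assoc, trace_smul, Matrix.mul_assoc, trace_mul_comm,
    Matrix.mul_assoc, colRes_mul_transpose hN hx, ← Matrix.mul_assoc]
  have h2 : (x • (1 : Matrix ι ι ℝ) + N⁻¹ • (X * Xᵀ)) * rowRes N x X = 1 := by
    rw [rowRes, mul_nonsing_inv _ (isUnit_det_resolvent (posSemidef_rowGram hN X) hx)]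
  have h3 := congrArg trace h2
  rw [Matrix.add_mul, trace_add, smul_mul_assoc, smul_mul_assoc, Matrix.one_mul, trace_smul,
    trace_smul, trace_one, smul_eq_mul] at h3
  simp only [Finset.sum_const, Finset.card_univ, nsmul_eq_mul, mul_one]
  linarith

theorem abs_trace_transpose_mul_le {η : ℝ} (hη : 0 < η) (A B : Matrix ι κ ℝ) :
    |(Aᵀ * B).trace| ≤ 2⁻¹ * (η * ∑ i, ∑ j, A i j ^ 2 + η⁻¹ * ∑ i, ∑ j, B i j ^ 2) := by
  have h1 : (Aᵀ * B).trace = ∑ i, ∑ j, A i j * B i j := by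
    rw [trace, Finset.sum_comm]
    simp [mul_apply]
  rw [h1, Finset.mul_sum, Finset.mul_sum, ← Finset.sum_add_distrib, Finset.mul_sum]
  refine (Finset.abs_sum_le_sum_abs _ _).trans (Finset.sum_le_sum fun i _ => ?_)
  rw [Finset.mul_sum, Finset.mul_sum, ← Finset.sum_add_distrib, Finset.mul_sum]
  refine (Finset.abs_sum_le_sum_abs _ _).trans (Finset.sum_le_sum fun j _ => ?_)
  have h2 : 0 ≤ η⁻¹ * (η * |A i j| - |B i j|) ^ 2 := by positivity
  have h3 : η⁻¹ * (η * |A i j| - |B i j|) ^ 2 =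
      η * |A i j| ^ 2 + η⁻¹ * |B i j| ^ 2 - 2 * (|A i j| * |B i j|) := by
    field_simp
    ring
  rw [sq_abs, sq_abs] at h3
  rw [abs_mul]
  linarith

/-- The resolvent identity makes the difference linear in Y - X, and a weighted arithmetic–geometric
inequality separates it from X and Y. The free weight η lets a vanishing mean square of Y - X
suffice. -/
theorem abs_trace_rowRes_sub_le {N x η : ℝ} (hN : 0 < N) (hx : 0 < x) (hη : 0 < η)
    (X Y : Matrix ι κ ℝ) :
    |(rowRes N x X).trace - (rowRes N x Y).trace| ≤
      N⁻¹ * (2⁻¹ * (η * (∑ i, ∑ j, X i j ^ 2 + ∑ i, ∑ j, Y i j ^ 2)) +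
        η⁻¹ * (x⁻¹ ^ 4 * ∑ i, ∑ j, (Y i j - X i j) ^ 2)) := by
  have hu := isUnit_det_resolvent (posSemidef_rowGram hN X) hx
  have hv := isUnit_det_resolvent (posSemidef_rowGram hN Y) hx
  set R := rowRes N x X with hR
  set Q := rowRes N x Y with hQ
  have hRt : Rᵀ = R := resolvent_transpose (posSemidef_rowGram hN X)
  have hQt : Qᵀ = Q := resolvent_transpose (posSemidef_rowGram hN Y)
  have hRn : ‖R‖ ≤ x⁻¹ := norm_resolvent_le (posSemidef_rowGram hN X) hx
  have hQn : ‖Q‖ ≤ x⁻¹ := norm_resolvent_le (posSemidef_rowGram hN Y) hx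
  have hdiff : R - Q = N⁻¹ • (R * ((Y - X) * Yᵀ) * Q + R * (X * (Y - X)ᵀ) * Q) := by
    have h1 : N⁻¹ • ((Y - X) * Yᵀ + X * (Y - X)ᵀ) =
        (x • (1 : Matrix ι ι ℝ) + N⁻¹ • (Y * Yᵀ)) - (x • (1 : Matrix ι ι ℝ) + N⁻¹ • (X * Xᵀ)) := by
      rw [add_sub_add_left_eq_sub, ← smul_sub, Matrix.sub_mul, transpose_sub, Matrix.mul_sub]
      congr 1
      abel
    rw [← Matrix.add_mul, ← Matrix.mul_add, ← Matrix.smul_mul, ← Matrix.mul_smul, h1,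
      Matrix.mul_sub, Matrix.sub_mul, hR, hQ, rowRes, rowRes, nonsing_inv_mul _ hu,
      Matrix.mul_assoc, mul_nonsing_inv _ hv, Matrix.mul_one, Matrix.one_mul]
  have hQR : ∀ M : Matrix ι ι ℝ, ‖M‖ ≤ x⁻¹ * x⁻¹ →
      ∑ i, ∑ j, (M * (Y - X)) i j ^ 2 ≤ x⁻¹ ^ 4 * ∑ i, ∑ j, (Y i j - X i j) ^ 2 := by
    intro M hM
    refine (sum_sq_mul_le M (Y - X)).trans ?_
    simp only [Matrix.sub_apply]
    refine mul_le_mul_of_nonneg_right ?_ (Finset.sum_nonneg fun i _ =>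
      Finset.sum_nonneg fun j _ => sq_nonneg _)
    calc ‖M‖ ^ 2 ≤ (x⁻¹ * x⁻¹) ^ 2 := pow_le_pow_left₀ (norm_nonneg _) hM 2
      _ = x⁻¹ ^ 4 := by ring
  have hm : ∀ M M' : Matrix ι ι ℝ, ‖M‖ ≤ x⁻¹ → ‖M'‖ ≤ x⁻¹ → ‖M * M'‖ ≤ x⁻¹ * x⁻¹ :=
    fun M M' h h' => (l2_opNorm_mul M M').trans (mul_le_mul h h' (norm_nonneg _) (by positivity))
  have e1 : (R * ((Y - X) * Yᵀ) * Q).trace = (Yᵀ * ((Q * R) * (Y - X))).trace := by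
    calc (R * ((Y - X) * Yᵀ) * Q).trace = ((R * (Y - X)) * (Yᵀ * Q)).trace := by
          simp only [Matrix.mul_assoc]
      _ = ((Yᵀ * Q) * (R * (Y - X))).trace := trace_mul_comm _ _
      _ = _ := by simp only [Matrix.mul_assoc]
  have e2 : (R * (X * (Y - X)ᵀ) * Q).trace = (Xᵀ * ((R * Q) * (Y - X))).trace := by
    calc (R * (X * (Y - X)ᵀ) * Q).trace = ((R * (X * (Y - X)ᵀ) * Q)ᵀ).trace :=
          (trace_transpose _).symm
      _ = ((Q * (Y - X)) * (Xᵀ * R)).trace := by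
          simp only [transpose_mul, transpose_transpose, hRt, hQt, Matrix.mul_assoc]
      _ = ((Xᵀ * R) * (Q * (Y - X))).trace := trace_mul_comm _ _
      _ = _ := by simp only [Matrix.mul_assoc]
  have b1 := abs_trace_transpose_mul_le hη Y ((Q * R) * (Y - X))
  have b2 := abs_trace_transpose_mul_le hη X ((R * Q) * (Y - X))
  have c1 := mul_le_mul_of_nonneg_left (hQR (Q * R) (hm _ _ hQn hRn)) (inv_pos.2 hη).le
  have c2 := mul_le_mul_of_nonneg_left (hQR (R * Q) (hm _ _ hRn hQn)) (inv_pos.2 hη).le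
  rw [← trace_sub, hdiff, trace_smul, smul_eq_mul, abs_mul, abs_of_pos (inv_pos.2 hN), trace_add,
    e1, e2]
  refine mul_le_mul_of_nonneg_left ?_ (inv_pos.2 hN).le
  refine (abs_add_le _ _).trans ?_
  linarith

end Resolvent

/-! ### Test matrices and the deterministic approximate fixed-point equation -/

section Resolvent

open Matrix
open scoped Matrix.Norms.L2Operator

variable {ι κ : Type*} [Fintype ι] [DecidableEq ι] [Fintype κ] [DecidableEq κ]

/-- The test matrix `(1 + u Γ)⁻¹ Γ`. -/
noncomputable def testMatrix (u : ℝ) (Γ : Matrix κ κ ℝ) : Matrix κ κ ℝ := (1 + u • Γ)⁻¹ * Γ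

theorem isUnit_det_one_add {u : ℝ} (hu : 0 ≤ u) {Γ : Matrix κ κ ℝ} (hΓ : Γ.PosSemidef) :
    IsUnit (1 + u • Γ).det := by
  have := isUnit_det_resolvent (hΓ.smul hu) one_pos
  rwa [one_smul] at this

/-- The relation for which the test matrix is designed: it recombines two unknown traces into one.
-/
theorem testMatrix_mul {u : ℝ} (hu : 0 ≤ u) {Γ : Matrix κ κ ℝ} (hΓ : Γ.PosSemidef) :
    testMatrix u Γ + u • (testMatrix u Γ * Γ) = Γ := by
  have h := isUnit_det_one_add hu hΓ
  have h1 : (1 + u • Γ) * Γ = Γ * (1 + u • Γ) := by simp [Matrix.add_mul, Matrix.mul_add]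
  have h2 : testMatrix u Γ * (1 + u • Γ) = Γ := by
    rw [testMatrix, Matrix.mul_assoc, ← h1, ← Matrix.mul_assoc, nonsing_inv_mul _ h,
      Matrix.one_mul]
  rwa [Matrix.mul_add, Matrix.mul_one, Matrix.mul_smul] at h2

theorem norm_testMatrix_le {u : ℝ} (hu : 0 ≤ u) {Γ : Matrix κ κ ℝ} (hΓ : Γ.PosSemidef) :
    ‖testMatrix u Γ‖ ≤ ‖Γ‖ := by
  have := norm_resolvent_le (hΓ.smul hu) one_pos
  rw [one_smul, inv_one] at this
  refine (l2_opNorm_mul _ _).trans ?_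
  exact mul_le_of_le_one_left (norm_nonneg _) this

theorem abs_inv_one_add_sub_le {q t : ℝ} (hq : 0 ≤ q) (ht : 0 ≤ t) :
    |(1 + q)⁻¹ - (1 + t)⁻¹| ≤ |q - t| := by
  have h1 : (1 + q)⁻¹ - (1 + t)⁻¹ = (t - q) * ((1 + q)⁻¹ * (1 + t)⁻¹) := by
    field_simp
    ring
  rw [h1, abs_mul, abs_sub_comm]
  refine mul_le_of_le_one_right (abs_nonneg _) ?_
  rw [abs_of_nonneg (by positivity)]
  exact mul_le_one₀ (inv_le_one_of_one_le₀ (by linarith)) (by positivity)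
    (inv_le_one_of_one_le₀ (by linarith))

/-- Write q_i(A) for the leave-one-out forms, G for `colRes`, τ₁ = n⁻¹ tr(GΓ), τ = n⁻¹ tr(GBΓ). If
q_i(1) ≈ τ₁, q_i(B) ≈ τ and m ≈ s, then xs ≈ (1 + τ₁)⁻¹, and the trace identity gives n⁻¹ tr B ≈ x
n⁻¹ tr(GB) + cxsτ. With B + csBΓ = Γ the right side is xτ₁ ≈ 1/s - x. No limit of G itself is
needed. -/
theorem abs_trace_testMatrix_sub_le [Nonempty ι] [Nonempty κ] {x s c Λ : ℝ} (hx : 0 < x)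
    (hs : 0 < s) (hc : 0 < c) {C Γ : Matrix κ κ ℝ} (hC : Γ = Cᵀ * C) (hΛ : ‖Γ‖ ≤ Λ)
    (X : Matrix ι κ ℝ) {n p m : ℝ} (hn : n = Fintype.card κ) (hp : p = Fintype.card ι)
    (hpn : p / n ≤ c + 1) (hm : m = p⁻¹ * (rowRes n x X).trace) :
    |n⁻¹ * (testMatrix (c * s) Γ).trace - (s⁻¹ - x)| ≤
      n⁻¹ * ∑ i, |looForm n x X (testMatrix (c * s) Γ) i -
        n⁻¹ * (colRes n x X * (testMatrix (c * s) Γ * Γ)).trace| +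
      Λ ^ 2 * ((c + 1) * |m - s| + s * |p / n - c|) +
      (1 + Λ * x⁻¹) / s * (x * |m - s| +
        p⁻¹ * ∑ i, |looForm n x X 1 i - n⁻¹ * (colRes n x X * (1 * Γ)).trace|) := by
  have hΓ : Γ.PosSemidef := by
    rw [hC, ← conjTranspose_eq_transpose_of_trivial]
    exact posSemidef_conjTranspose_mul_self C
  have hn0 : 0 < n := by rw [hn]; exact_mod_cast Fintype.card_pos
  have hp0 : 0 < p := by rw [hp]; exact_mod_cast Fintype.card_pos
  have hΛ0 : 0 ≤ Λ := (norm_nonneg _).trans hΛ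
  have hcs : 0 ≤ c * s := by positivity
  set B := testMatrix (c * s) Γ with hB
  have hBn : ‖B‖ ≤ Λ := (norm_testMatrix_le hcs hΓ).trans hΛ
  have hGn : ‖colRes n x X‖ ≤ x⁻¹ := norm_colRes_le hn0 hx X
  set τ₁ := n⁻¹ * (colRes n x X * (1 * Γ)).trace with hτ₁
  set τ := n⁻¹ * (colRes n x X * (B * Γ)).trace with hτ
  set S₁ := p⁻¹ * ∑ i, |looForm n x X 1 i - τ₁| with hS₁
  set S₂ := n⁻¹ * ∑ i, |looForm n x X B i - τ| with hS₂
  set β : ι → ℝ := fun i => (1 + looForm n x X 1 i)⁻¹ with hβ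
  have hq : ∀ i, 0 ≤ looForm n x X 1 i := looForm_one_nonneg hn0 hx X
  have hβ0 : ∀ i, 0 ≤ β i := fun i => inv_nonneg.2 (by linarith [hq i])
  have hβ1 : ∀ i, β i ≤ 1 := fun i => inv_le_one_of_one_le₀ (by linarith [hq i])
  -- tr(GΓ) = tr(C G Cᵀ), the trace of a positive semidefinite matrix.
  have hτ₁0 : 0 ≤ τ₁ := by
    have h1 := (posDef_resolvent (posSemidef_colGram hn0 X) hx).inv.posSemidef
    refine mul_nonneg (inv_nonneg.2 hn0.le) ?_
    have h2 := h1.mul_mul_conjTranspose_same C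
    have h3 : (colRes n x X * (1 * Γ)).trace = (C * colRes n x X * Cᴴ).trace := by
      rw [hC, Matrix.one_mul, Matrix.mul_assoc C, trace_mul_comm C, Matrix.mul_assoc,
        conjTranspose_eq_transpose_of_trivial]
    rw [h3]
    exact h2.trace_nonneg
  have htr : ∀ M : Matrix κ κ ℝ, ∀ K, ‖M‖ ≤ K → |n⁻¹ * (colRes n x X * M).trace| ≤ x⁻¹ * K := by
    intro M K hM
    have h1 := abs_trace_le (colRes n x X * M)
    rw [← hn] at h1
    have h2 : ‖colRes n x X * M‖ ≤ x⁻¹ * K :=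
      (l2_opNorm_mul _ _).trans (mul_le_mul hGn hM (norm_nonneg _) (by positivity))
    rw [abs_mul, abs_of_pos (by positivity), inv_mul_le_iff₀ hn0]
    exact h1.trans (mul_le_mul_of_nonneg_left h2 hn0.le)
  have hτ₁1 : τ₁ ≤ Λ * x⁻¹ := by
    have := (le_abs_self _).trans (htr (1 * Γ) Λ (by rwa [Matrix.one_mul]))
    linarith
  have hτb : |τ| ≤ x⁻¹ * Λ ^ 2 := by
    refine htr (B * Γ) (Λ ^ 2) ?_
    rw [pow_two]
    exact (l2_opNorm_mul _ _).trans (mul_le_mul hBn hΛ (norm_nonneg _) hΛ0)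
  have hsum : ∑ i, β i = x * (p * m) := by
    rw [hm, ← mul_assoc p, mul_inv_cancel₀ hp0.ne', one_mul]
    exact sum_inv_one_add_looForm hn0 hx X
  -- the limit of `τ₁`
  have hA1 : |x * m - (1 + τ₁)⁻¹| ≤ S₁ := by
    have h1 : x * m - (1 + τ₁)⁻¹ = p⁻¹ * ∑ i, (β i - (1 + τ₁)⁻¹) := by
      rw [Finset.sum_sub_distrib, hsum, Finset.sum_const, Finset.card_univ, nsmul_eq_mul, ← hp]
      field_simp
    rw [h1, abs_mul, abs_of_pos (by positivity)]
    refine mul_le_mul_of_nonneg_left ?_ (by positivity)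
    exact (Finset.abs_sum_le_sum_abs _ _).trans
      (Finset.sum_le_sum fun i _ => abs_inv_one_add_sub_le (hq i) hτ₁0)
  have hS₁0 : 0 ≤ S₁ := (abs_nonneg _).trans hA1
  have hA2 : |x * s - (1 + τ₁)⁻¹| ≤ x * |m - s| + S₁ := by
    have h1 : x * s - (1 + τ₁)⁻¹ = (x * m - (1 + τ₁)⁻¹) - x * (m - s) := by ring
    have h2 : |x * (m - s)| = x * |m - s| := by rw [abs_mul, abs_of_pos hx]
    rw [h1]
    refine (abs_sub _ _).trans ?_
    linarith
  have hA3 : |x * τ₁ - (s⁻¹ - x)| ≤ (1 + Λ * x⁻¹) / s * (x * |m - s| + S₁) := by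
    have h1 : x * τ₁ - (s⁻¹ - x) = (1 + τ₁) / s * (x * s - (1 + τ₁)⁻¹) := by
      field_simp
      ring
    rw [h1, abs_mul, abs_of_nonneg (by positivity)]
    gcongr
  -- the trace identity
  have hB1 : |n⁻¹ * B.trace - x * (n⁻¹ * (colRes n x X * B).trace) - n⁻¹ * (∑ i, β i) * τ| ≤ S₂ := by
    have h1 := trace_sub_mul_trace_colRes hn0 hx X B
    have h2 : n⁻¹ * B.trace - x * (n⁻¹ * (colRes n x X * B).trace) - n⁻¹ * (∑ i, β i) * τ =
        n⁻¹ * ∑ i, β i * (looForm n x X B i - τ) := by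
      have h3 : ∑ i, β i * (looForm n x X B i - τ) =
          ∑ i, β i * looForm n x X B i - (∑ i, β i) * τ := by
        rw [Finset.sum_mul, ← Finset.sum_sub_distrib]
        refine Finset.sum_congr rfl fun i _ => by ring
      rw [h3, ← h1]
      ring
    rw [h2, abs_mul, abs_of_pos (by positivity)]
    refine mul_le_mul_of_nonneg_left ?_ (by positivity)
    refine (Finset.abs_sum_le_sum_abs _ _).trans (Finset.sum_le_sum fun i _ => ?_)
    rw [abs_mul, abs_of_nonneg (hβ0 i)]
    exact mul_le_of_le_one_left (abs_nonneg _) (hβ1 i)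
  have hB2 : |(n⁻¹ * (∑ i, β i) - c * x * s) * τ| ≤
      Λ ^ 2 * ((c + 1) * |m - s| + s * |p / n - c|) := by
    have h1 : n⁻¹ * (∑ i, β i) - c * x * s = x * ((p / n) * (m - s) + s * (p / n - c)) := by
      rw [hsum]
      field_simp
      ring
    have h2 : |(p / n) * (m - s) + s * (p / n - c)| ≤ (c + 1) * |m - s| + s * |p / n - c| := by
      refine (abs_add_le _ _).trans ?_
      rw [abs_mul, abs_mul, abs_of_pos hs, abs_of_pos (by positivity : 0 < p / n)]
      gcongr
    rw [h1, abs_mul, abs_mul, abs_of_pos hx]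
    calc x * |(p / n) * (m - s) + s * (p / n - c)| * |τ|
        ≤ x * ((c + 1) * |m - s| + s * |p / n - c|) * (x⁻¹ * Λ ^ 2) := by gcongr
      _ = _ := by field_simp
  -- Here B + csBΓ = Γ eliminates the unknown tr(GB).
  have hB3 : x * (n⁻¹ * (colRes n x X * B).trace) + c * x * s * τ = x * τ₁ := by
    rw [hτ, hτ₁, Matrix.one_mul]
    have h1 := congrArg (fun M => (colRes n x X * M).trace) (testMatrix_mul hcs hΓ)
    simp only [Matrix.mul_add, trace_add, Matrix.mul_smul, trace_smul, smul_eq_mul] at h1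
    rw [← h1]
    ring
  have hfin : n⁻¹ * B.trace - (s⁻¹ - x) =
      (n⁻¹ * B.trace - x * (n⁻¹ * (colRes n x X * B).trace) - n⁻¹ * (∑ i, β i) * τ) +
      (n⁻¹ * (∑ i, β i) - c * x * s) * τ + (x * τ₁ - (s⁻¹ - x)) := by
    rw [← hB3]
    ring
  rw [hfin]
  exact (abs_add_three _ _ _).trans (add_le_add (add_le_add hB1 hB2) hA3)

end Resolvent

/-! ### Random quadratic forms -/

section QuadraticForm

variable {Ω : Type*} [MeasurableSpace Ω] {P : Measure Ω}

/-- Independent centred random variables with unit variance and fourth moment at most `M`. -/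
structure IsNoise {κ : Type*} (P : Measure Ω) (z : κ → Ω → ℝ) (M : ℝ) : Prop where
  meas : ∀ j, Measurable (z j)
  indep : iIndepFun z P
  mean : ∀ j, ∫ ω, z j ω ∂P = 0
  var : ∀ j, ∫ ω, z j ω ^ 2 ∂P = 1
  memLp : ∀ j, MemLp (z j) 4 P
  fourth : ∀ j, ∫ ω, z j ω ^ 4 ∂P ≤ M

namespace IsNoise

variable {κ : Type*} [DecidableEq κ] {z : κ → Ω → ℝ} {M : ℝ} [IsProbabilityMeasure P]

theorem integrable_pow_four (h : IsNoise P z M) (j : κ) : Integrable (fun ω => z j ω ^ 4) P := by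
  have := (h.memLp j).integrable_norm_pow (p := 4) (by norm_num)
  refine this.congr (Eventually.of_forall fun ω => ?_)
  simp only [Real.norm_eq_abs]
  exact Even.pow_abs (by decide) _

theorem integrable_sq (h : IsNoise P z M) (j : κ) : Integrable (fun ω => z j ω ^ 2) P := by
  have hm := h.meas j
  refine ((h.integrable_pow_four j).add (integrable_const 1)).mono
    (by fun_prop : Measurable _).aestronglyMeasurable (Eventually.of_forall fun ω => ?_)
  rw [Real.norm_of_nonneg (by positivity)]
  refine le_trans ?_ (le_abs_self _)
  simp only [Pi.add_apply]
  nlinarith [sq_nonneg (z j ω ^ 2 - 1), sq_nonneg (z j ω)]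

theorem integrable_mul (h : IsNoise P z M) (j k : κ) :
    Integrable (fun ω => z j ω * z k ω) P := by
  have hj := h.meas j
  have hk := h.meas k
  refine ((h.integrable_sq j).add (h.integrable_sq k)).mono
    (by fun_prop : Measurable _).aestronglyMeasurable (Eventually.of_forall fun ω => ?_)
  simp only [Real.norm_eq_abs, Pi.add_apply]
  rw [abs_of_nonneg (by positivity : 0 ≤ z j ω ^ 2 + z k ω ^ 2), abs_le]
  constructor <;> nlinarith [sq_nonneg (z j ω - z k ω), sq_nonneg (z j ω + z k ω)]

theorem integrable_mul_four (h : IsNoise P z M) (j k l m : κ) :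
    Integrable (fun ω => z j ω * z k ω * (z l ω * z m ω)) P := by
  have hj := h.meas j
  have hk := h.meas k
  have hl := h.meas l
  have hm := h.meas m
  refine (((h.integrable_pow_four j).add (h.integrable_pow_four k)).add
    ((h.integrable_pow_four l).add (h.integrable_pow_four m))).mono
    (by fun_prop : Measurable _).aestronglyMeasurable (Eventually.of_forall fun ω => ?_)
  simp only [Real.norm_eq_abs, Pi.add_apply]
  rw [abs_of_nonneg (by positivity : 0 ≤ z j ω ^ 4 + z k ω ^ 4 + (z l ω ^ 4 + z m ω ^ 4))]
  have key : ∀ a b : ℝ, |a * b| ≤ a ^ 2 + b ^ 2 := fun a b => by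
    rw [abs_le]
    constructor <;> nlinarith [sq_nonneg (a - b), sq_nonneg (a + b), sq_nonneg a, sq_nonneg b]
  have k1 := key (z j ω * z k ω) (z l ω * z m ω)
  have k2 : (z j ω * z k ω) ^ 2 ≤ z j ω ^ 4 + z k ω ^ 4 := by
    nlinarith [sq_nonneg (z j ω ^ 2 - z k ω ^ 2), sq_nonneg (z j ω ^ 2 + z k ω ^ 2)]
  have k3 : (z l ω * z m ω) ^ 2 ≤ z l ω ^ 4 + z m ω ^ 4 := by
    nlinarith [sq_nonneg (z l ω ^ 2 - z m ω ^ 2), sq_nonneg (z l ω ^ 2 + z m ω ^ 2)]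
  linarith

theorem integral_mul (h : IsNoise P z M) (j k : κ) :
    ∫ ω, z j ω * z k ω ∂P = if j = k then 1 else 0 := by
  split_ifs with hjk
  · subst hjk
    simpa [pow_two] using h.var j
  · have := (h.indep.indepFun hjk).integral_fun_mul_eq_mul_integral
      (h.meas j).aestronglyMeasurable (h.meas k).aestronglyMeasurable
    rw [this, h.mean, zero_mul]

theorem integral_mul_four_eq_zero (h : IsNoise P z M) {j k l m : κ} (hk : j ≠ k) (hl : j ≠ l)
    (hm : j ≠ m) : ∫ ω, z j ω * z k ω * (z l ω * z m ω) ∂P = 0 := by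
  have h1 := h.indep.indepFun_finset {j} {k, l, m} (by simp [hk, hl, hm]) h.meas
  have h2 := h1.comp
    (φ := fun v : ({j} : Finset κ) → ℝ => v ⟨j, by simp⟩)
    (ψ := fun v : ({k, l, m} : Finset κ) → ℝ =>
      v ⟨k, by simp⟩ * (v ⟨l, by simp⟩ * v ⟨m, by simp⟩))
    (measurable_pi_apply (X := fun _ : ({j} : Finset κ) => ℝ) _)
    (by
      have m1 := fun i : ({k, l, m} : Finset κ) =>
        measurable_pi_apply (X := fun _ : ({k, l, m} : Finset κ) => ℝ) i
      exact (m1 _).mul ((m1 _).mul (m1 _)))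
  have hj' := h.meas j
  have hk' := h.meas k
  have hl' := h.meas l
  have hm' := h.meas m
  have h3 := h2.integral_fun_mul_eq_mul_integral
    (by simp only [Function.comp_def]; exact hj'.aestronglyMeasurable)
    (by
      simp only [Function.comp_def]
      exact (by fun_prop : Measurable fun ω => z k ω * (z l ω * z m ω)).aestronglyMeasurable)
  simp only [Function.comp_def] at h3
  simp only [mul_assoc]
  rw [h3, h.mean, zero_mul]

theorem integral_sq_mul_sq (h : IsNoise P z M) {j l : κ} (hl : j ≠ l) :
    ∫ ω, z j ω * z j ω * (z l ω * z l ω) ∂P = 1 := by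
  have h2 := (h.indep.indepFun hl).comp (φ := fun x : ℝ => x * x) (ψ := fun x : ℝ => x * x)
    (by fun_prop) (by fun_prop)
  have hj' := h.meas j
  have hl' := h.meas l
  have h3 := h2.integral_fun_mul_eq_mul_integral
    (by simp only [Function.comp_def]; exact (by fun_prop : Measurable _).aestronglyMeasurable)
    (by simp only [Function.comp_def]; exact (by fun_prop : Measurable _).aestronglyMeasurable)
  simp only [Function.comp_def] at h3
  rw [h3, h.integral_mul, h.integral_mul]
  simp

/-- The centred products `z_j z_k - E z_j z_k`. -/
noncomputable def centred (z : κ → Ω → ℝ) (q : κ × κ) (ω : Ω) : ℝ :=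
  z q.1 ω * z q.2 ω - if q.1 = q.2 then 1 else 0

theorem measurable_centred (h : IsNoise P z M) (q : κ × κ) : Measurable (centred z q) := by
  have h1 := h.meas q.1
  have h2 := h.meas q.2
  unfold centred
  fun_prop

theorem centred_mul_eq (q q' : κ × κ) (ω : Ω) : centred z q ω * centred z q' ω =
    z q.1 ω * z q.2 ω * (z q'.1 ω * z q'.2 ω) -
      (if q'.1 = q'.2 then 1 else 0) * (z q.1 ω * z q.2 ω) -
      (if q.1 = q.2 then 1 else 0) * (z q'.1 ω * z q'.2 ω) +
      (if q.1 = q.2 then 1 else 0) * (if q'.1 = q'.2 then 1 else 0) := by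
  unfold centred
  ring

theorem integrable_centred_mul (h : IsNoise P z M) (q q' : κ × κ) :
    Integrable (fun ω => centred z q ω * centred z q' ω) P := by
  simp only [centred_mul_eq]
  exact (((h.integrable_mul_four _ _ _ _).sub ((h.integrable_mul _ _).const_mul _)).sub
    ((h.integrable_mul _ _).const_mul _)).add (integrable_const _)

theorem integral_centred_mul (h : IsNoise P z M) (q q' : κ × κ) :
    ∫ ω, centred z q ω * centred z q' ω ∂P =
      ∫ ω, z q.1 ω * z q.2 ω * (z q'.1 ω * z q'.2 ω) ∂P -
        (if q.1 = q.2 then 1 else 0) * (if q'.1 = q'.2 then 1 else 0) := by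
  simp only [centred_mul_eq]
  have i1 := h.integrable_mul_four q.1 q.2 q'.1 q'.2
  have i2 := (h.integrable_mul q.1 q.2).const_mul (if q'.1 = q'.2 then (1 : ℝ) else 0)
  have i3 := (h.integrable_mul q'.1 q'.2).const_mul (if q.1 = q.2 then (1 : ℝ) else 0)
  have e1 := integral_add ((i1.sub i2).sub i3) (integrable_const
    ((if q.1 = q.2 then (1 : ℝ) else 0) * (if q'.1 = q'.2 then 1 else 0)))
  have e2 := integral_sub (i1.sub i2) i3
  have e3 := integral_sub i1 i2
  simp only [Pi.sub_apply] at e1 e2 e3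
  rw [e1, e2, e3, integral_const_mul, integral_const_mul, h.integral_mul, h.integral_mul,
    integral_const, probReal_univ, one_smul]
  ring

/-- Unless the pairs agree up to order, either some index occurs exactly once among the four and
independence gives 0, or the product is z_j²z_l² with j ≠ l, whose mean 1 is cancelled by the
centring. -/
theorem integral_centred_mul_eq_zero (h : IsNoise P z M) {q q' : κ × κ} (h1 : q' ≠ q)
    (h2 : q' ≠ q.swap) : ∫ ω, centred z q ω * centred z q' ω ∂P = 0 := by
  obtain ⟨j, k⟩ := q
  obtain ⟨l, m⟩ := q'
  rw [h.integral_centred_mul]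
  simp only [Prod.swap_prod_mk, ne_eq, Prod.mk.injEq] at h1 h2 ⊢
  have hj := h.integral_mul_four_eq_zero (j := j) (k := k) (l := l) (m := m)
  have hk := h.integral_mul_four_eq_zero (j := k) (k := j) (l := l) (m := m)
  have hl := h.integral_mul_four_eq_zero (j := l) (k := m) (l := j) (m := k)
  have hm := h.integral_mul_four_eq_zero (j := m) (k := l) (l := j) (m := k)
  have ek : ∀ ω, z k ω * z j ω * (z l ω * z m ω) = z j ω * z k ω * (z l ω * z m ω) :=
    fun ω => by ring
  have el : ∀ ω, z l ω * z m ω * (z j ω * z k ω) = z j ω * z k ω * (z l ω * z m ω) :=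
    fun ω => by ring
  have em : ∀ ω, z m ω * z l ω * (z j ω * z k ω) = z j ω * z k ω * (z l ω * z m ω) :=
    fun ω => by ring
  simp only [ek] at hk
  simp only [el] at hl
  simp only [em] at hm
  by_cases hjk : j = k
  · subst hjk
    by_cases hlm : l = m
    · subst hlm
      have hjl : j ≠ l := fun e => h1 ⟨e.symm, e.symm⟩
      rw [h.integral_sq_mul_sq hjl]
      simp
    · simp only [hlm, if_false, mul_zero, sub_zero]
      by_cases hlj : l = j
      · subst hlj
        exact hm (Ne.symm hlm) (Ne.symm hlm) (Ne.symm hlm)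
      · exact hl hlm hlj hlj
  · simp only [hjk, if_false, zero_mul, sub_zero]
    by_cases hlm : l = m
    · subst hlm
      by_cases hjl : j = l
      · subst hjl
        exact hk (Ne.symm hjk) (Ne.symm hjk) (Ne.symm hjk)
      · exact hj hjk hjl hjl
    · by_cases hjl : j = l
      · subst hjl
        have hkm : k ≠ m := fun e => h1 ⟨rfl, e.symm⟩
        exact hk (Ne.symm hjk) (Ne.symm hjk) hkm
      · by_cases hjm : j = m
        · subst hjm
          have hkl : k ≠ l := fun e => h2 ⟨e.symm, rfl⟩
          exact hk (Ne.symm hjk) hkl (Ne.symm hjk)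
        · exact hj hjk hjl hjm

/-- Expectation of (z² - 1)² ≥ 0. -/
theorem one_le (h : IsNoise P z M) (j : κ) : 1 ≤ M := by
  have h1 : ∫ ω, (2 * z j ω ^ 2 - 1) ∂P ≤ ∫ ω, z j ω ^ 4 ∂P := by
    refine integral_mono (((h.integrable_sq j).const_mul 2).sub (integrable_const _))
      (h.integrable_pow_four j) fun ω => ?_
    simp only
    nlinarith [sq_nonneg (z j ω ^ 2 - 1)]
  rw [integral_sub ((h.integrable_sq j).const_mul 2) (integrable_const _), integral_const_mul,
    h.var, integral_const, probReal_univ, one_smul] at h1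
  linarith [h.fourth j]

theorem integral_centred_sq_le (h : IsNoise P z M) (q : κ × κ) :
    ∫ ω, centred z q ω * centred z q ω ∂P ≤ M := by
  obtain ⟨j, k⟩ := q
  rw [h.integral_centred_mul]
  by_cases hjk : j = k
  · subst hjk
    have : ∀ ω, z j ω * z j ω * (z j ω * z j ω) = z j ω ^ 4 := fun ω => by ring
    simp only [this]
    have := h.fourth j
    simp
    linarith
  · have e : ∀ ω, z j ω * z k ω * (z j ω * z k ω) = z j ω * z j ω * (z k ω * z k ω) :=
      fun ω => by ring
    simp only [e]
    rw [h.integral_sq_mul_sq hjk]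
    simpa [hjk] using h.one_le j

theorem abs_integral_centred_mul_le (h : IsNoise P z M) (q q' : κ × κ) :
    |∫ ω, centred z q ω * centred z q' ω ∂P| ≤
      M * ((if q' = q then 1 else 0) + (if q' = q.swap then 1 else 0)) := by
  have hM := h.one_le q.1
  by_cases h0 : q' = q ∨ q' = q.swap
  · have h1 : |∫ ω, centred z q ω * centred z q' ω ∂P| ≤ M := by
      have i1 := (h.integrable_centred_mul q q).const_mul 2⁻¹
      have i2 := (h.integrable_centred_mul q' q').const_mul 2⁻¹
      calc |∫ ω, centred z q ω * centred z q' ω ∂P|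
          ≤ ∫ ω, |centred z q ω * centred z q' ω| ∂P := abs_integral_le_integral_abs
        _ ≤ ∫ ω, (2⁻¹ * (centred z q ω * centred z q ω) +
              2⁻¹ * (centred z q' ω * centred z q' ω)) ∂P := by
            refine integral_mono (h.integrable_centred_mul q q').abs (i1.add i2) fun ω => ?_
            simp only
            rw [abs_le]
            constructor <;> nlinarith [sq_nonneg (centred z q ω - centred z q' ω),
              sq_nonneg (centred z q ω + centred z q' ω)]
        _ ≤ M := by
            rw [integral_add i1 i2, integral_const_mul, integral_const_mul]
            linarith [h.integral_centred_sq_le q, h.integral_centred_sq_le q']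
    refine h1.trans ?_
    have h2 : (1 : ℝ) ≤ (if q' = q then 1 else 0) + (if q' = q.swap then 1 else 0) := by
      rcases h0 with h0 | h0
      · rw [if_pos h0]
        split_ifs <;> norm_num
      · rw [if_pos h0]
        split_ifs <;> norm_num
    nlinarith
  · push Not at h0
    rw [h.integral_centred_mul_eq_zero h0.1 h0.2, abs_zero, if_neg h0.1, if_neg h0.2]
    simp

variable [Fintype κ] [Nonempty κ]

/-- The variance of a quadratic form whose matrix is independent of the variables. -/
theorem integral_quadraticForm_sq_le (h : IsNoise P z M) {A : κ × κ → Ω → ℝ}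
    (hA : ∀ q, Measurable (A q)) {K T : ℝ} (hK : ∀ q ω, |A q ω| ≤ K)
    (hT : ∀ ω, ∑ q, A q ω ^ 2 ≤ T) (hind : IndepFun (fun ω q => A q ω) (fun ω j => z j ω) P) :
    Integrable (fun ω => (∑ q, A q ω * centred z q ω) ^ 2) P ∧
    ∫ ω, (∑ q, A q ω * centred z q ω) ^ 2 ∂P ≤ 2 * M * T := by
  have hAA : ∀ q q', Integrable (fun ω => A q ω * A q' ω) P := fun q q' => by
    have h1 := hA q
    have h2 := hA q'
    refine Integrable.of_bound (by fun_prop : Measurable _).aestronglyMeasurable (K * K)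
      (Eventually.of_forall fun ω => ?_)
    rw [Real.norm_eq_abs, abs_mul]
    exact mul_le_mul (hK q ω) (hK q' ω) (abs_nonneg _) ((abs_nonneg _).trans (hK q ω))
  have hsq : ∀ ω, (∑ q, A q ω * centred z q ω) ^ 2 =
      ∑ q, ∑ q', (A q ω * A q' ω) * (centred z q ω * centred z q' ω) := by
    intro ω
    rw [pow_two, Finset.sum_mul_sum]
    refine Finset.sum_congr rfl fun q _ => Finset.sum_congr rfl fun q' _ => by ring
  -- Independence lets each term factor, so only the covariances of the centred products matter.
  have hin : ∀ q q', IndepFun (fun ω => A q ω * A q' ω)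
      (fun ω => centred z q ω * centred z q' ω) P := by
    intro q q'
    exact hind.comp (φ := fun a : κ × κ → ℝ => a q * a q')
      (ψ := fun v : κ → ℝ => (v q.1 * v q.2 - if q.1 = q.2 then 1 else 0) *
        (v q'.1 * v q'.2 - if q'.1 = q'.2 then 1 else 0)) (by fun_prop) (by fun_prop)
  have hint : ∀ q q', Integrable
      (fun ω => (A q ω * A q' ω) * (centred z q ω * centred z q' ω)) P := fun q q' =>
    (hin q q').integrable_mul (hAA q q') (h.integrable_centred_mul q q')
  simp only [hsq]
  refine ⟨integrable_finsetSum _ fun q _ => integrable_finsetSum _ fun q' _ => hint q q', ?_⟩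
  rw [integral_finsetSum _ fun q _ => integrable_finsetSum _ fun q' _ => hint q q']
  have h1 : ∀ q, ∫ ω, ∑ q', (A q ω * A q' ω) * (centred z q ω * centred z q' ω) ∂P ≤
      ∑ q', (2⁻¹ * (∫ ω, A q ω * A q ω ∂P + ∫ ω, A q' ω * A q' ω ∂P)) *
        (M * ((if q' = q then 1 else 0) + (if q' = q.swap then 1 else 0))) := by
    intro q
    rw [integral_finsetSum _ fun q' _ => hint q q']
    refine Finset.sum_le_sum fun q' _ => ?_
    have hm1 := h.measurable_centred q
    have hm2 := h.measurable_centred q'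
    have hm3 := hA q
    have hm4 := hA q'
    rw [(hin q q').integral_fun_mul_eq_mul_integral
      (by fun_prop : Measurable _).aestronglyMeasurable
      (by fun_prop : Measurable _).aestronglyMeasurable]
    refine (le_abs_self _).trans ?_
    rw [abs_mul]
    refine mul_le_mul ?_ (h.abs_integral_centred_mul_le q q') (abs_nonneg _) ?_
    · rw [← integral_add (hAA q q) (hAA q' q'), ← integral_const_mul]
      refine abs_integral_le_integral_abs.trans (integral_mono (hAA q q').abs
        (((hAA q q).add (hAA q' q')).const_mul _) fun ω => ?_)
      simp only
      rw [abs_le]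
      constructor <;> nlinarith [sq_nonneg (A q ω - A q' ω), sq_nonneg (A q ω + A q' ω)]
    · have e1 : 0 ≤ ∫ ω, A q ω * A q ω ∂P := integral_nonneg fun ω => mul_self_nonneg _
      have e2 : 0 ≤ ∫ ω, A q' ω * A q' ω ∂P := integral_nonneg fun ω => mul_self_nonneg _
      positivity
  refine (Finset.sum_le_sum fun q _ => h1 q).trans ?_
  -- Only q' = q and q' = q.swap survive; their two contributions make the factor 2 in 2MT.
  have h2 : ∀ q, ∑ q', (2⁻¹ * (∫ ω, A q ω * A q ω ∂P + ∫ ω, A q' ω * A q' ω ∂P)) *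
        (M * ((if q' = q then 1 else 0) + (if q' = q.swap then 1 else 0))) =
      M * (∫ ω, A q ω * A q ω ∂P) +
        M * (2⁻¹ * (∫ ω, A q ω * A q ω ∂P + ∫ ω, A q.swap ω * A q.swap ω ∂P)) := by
    intro q
    simp only [mul_add, Finset.sum_add_distrib, mul_ite, mul_one, mul_zero, Finset.sum_ite_eq',
      Finset.mem_univ, if_true]
    ring
  rw [Finset.sum_congr rfl fun q _ => h2 q]
  have h3 : ∑ q : κ × κ, ∫ ω, A q.swap ω * A q.swap ω ∂P = ∑ q, ∫ ω, A q ω * A q ω ∂P :=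
    Equiv.sum_comp (Equiv.prodComm κ κ) fun q => ∫ ω, A q ω * A q ω ∂P
  have h4 : ∑ q, ∫ ω, A q ω * A q ω ∂P ≤ T := by
    rw [← integral_finsetSum _ fun q _ => hAA q q]
    calc ∫ ω, ∑ q, A q ω * A q ω ∂P ≤ ∫ _, T ∂P := by
          refine integral_mono (integrable_finsetSum _ fun q _ => hAA q q) (integrable_const _)
            fun ω => ?_
          simpa [pow_two] using hT ω
      _ = T := by simp
  rw [Finset.sum_add_distrib, ← Finset.mul_sum, ← Finset.mul_sum, ← Finset.mul_sum,
    Finset.sum_add_distrib, h3]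
  have := h.one_le (Classical.arbitrary κ)
  nlinarith

end IsNoise

end QuadraticForm

/-! ### Random Gram matrices with independent rows -/

section RandomGram

open Matrix
open scoped Matrix.Norms.L2Operator

variable {Ω : Type*} [MeasurableSpace Ω] {P : Measure Ω}
variable {ι κ ν : Type*} [Fintype ι] [DecidableEq ι] [Fintype κ] [DecidableEq κ] [Fintype ν]

/-- A random matrix with measurable entries. -/
def EntryMeasurable {ι κ : Type*} (A : Ω → Matrix ι κ ℝ) : Prop :=
  ∀ i j, Measurable fun ω => A ω i j

namespace EntryMeasurable

theorem const (A : Matrix ι κ ℝ) : EntryMeasurable fun _ : Ω => A :=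
  fun _ _ => measurable_const

theorem add {A B : Ω → Matrix ι κ ℝ} (hA : EntryMeasurable A) (hB : EntryMeasurable B) :
    EntryMeasurable fun ω => A ω + B ω :=
  fun i j => (hA i j).add (hB i j)

theorem smul {A : Ω → Matrix ι κ ℝ} (hA : EntryMeasurable A) (r : ℝ) :
    EntryMeasurable fun ω => r • A ω :=
  fun i j => (hA i j).const_mul r

theorem transpose {A : Ω → Matrix ι κ ℝ} (hA : EntryMeasurable A) :
    EntryMeasurable fun ω => (A ω)ᵀ :=
  fun i j => hA j i

theorem mul {A : Ω → Matrix ι κ ℝ} {B : Ω → Matrix κ ν ℝ} (hA : EntryMeasurable A)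
    (hB : EntryMeasurable B) : EntryMeasurable fun ω => A ω * B ω := by
  intro i j
  simp only [Matrix.mul_apply]
  exact Finset.measurable_fun_sum _ fun k _ => (hA i k).mul (hB k j)

theorem updateRow {A : Ω → Matrix ι κ ℝ} (hA : EntryMeasurable A) (i : ι) (v : κ → ℝ) :
    EntryMeasurable fun ω => (A ω).updateRow i v := by
  intro k j
  by_cases h : k = i
  · subst h
    simp
  · simpa [updateRow_ne h] using hA k j

theorem det {A : Ω → Matrix κ κ ℝ} (hA : EntryMeasurable A) : Measurable fun ω => (A ω).det := by
  simp only [Matrix.det_apply]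
  exact Finset.measurable_fun_sum _ fun σ _ =>
    (Finset.measurable_fun_prod _ fun k _ => hA _ _).const_smul _

theorem inv {A : Ω → Matrix κ κ ℝ} (hA : EntryMeasurable A) :
    EntryMeasurable fun ω => (A ω)⁻¹ := by
  intro i j
  simp only [Matrix.inv_def, Ring.inverse_eq_inv', Matrix.smul_apply, Matrix.adjugate_apply,
    smul_eq_mul]
  exact hA.det.inv.mul (hA.updateRow j _).det

theorem trace {A : Ω → Matrix κ κ ℝ} (hA : EntryMeasurable A) :
    Measurable fun ω => (A ω).trace :=
  Finset.measurable_fun_sum _ fun k _ => hA k k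

theorem colRes {A : Ω → Matrix ι κ ℝ} (hA : EntryMeasurable A) (N x : ℝ) :
    EntryMeasurable fun ω => colRes N x (A ω) :=
  ((const _).add ((hA.transpose.mul hA).smul _)).inv

theorem rowRes {A : Ω → Matrix ι κ ℝ} (hA : EntryMeasurable A) (N x : ℝ) :
    EntryMeasurable fun ω => rowRes N x (A ω) :=
  ((const _).add ((hA.mul hA.transpose).smul _)).inv

theorem looForm {A : Ω → Matrix ι κ ℝ} (hA : EntryMeasurable A) (N x : ℝ) (B : Matrix κ κ ℝ)
    (i : ι) : Measurable fun ω => looForm N x (A ω) B i := by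
  unfold _root_.looForm
  simp only [dotProduct, mulVec]
  have := ((hA.updateRow i 0).colRes N x).mul (const B)
  exact (Finset.measurable_fun_sum _ fun j _ => (hA i j).mul
    (Finset.measurable_fun_sum _ fun k _ => (this j k).mul (hA i k))).const_mul _

end EntryMeasurable

theorem dotProduct_mulVec_vecMul (z : κ → ℝ) (C A : Matrix κ κ ℝ) :
    (z ᵥ* C) ⬝ᵥ (A *ᵥ (z ᵥ* C)) = z ⬝ᵥ ((C * A * Cᵀ) *ᵥ z) := by
  rw [← mulVec_transpose, mulVec_mulVec, dotProduct_mulVec, vecMul_mulVec, transpose_transpose,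
    ← dotProduct_mulVec, ← Matrix.mul_assoc]

theorem dotProduct_mulVec_sub_trace (z : κ → ℝ) (A : Matrix κ κ ℝ) :
    z ⬝ᵥ (A *ᵥ z) - A.trace =
      ∑ q : κ × κ, A q.1 q.2 * (z q.1 * z q.2 - if q.1 = q.2 then 1 else 0) := by
  rw [Fintype.sum_prod_type]
  simp only [mul_sub, Finset.sum_sub_distrib, mul_ite, mul_one, mul_zero, Finset.sum_ite_eq,
    Finset.mem_univ, if_true, dotProduct, mulVec, Finset.mul_sum]
  congr 1
  exact Finset.sum_congr rfl fun i _ => Finset.sum_congr rfl fun j _ => by ring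

variable [IsProbabilityMeasure P] [Nonempty κ]

theorem IsNoise.row {Z : ι × κ → Ω → ℝ} {M : ℝ} (h : IsNoise P Z M) (i : ι) :
    IsNoise P (fun j => Z (i, j)) M where
  meas _ := h.meas _
  indep := h.indep.precomp (g := fun j => (i, j)) fun _ _ hjk => (Prod.mk.inj hjk).2
  mean _ := h.mean _
  var _ := h.var _
  memLp _ := h.memLp _
  fourth _ := h.fourth _

/-- With row i set to zero, the statistic depends on the other rows only. -/
theorem IsNoise.indepFun_row {Z : ι × κ → Ω → ℝ} {M : ℝ} (h : IsNoise P Z M) (i : ι)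
    {T : Matrix ι κ ℝ → κ × κ → ℝ}
    (hT : ∀ q, Measurable fun v : ι × κ → ℝ => T (of fun k j => v (k, j)) q) :
    IndepFun (fun ω q => T ((of fun k j => Z (k, j) ω).updateRow i 0) q)
      (fun ω j => Z (i, j) ω) P := by
  set S : Finset (ι × κ) := Finset.univ.filter fun q => q.1 ≠ i
  set S' : Finset (ι × κ) := Finset.univ.filter fun q => q.1 = i
  have hd : Disjoint S S' := by
    rw [Finset.disjoint_left]
    simp [S, S']
  have h1 := h.indep.indepFun_finset S S' hd h.meas
  -- Extension by zero from the entries outside row i, which reproduces `updateRow i 0`.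
  let R : (S → ℝ) → ι × κ → ℝ := fun v q => if hq : q ∈ S then v ⟨q, hq⟩ else 0
  have hR : Measurable R := by
    refine measurable_pi_lambda _ fun q => ?_
    by_cases hq : q ∈ S
    · simpa only [R, hq, dite_true] using measurable_pi_apply (X := fun _ : S => ℝ) ⟨q, hq⟩
    · simp [R, hq]
  have h2 := h1.comp (φ := fun v q => T (of fun k j => R v (k, j)) q)
    (ψ := fun (v : S' → ℝ) (j : κ) => v ⟨(i, j), by simp [S']⟩)
    (measurable_pi_lambda _ fun q => (hT q).comp hR)
    (measurable_pi_lambda _ fun j => measurable_pi_apply _)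
  have h3 : (fun ω q => T ((of fun k j => Z (k, j) ω).updateRow i 0) q) =
      (fun v q => T (of fun k j => R v (k, j)) q) ∘ fun ω (q : S) => Z q ω := by
    funext ω q
    simp only [Function.comp_def]
    congr 1
    ext k j
    by_cases hk : k = i
    · subst hk
      simp [R, S]
    · simp [R, S, hk, updateRow_ne]
  rw [h3]
  exact h2

/-- Concentration of the leave-one-out quadratic forms around normalized traces. -/
theorem integral_abs_looForm_sub_le {Z : ι × κ → Ω → ℝ} {M : ℝ} (h : IsNoise P Z M)
    {x n : ℝ} (hx : 0 < x) (hn : n = Fintype.card κ) (C B : Matrix κ κ ℝ) (i : ι) {D : ℝ}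
    (hD : ‖C‖ ^ 2 * x⁻¹ * ‖B‖ ≤ D) :
    let X : Ω → Matrix ι κ ℝ := fun ω => (of fun k j => Z (k, j) ω) * C
    Integrable (fun ω => |looForm n x (X ω) B i -
      n⁻¹ * (colRes n x (X ω) * (B * (Cᵀ * C))).trace|) P ∧
    ∫ ω, |looForm n x (X ω) B i - n⁻¹ * (colRes n x (X ω) * (B * (Cᵀ * C))).trace| ∂P ≤
      (1 + 2 * M * D ^ 2 + D) * (√n)⁻¹ := by
  intro X
  have hn1 : 1 ≤ n := by
    rw [hn]
    exact_mod_cast Fintype.card_pos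
  have hn0 : 0 < n := by linarith
  have hs0 : 0 < √n := Real.sqrt_pos.2 hn0
  have hD0 : 0 ≤ D := le_trans (by positivity) hD
  set T : Matrix ι κ ℝ → Matrix κ κ ℝ := fun W => C * (colRes n x (W * C) * B) * Cᵀ with hTdef
  have hZm : EntryMeasurable fun ω => (of fun k j => Z (k, j) ω : Matrix ι κ ℝ) :=
    fun k j => h.meas (k, j)
  have hXm : EntryMeasurable X := hZm.mul (.const C)
  have hTn : ∀ W, ‖T W‖ ≤ D := by
    intro W
    refine le_trans ?_ hD
    calc ‖T W‖ ≤ ‖C‖ * (x⁻¹ * ‖B‖) * ‖Cᵀ‖ := by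
          refine (l2_opNorm_mul _ _).trans (mul_le_mul_of_nonneg_right ?_ (norm_nonneg _))
          refine (l2_opNorm_mul _ _).trans (mul_le_mul_of_nonneg_left ?_ (norm_nonneg _))
          refine (l2_opNorm_mul _ _).trans (mul_le_mul_of_nonneg_right ?_ (norm_nonneg _))
          exact norm_colRes_le hn0 hx _
      _ = ‖C‖ ^ 2 * x⁻¹ * ‖B‖ := by
          rw [← conjTranspose_eq_transpose_of_trivial, l2_opNorm_conjTranspose]
          ring
  have hTm : ∀ q : κ × κ, Measurable fun v : ι × κ → ℝ => T (of fun k j => v (k, j)) q.1 q.2 := by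
    intro q
    have hA : EntryMeasurable fun v : ι × κ → ℝ => (of fun k j => v (k, j) : Matrix ι κ ℝ) :=
      fun k j => measurable_pi_apply _
    exact (((EntryMeasurable.const C).mul (((hA.mul (.const C)).colRes n x).mul (.const B))).mul
      (.const Cᵀ)) q.1 q.2
  set W : Ω → Matrix ι κ ℝ := fun ω => (of fun k j => Z (k, j) ω).updateRow i 0 with hW
  have hWC : ∀ ω, W ω * C = (X ω).updateRow i 0 := by
    intro ω
    rw [hW, updateRow_mul, zero_vecMul]
  obtain ⟨q1, q2⟩ := (h.row i).integral_quadraticForm_sq_le (A := fun q ω => T (W ω) q.1 q.2)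
    (K := D) (T := n * D ^ 2) (fun q => (((EntryMeasurable.const C).mul
      ((((hZm.updateRow i 0).mul (.const C)).colRes n x).mul (.const B))).mul (.const Cᵀ)) q.1 q.2)
    (fun q ω => (abs_entry_le _ _ _).trans (hTn _))
    (fun ω => by
      rw [Fintype.sum_prod_type]
      refine (sum_sq_le_card (T (W ω))).trans ?_
      rw [hn]
      exact mul_le_mul_of_nonneg_left (pow_le_pow_left₀ (norm_nonneg _) (hTn _) 2)
        (Nat.cast_nonneg _))
    (h.indepFun_row i (T := fun W q => T W q.1 q.2) hTm)
  set Q : Ω → ℝ := fun ω => ∑ q : κ × κ, T (W ω) q.1 q.2 *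
    IsNoise.centred (fun j => Z (i, j)) q ω with hQ
  have key : ∀ ω, looForm n x (X ω) B i -
      n⁻¹ * (colRes n x ((X ω).updateRow i 0) * (B * (Cᵀ * C))).trace = n⁻¹ * Q ω := by
    intro ω
    have e1 : (colRes n x ((X ω).updateRow i 0) * (B * (Cᵀ * C))).trace = (T (W ω)).trace := by
      rw [hTdef]
      simp only
      rw [hWC, trace_mul_comm _ Cᵀ, ← Matrix.mul_assoc, trace_mul_comm _ (Cᵀ * C),
        Matrix.mul_assoc]
    have e2 : X ω i = (fun j => Z (i, j) ω) ᵥ* C := by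
      ext j
      simp [X, mul_apply, vecMul, dotProduct]
    rw [looForm, e1, ← mul_sub, e2, dotProduct_mulVec_vecMul, ← hWC]
    congr 1
    exact dotProduct_mulVec_sub_trace _ _
  have hbound : ∀ ω, |looForm n x (X ω) B i -
      n⁻¹ * (colRes n x (X ω) * (B * (Cᵀ * C))).trace| ≤
      (√n)⁻¹ + √n * (n⁻¹ ^ 2 * Q ω ^ 2) + D * (√n)⁻¹ := by
    intro ω
    -- The inequality y ≤ n^(-1/2) + n^(1/2) y² converts the variance bound of order 1/n into a mean
    -- bound of order n^(-1/2).
    have b1 : |n⁻¹ * Q ω| ≤ (√n)⁻¹ + √n * (n⁻¹ ^ 2 * Q ω ^ 2) := by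
      rw [← mul_pow, ← sq_abs (n⁻¹ * Q ω)]
      set y := |n⁻¹ * Q ω|
      have h3 : (√n)⁻¹ + √n * y ^ 2 - y =
          (√n)⁻¹ * ((√n * y - 2⁻¹) ^ 2 + 3 / 4) := by
        field_simp
        ring
      have : 0 ≤ (√n)⁻¹ * ((√n * y - 2⁻¹) ^ 2 + 3 / 4) := by positivity
      linarith
    -- The quadratic form concentrates around the trace without row i; restoring the row costs only
    -- D/n after normalization.
    have b2 := abs_trace_colRes_sub_le hn0 hx (X ω) (B * (Cᵀ * C)) i
    have b3 : ‖B * (Cᵀ * C)‖ * x⁻¹ ≤ D := by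
      refine le_trans ?_ hD
      have : ‖B * (Cᵀ * C)‖ ≤ ‖B‖ * (‖C‖ * ‖C‖) := by
        refine (l2_opNorm_mul _ _).trans (mul_le_mul_of_nonneg_left ?_ (norm_nonneg _))
        rw [← l2_opNorm_conjTranspose_mul_self, conjTranspose_eq_transpose_of_trivial]
      calc _ ≤ ‖B‖ * (‖C‖ * ‖C‖) * x⁻¹ := by gcongr
        _ = _ := by ring
    have b4 : n⁻¹ ≤ (√n)⁻¹ := by
      refine inv_anti₀ hs0 ?_
      rw [Real.sqrt_le_left hn0.le]
      nlinarith
    have e : looForm n x (X ω) B i - n⁻¹ * (colRes n x (X ω) * (B * (Cᵀ * C))).trace =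
        n⁻¹ * Q ω + n⁻¹ * ((colRes n x ((X ω).updateRow i 0) * (B * (Cᵀ * C))).trace -
          (colRes n x (X ω) * (B * (Cᵀ * C))).trace) := by
      rw [← key]
      ring
    rw [e]
    refine (abs_add_le _ _).trans (add_le_add b1 ?_)
    rw [abs_mul, abs_of_pos (inv_pos.2 hn0), mul_comm]
    exact mul_le_mul (b2.trans b3) b4 (by positivity) hD0
  have hint : Integrable (fun ω => (√n)⁻¹ + √n * (n⁻¹ ^ 2 * Q ω ^ 2) + D * (√n)⁻¹) P :=
    ((integrable_const _).add ((q1.const_mul _).const_mul _)).add (integrable_const _)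
  have hmeas : Measurable fun ω => |looForm n x (X ω) B i -
      n⁻¹ * (colRes n x (X ω) * (B * (Cᵀ * C))).trace| :=
    (((hXm.looForm n x B i).sub (((hXm.colRes n x).mul (.const _)).trace.const_mul _))).abs
  have hI := hint.mono' hmeas.aestronglyMeasurable (Eventually.of_forall fun ω => by
    rw [Real.norm_eq_abs, abs_abs]
    exact hbound ω)
  refine ⟨hI, (integral_mono hI hint hbound).trans ?_⟩
  rw [integral_add (f := fun ω => (√n)⁻¹ + √n * (n⁻¹ ^ 2 * Q ω ^ 2))
      ((integrable_const _).add ((q1.const_mul _).const_mul _)) (integrable_const _),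
    integral_add (integrable_const _) ((q1.const_mul _).const_mul _), integral_const_mul,
    integral_const_mul, integral_const, integral_const, probReal_univ, one_smul, one_smul]
  have e5 : √n * (n⁻¹ ^ 2 * (2 * M * (n * D ^ 2))) = 2 * M * D ^ 2 * (√n)⁻¹ := by
    have : n = √n ^ 2 := (Real.sq_sqrt hn0.le).symm
    have h2 : √n * (n⁻¹ ^ 2 * n) = (√n)⁻¹ := by
      nth_rewrite 2 3 [this]
      field_simp
    linear_combination (2 * M * D ^ 2) * h2
  have e6 : √n * (n⁻¹ ^ 2 * ∫ ω, Q ω ^ 2 ∂P) ≤ √n * (n⁻¹ ^ 2 * (2 * M * (n * D ^ 2))) := by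
    gcongr
  linarith

end RandomGram

/-! ### Square-integrable random series -/

section RandomSeries

variable {Ω : Type*} [MeasurableSpace Ω] {P : Measure Ω}

/-- Cauchy–Schwarz with weights |a_k|. -/
theorem sq_tsum_mul_le {a y : ℕ → ℝ} (ha : Summable fun k => |a k|)
    (hy : Summable fun k => |a k| * y k ^ 2) :
    Summable (fun k => a k * y k) ∧
      (∑' k, a k * y k) ^ 2 ≤ (∑' k, |a k|) * ∑' k, |a k| * y k ^ 2 := by
  have hs : Summable fun k => a k * y k := by
    refine Summable.of_norm_bounded (ha.add hy) fun k => ?_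
    rw [Real.norm_eq_abs, abs_mul]
    have h1 : |y k| ≤ 1 + y k ^ 2 := by
      rw [← sq_abs]
      nlinarith [sq_nonneg (|y k| - 1), abs_nonneg (y k)]
    nlinarith [mul_le_mul_of_nonneg_left h1 (abs_nonneg (a k))]
  refine ⟨hs, le_of_tendsto' (hs.hasSum.tendsto_sum_nat.pow 2) fun N => ?_⟩
  refine (Finset.sum_sq_le_sum_mul_sum_of_sq_le_mul _ (f := fun k => |a k|)
    (g := fun k => |a k| * y k ^ 2) (fun k _ => abs_nonneg _) (fun k _ => by positivity)
    fun k _ => le_of_eq ?_).trans ?_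
  · rw [mul_pow, ← sq_abs (a k)]
    ring
  · exact mul_le_mul (ha.sum_le_tsum _ fun k _ => abs_nonneg _)
      (hy.sum_le_tsum _ fun k _ => by positivity)
      (Finset.sum_nonneg fun k _ => by positivity) (tsum_nonneg fun k => abs_nonneg _)

/-- The series ∑ |a_k| Y_k² has finite expectation by Tonelli, so it converges almost surely;
weighted Cauchy–Schwarz then controls ∑ a_k Y_k. No independence is involved. -/
theorem ae_summable_and_integral_sq_tsum_le {a : ℕ → ℝ} (ha : Summable fun k => |a k|)
    {Y : ℕ → Ω → ℝ} (hm : ∀ k, Measurable (Y k)) (hi : ∀ k, Integrable (fun ω => Y k ω ^ 2) P)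
    {B : ℝ} (hB : ∀ k, ∫ ω, Y k ω ^ 2 ∂P ≤ B) :
    (∀ᵐ ω ∂P, Summable fun k => a k * Y k ω) ∧
    Integrable (fun ω => (∑' k, a k * Y k ω) ^ 2) P ∧
    ∫ ω, (∑' k, a k * Y k ω) ^ 2 ∂P ≤ B * (∑' k, |a k|) ^ 2 := by
  set A := ∑' k, |a k| with hA
  have hA0 : 0 ≤ A := tsum_nonneg fun k => abs_nonneg _
  have hB0 : 0 ≤ B := (integral_nonneg fun ω => sq_nonneg _).trans (hB 0)
  set G : Ω → ℝ≥0∞ := fun ω => ∑' k, ENNReal.ofReal (|a k| * Y k ω ^ 2) with hG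
  have hGm : Measurable G := by
    refine Measurable.tsum fun k => ?_
    have := hm k
    fun_prop
  have hGi : ∫⁻ ω, G ω ∂P ≤ ENNReal.ofReal (A * B) := by
    rw [lintegral_tsum fun k => by have := hm k; fun_prop]
    calc ∑' k, ∫⁻ ω, ENNReal.ofReal (|a k| * Y k ω ^ 2) ∂P
        ≤ ∑' k, ENNReal.ofReal (|a k| * B) := by
          refine ENNReal.tsum_le_tsum fun k => ?_
          rw [← ofReal_integral_eq_lintegral_ofReal ((hi k).const_mul _)
            (Eventually.of_forall fun ω => by positivity), integral_const_mul]
          exact ENNReal.ofReal_le_ofReal (mul_le_mul_of_nonneg_left (hB k) (abs_nonneg _))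
      _ = ENNReal.ofReal (A * B) := by
          rw [← ENNReal.ofReal_tsum_of_nonneg (fun k => by positivity) (ha.mul_right B),
            tsum_mul_right]
  have hfin : ∀ᵐ ω ∂P, G ω < ⊤ :=
    ae_lt_top hGm (ne_top_of_le_ne_top ENNReal.ofReal_ne_top hGi)
  have hsum : ∀ ω, G ω < ⊤ → Summable fun k => |a k| * Y k ω ^ 2 := by
    intro ω hω
    have := ENNReal.summable_toReal hω.ne
    refine this.congr fun k => ?_
    rw [ENNReal.toReal_ofReal (by positivity)]
  have hs : ∀ᵐ ω ∂P, Summable fun k => a k * Y k ω := by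
    filter_upwards [hfin] with ω hω using (sq_tsum_mul_le ha (hsum ω hω)).1
  have hmeas : Measurable fun ω => ∑' k, a k * Y k ω :=
    Measurable.tsum fun k => (hm k).const_mul _
  have hle : ∫⁻ ω, ENNReal.ofReal ((∑' k, a k * Y k ω) ^ 2) ∂P ≤
      ENNReal.ofReal (B * A ^ 2) := by
    calc ∫⁻ ω, ENNReal.ofReal ((∑' k, a k * Y k ω) ^ 2) ∂P
        ≤ ∫⁻ ω, ENNReal.ofReal A * G ω ∂P := by
          refine lintegral_mono_ae ?_
          filter_upwards [hfin] with ω hω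
          rw [hG]
          simp only
          rw [← ENNReal.ofReal_tsum_of_nonneg (fun k => by positivity) (hsum ω hω),
            ← ENNReal.ofReal_mul hA0]
          exact ENNReal.ofReal_le_ofReal (sq_tsum_mul_le ha (hsum ω hω)).2
      _ ≤ ENNReal.ofReal A * ENNReal.ofReal (A * B) := by
          rw [lintegral_const_mul _ hGm]
          exact mul_le_mul_right hGi _
      _ = ENNReal.ofReal (B * A ^ 2) := by
          rw [← ENNReal.ofReal_mul hA0]
          congr 1
          ring
  have hint : Integrable (fun ω => (∑' k, a k * Y k ω) ^ 2) P := by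
    refine ⟨(hmeas.pow_const 2).aestronglyMeasurable, ?_⟩
    rw [hasFiniteIntegral_iff_ofReal (Eventually.of_forall fun ω => sq_nonneg _)]
    exact hle.trans_lt ENNReal.ofReal_lt_top
  refine ⟨hs, hint, ?_⟩
  rw [← ENNReal.ofReal_le_ofReal_iff (by positivity),
    ofReal_integral_eq_lintegral_ofReal hint (Eventually.of_forall fun ω => sq_nonneg _)]
  exact hle

end RandomSeries

/-! ### The periodized linear process -/

section Periodized

open Matrix
open scoped Matrix.Norms.L2Operator

/-- The circulant matrix of the filter truncated at lag `n`. -/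
noncomputable def filterMatrix (φ : ℕ → ℝ) (n : ℕ) [NeZero n] : Matrix (Fin n) (Fin n) ℝ :=
  of fun j t => φ ((t - j : Fin n) : ℕ)

/-- The circulant is ∑ φ_k times cyclic shifts, and a permutation matrix has norm at most 1. -/
theorem norm_filterMatrix_le {φ : ℕ → ℝ} (hφ : Summable fun k => |φ k|) (n : ℕ) [NeZero n] :
    ‖filterMatrix φ n‖ ≤ ∑' k, |φ k| := by
  have h1 : filterMatrix φ n =
      ∑ k : Fin n, φ k • (Equiv.addRight k).permMatrix ℝ := by
    ext j t
    simp only [filterMatrix, of_apply, Matrix.sum_apply, Matrix.smul_apply,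
      Equiv.Perm.permMatrix, PEquiv.toMatrix_apply, Equiv.toPEquiv_apply, smul_eq_mul]
    rw [Finset.sum_eq_single (t - j)]
    · simp
    · intro k _ hk
      have : ¬ j + k = t := fun h => hk (by rw [← h, add_sub_cancel_left])
      simp [this]
    · simp
  rw [h1]
  refine (norm_sum_le _ _).trans ?_
  calc ∑ k : Fin n, ‖φ k • (Equiv.addRight k).permMatrix ℝ‖
      ≤ ∑ k : Fin n, |φ k| := by
        refine Finset.sum_le_sum fun k _ => ?_
        rw [norm_smul, Real.norm_eq_abs]
        exact mul_le_of_le_one_right (abs_nonneg _) (permMatrix_l2_opNorm_le _)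
    _ = ∑ k ∈ Finset.range n, |φ k| := Fin.sum_univ_eq_sum_range (fun k => |φ k|) n
    _ ≤ ∑' k, |φ k| := hφ.sum_le_tsum _ fun k _ => abs_nonneg _

/-- The innovations at the epochs `1, …, n`. -/
noncomputable def noiseMatrix {Ω : Type*} (ε : ℕ → ℤ → Ω → ℝ) (p n : ℕ) (ω : Ω) : Matrix (Fin p) (Fin n) ℝ :=
  of fun i j => ε i (((j : ℕ) : ℤ) + 1) ω

/-- Written as a series over all lags, zero from lag n on, to be compared term by term with the
linear process. -/
theorem noiseMatrix_mul_filterMatrix_apply {Ω : Type*} (φ : ℕ → ℝ) (ε : ℕ → ℤ → Ω → ℝ)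
    (p n : ℕ) [NeZero n] (ω : Ω) (i : Fin p) (t : Fin n) :
    (noiseMatrix ε p n ω * filterMatrix φ n) i t =
      ∑' k : ℕ, φ k * (if h : k < n then ε i ((((t - ⟨k, h⟩ : Fin n) : ℕ) : ℤ) + 1) ω else 0) := by
  rw [tsum_eq_sum (s := Finset.range n) (by
    intro k hk
    simp [Finset.mem_range.not.1 hk]), ← Fin.sum_univ_eq_sum_range, mul_apply,
    ← (Equiv.subLeft t).sum_comp]
  refine Finset.sum_congr rfl fun k _ => ?_
  simp only [noiseMatrix, filterMatrix, of_apply, Equiv.subLeft_apply, sub_sub_cancel, Fin.is_lt,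
    dite_true, Fin.eta]
  ring

/-- The sum of the absolute filter coefficients at lags larger than `t`. -/
noncomputable def filterTail (φ : ℕ → ℝ) (t : ℕ) : ℝ := ∑' k, |if t < k then φ k else 0|

theorem summable_filterTail {φ : ℕ → ℝ} (hφ : Summable fun k => |φ k|) (t : ℕ) :
    Summable fun k => |if t < k then φ k else 0| := by
  refine Summable.of_nonneg_of_le (fun k => abs_nonneg _) (fun k => ?_) hφ
  split_ifs
  · exact le_rfl
  · simp

theorem filterTail_nonneg (φ : ℕ → ℝ) (t : ℕ) : 0 ≤ filterTail φ t :=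
  tsum_nonneg fun _ => abs_nonneg _

theorem filterTail_le {φ : ℕ → ℝ} (hφ : Summable fun k => |φ k|) (t : ℕ) :
    filterTail φ t ≤ ∑' k, |φ k| := by
  refine (summable_filterTail hφ t).tsum_le_tsum (fun k => ?_) hφ
  split_ifs
  · exact le_rfl
  · simp

theorem tendsto_filterTail {φ : ℕ → ℝ} (hφ : Summable fun k => |φ k|) :
    Tendsto (filterTail φ) atTop (𝓝 0) := by
  have := tendsto_tsum_of_dominated_convergence (𝓕 := atTop)
    (f := fun t k => |if t < k then φ k else 0|) (g := fun _ => (0 : ℝ)) hφ (fun k => by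
      refine tendsto_const_nhds.congr' ?_
      filter_upwards [eventually_ge_atTop k] with t ht
      simp [not_lt.2 ht]) (Eventually.of_forall fun t k => by
      rw [Real.norm_eq_abs, abs_abs]
      split_ifs
      · exact le_rfl
      · simp)
  rw [tsum_zero] at this
  exact this

/-- The mean square of the filter tails. -/
noncomputable def meanSqTail (φ : ℕ → ℝ) (n : ℕ) : ℝ := (n : ℝ)⁻¹ * ∑ t ∈ Finset.range n, filterTail φ t ^ 2

theorem tendsto_meanSqTail {φ : ℕ → ℝ} (hφ : Summable fun k => |φ k|) :
    Tendsto (meanSqTail φ) atTop (𝓝 0) := by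
  have := ((tendsto_filterTail hφ).pow 2).cesaro
  rw [zero_pow two_ne_zero] at this
  exact this

variable {Ω : Type*} [MeasurableSpace Ω] {P : Measure Ω}

theorem linearProcess_L2 {ε : ℕ → ℤ → Ω → ℝ} {M : ℝ} [IsProbabilityMeasure P]
    (hε : IsNoise P (fun q : ℕ × ℤ => ε q.1 q.2) M) {φ : ℕ → ℝ} (hφ : Summable fun k => |φ k|)
    (i : ℕ) (t : ℤ) :
    (∀ᵐ ω ∂P, Summable fun k : ℕ => φ k * ε i (t - k) ω) ∧
    Integrable (fun ω => linearProcess φ ε i t ω ^ 2) P ∧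
    ∫ ω, linearProcess φ ε i t ω ^ 2 ∂P ≤ (∑' k, |φ k|) ^ 2 := by
  have := ae_summable_and_integral_sq_tsum_le hφ (P := P) (Y := fun k => ε i (t - k)) (B := 1)
    (fun k => hε.meas (i, t - k)) (fun k => hε.integrable_sq (i, t - k))
    (fun k => (hε.var (i, t - k)).le)
  rwa [one_mul] at this

/-- The process and its periodization use the same innovations until the lag wraps around the time
origin; the longer lags cost only the tail of the filter. -/
theorem linearProcess_sub_L2 {ε : ℕ → ℤ → Ω → ℝ} {M : ℝ} [IsProbabilityMeasure P]
    (hε : IsNoise P (fun q : ℕ × ℤ => ε q.1 q.2) M) {φ : ℕ → ℝ} (hφ : Summable fun k => |φ k|)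
    (p n : ℕ) [NeZero n] (i : Fin p) (t : Fin n) :
    Integrable (fun ω => (dataMatrix φ ε p n ω i t -
      (noiseMatrix ε p n ω * filterMatrix φ n) i t) ^ 2) P ∧
    ∫ ω, (dataMatrix φ ε p n ω i t - (noiseMatrix ε p n ω * filterMatrix φ n) i t) ^ 2 ∂P ≤
      4 * filterTail φ t ^ 2 := by
  set W : ℕ → Ω → ℝ := fun k ω =>
    if h : k < n then ε i ((((t - ⟨k, h⟩ : Fin n) : ℕ) : ℤ) + 1) ω else 0 with hW
  set V : ℕ → Ω → ℝ := fun k => ε i ((((t : ℕ) : ℤ) + 1) - k) with hV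
  -- The index t counts from 0 and stands for the epoch t + 1, so lags k ≤ t reach back to epoch 1
  -- at the earliest and do not wrap.
  have hVW : ∀ (k : ℕ) ω, k ≤ (t : ℕ) → W k ω = V k ω := by
    intro k ω hk
    have hkn : k < n := hk.trans_lt t.2
    have e : ((t - ⟨k, hkn⟩ : Fin n) : ℕ) = t - k := by
      rw [Fin.sub_val_of_le (by simpa [Fin.le_def] using hk)]
    simp only [hW, hV, dif_pos hkn, e]
    congr 1
    push_cast [hk]
    ring
  have hVm : ∀ k, Measurable (V k) := fun k => hε.meas (_, _)
  have hWm : ∀ k, Measurable (W k) := by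
    intro k
    by_cases h : k < n
    · simp only [hW, dif_pos h]
      exact hε.meas (_, _)
    · simp [hW, dif_neg h]
  have hVi : ∀ k, Integrable (fun ω => V k ω ^ 2) P := fun k => hε.integrable_sq (_, _)
  have hWi : ∀ k, Integrable (fun ω => W k ω ^ 2) P := by
    intro k
    by_cases h : k < n
    · simp only [hW, dif_pos h]
      exact hε.integrable_sq (_, _)
    · simp [hW, dif_neg h]
  have hV1 : ∀ k, ∫ ω, V k ω ^ 2 ∂P ≤ 1 := fun k => (hε.var (_, _)).le
  have hW1 : ∀ k, ∫ ω, W k ω ^ 2 ∂P ≤ 1 := by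
    intro k
    by_cases h : k < n
    · simp only [hW, dif_pos h]
      exact (hε.var (_, _)).le
    · simp [hW, dif_neg h]
  have hb : ∀ k ω, (V k ω - W k ω) ^ 2 ≤ 2 * V k ω ^ 2 + 2 * W k ω ^ 2 := fun k ω => by
    nlinarith [sq_nonneg (V k ω + W k ω)]
  have hdi : ∀ k, Integrable (fun ω => (V k ω - W k ω) ^ 2) P := by
    intro k
    have h1 := hVm k
    have h2 := hWm k
    refine (((hVi k).const_mul 2).add ((hWi k).const_mul 2)).mono'
      (by fun_prop : Measurable _).aestronglyMeasurable (Eventually.of_forall fun ω => ?_)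
    rw [Real.norm_of_nonneg (sq_nonneg _)]
    exact hb k ω
  have hd1 : ∀ k, ∫ ω, (V k ω - W k ω) ^ 2 ∂P ≤ 4 := by
    intro k
    refine (integral_mono (hdi k) (((hVi k).const_mul 2).add ((hWi k).const_mul 2))
      (hb k)).trans ?_
    have := integral_add ((hVi k).const_mul 2) ((hWi k).const_mul 2)
    simp only [Pi.add_apply] at this ⊢
    rw [this, integral_const_mul, integral_const_mul]
    linarith [hV1 k, hW1 k]
  obtain ⟨-, r3, r4⟩ := ae_summable_and_integral_sq_tsum_le (summable_filterTail hφ t) (P := P)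
    (fun k => (hVm k).sub (hWm k)) hdi hd1
  have hsV := (linearProcess_L2 hε hφ i (((t : ℕ) : ℤ) + 1)).1
  have hsW := (ae_summable_and_integral_sq_tsum_le hφ (P := P) hWm hWi hW1).1
  have hae : (fun ω => (∑' k, (if (t : ℕ) < k then φ k else 0) * (V k ω - W k ω)) ^ 2) =ᵐ[P]
      fun ω => (dataMatrix φ ε p n ω i t -
        (noiseMatrix ε p n ω * filterMatrix φ n) i t) ^ 2 := by
    filter_upwards [hsV, hsW] with ω h1 h2
    congr 1
    rw [noiseMatrix_mul_filterMatrix_apply, dataMatrix, of_apply, linearProcess]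
    rw [← h1.tsum_sub h2]
    refine tsum_congr fun k => ?_
    by_cases hk : (t : ℕ) < k
    · rw [if_pos hk, mul_sub]
    · rw [if_neg hk, zero_mul, hVW k ω (not_lt.1 hk), ← mul_sub, sub_self, mul_zero]
  simp only [Pi.sub_apply] at r3 r4
  refine ⟨r3.congr hae, ?_⟩
  rw [← integral_congr_ae hae]
  exact r4

end Periodized

/-! ### Empirical spectral distributions and resolvents -/

section EmpiricalSpectrum

open Matrix
open scoped Matrix.Norms.L2Operator

/-- The columns of U are common eigenvectors of A and B, so T = A⁻¹B is diagonal in that basis. It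
serves the real eigenbasis of the covariance matrix and the complex Fourier basis of the circulant.
-/
theorem trace_eq_sum_div {K κ : Type*} [Field K] [Fintype κ] [DecidableEq κ]
    {A B T U : Matrix κ κ K} {a b : κ → K} (hU : IsUnit U.det) (hA : IsUnit A.det)
    (hAU : A * U = U * diagonal a) (hBU : B * U = U * diagonal b) (ha : ∀ i, a i ≠ 0)
    (hT : A * T = B) : T.trace = ∑ i, b i / a i := by
  have h1 : A * (T * U) = A * (U * diagonal fun i => b i / a i) := by
    rw [← Matrix.mul_assoc, hT, hBU, ← Matrix.mul_assoc, hAU, Matrix.mul_assoc, diagonal_mul_diagonal]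
    congr 3
    funext i
    rw [mul_div_cancel₀ _ (ha i)]
  have h2 : T * U = U * diagonal fun i => b i / a i := by
    have := congrArg (A⁻¹ * ·) h1
    simpa [← Matrix.mul_assoc, nonsing_inv_mul _ hA] using this
  have h3 : T = U * (diagonal fun i => b i / a i) * U⁻¹ := by
    rw [← h2, Matrix.mul_assoc, mul_nonsing_inv _ hU, Matrix.mul_one]
  rw [h3, trace_mul_comm, ← Matrix.mul_assoc, nonsing_inv_mul _ hU, Matrix.one_mul, trace_diagonal]

theorem integral_esd {p : ℕ} {A : Matrix (Fin p) (Fin p) ℝ} (hA : A.IsHermitian) (u : ℝ → ℝ) :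
    ∫ t, u t ∂(esd hA) = (p : ℝ)⁻¹ * ∑ i, u (hA.eigenvalues i) := by
  rw [esd, integral_smul_measure, integral_finsetSum_measure fun i _ => integrable_dirac (by simp)]
  simp

theorem trace_resolvent_eq_sum {p : ℕ} {A : Matrix (Fin p) (Fin p) ℝ} (hA : A.PosSemidef)
    {x : ℝ} (hx : 0 < x) :
    (x • (1 : Matrix (Fin p) (Fin p) ℝ) + A)⁻¹.trace =
      ∑ i, (max (hA.isHermitian.eigenvalues i) 0 + x)⁻¹ := by
  have hdet := isUnit_det_resolvent hA hx
  set U : Matrix (Fin p) (Fin p) ℝ :=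
    (hA.isHermitian.eigenvectorUnitary : Matrix (Fin p) (Fin p) ℝ)
  have hU : IsUnit U.det :=
    (Matrix.isUnit_iff_isUnit_det _).1
      (Unitary.toUnits hA.isHermitian.eigenvectorUnitary).isUnit
  have hAU : A * U = U * diagonal hA.isHermitian.eigenvalues := by
    ext i j
    have := congrFun (hA.isHermitian.mulVec_eigenvectorBasis j) i
    rw [mul_diagonal, mul_apply]
    simp only [U, IsHermitian.eigenvectorUnitary_apply]
    simpa [mulVec, dotProduct, mul_comm] using this
  have hmax : ∀ i, max (hA.isHermitian.eigenvalues i) 0 = hA.isHermitian.eigenvalues i :=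
    fun i => max_eq_left (hA.eigenvalues_nonneg i)
  rw [trace_eq_sum_div (a := fun i => hA.isHermitian.eigenvalues i + x) (b := fun _ => 1) hU hdet
    ?_ ?_ (fun i => (add_pos_of_nonneg_of_pos (hA.eigenvalues_nonneg i) hx).ne')
    (mul_nonsing_inv _ hdet)]
  · simp [hmax]
  · rw [Matrix.add_mul, hAU, smul_mul_assoc, Matrix.one_mul]
    ext i j
    simp only [Matrix.add_apply, Matrix.smul_apply, mul_diagonal, smul_eq_mul]
    ring
  · simp

/-- The bounded continuous function equal to `t ↦ (t + x)⁻¹` on the half line. -/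
noncomputable def resolventTest {x : ℝ} (hx : 0 < x) : ℝ →ᵇ ℝ :=
  BoundedContinuousFunction.ofNormedAddCommGroup (fun t => (max t 0 + x)⁻¹)
    (Continuous.inv₀ (by fun_prop) fun t => (add_pos_of_nonneg_of_pos (le_max_right t 0) hx).ne')
    x⁻¹ fun t => by
      rw [Real.norm_of_nonneg (inv_nonneg.2 (add_nonneg (le_max_right t 0) hx.le))]
      exact inv_anti₀ hx (le_add_of_nonneg_left (le_max_right t 0))

/-- A bounded continuous function detecting the negative half line. -/
noncomputable def negativeTest : ℝ →ᵇ ℝ :=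
  BoundedContinuousFunction.ofNormedAddCommGroup (fun t => min (max (-t) 0) 1) (by fun_prop) 1
    fun t => by
      rw [Real.norm_of_nonneg (le_min (le_max_right _ _) zero_le_one)]
      exact min_le_right _ _

variable {Ω : Type*} {φ : ℕ → ℝ} {ε : ℕ → ℤ → Ω → ℝ}

theorem posSemidef_sampleCov (p n : ℕ) (ω : Ω) : (sampleCov φ ε p n ω).PosSemidef := by
  have := posSemidef_self_mul_conjTranspose (dataMatrix φ ε p n ω)
  rw [conjTranspose_eq_transpose_of_trivial] at this
  exact this.smul (by positivity : (0 : ℝ) ≤ 1 / n)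

theorem integral_resolventTest_esd {x : ℝ} (hx : 0 < x) (p n : ℕ) (ω : Ω) :
    ∫ t, resolventTest hx t ∂(esd (sampleCov_isHermitian φ ε p n ω)) =
      (p : ℝ)⁻¹ * (rowRes n x (dataMatrix φ ε p n ω)).trace := by
  rw [integral_esd, rowRes, ← one_div (n : ℝ)]
  congr 1
  exact (trace_resolvent_eq_sum (posSemidef_sampleCov (φ := φ) (ε := ε) p n ω) hx).symm

variable [MeasurableSpace Ω] {P : Measure Ω} [IsProbabilityMeasure P] {p : ℕ → ℕ} {F : Measure ℝ}
  [IsProbabilityMeasure F]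

/-- Sample eigenvalues are nonnegative, so a bounded continuous function positive exactly on the
negative half line has zero integral in the limit. -/
theorem IsLSD.measure_Iio (hF : IsLSD P φ ε p F) : F (Iio 0) = 0 := by
  obtain ⟨ω, hω⟩ := hF.exists
  have h1 : ∫ t, negativeTest t ∂F = 0 := by
    refine tendsto_nhds_unique (hω negativeTest) (tendsto_const_nhds.congr fun n => ?_)
    rw [integral_esd, Finset.sum_eq_zero, mul_zero]
    intro i _
    have := (posSemidef_sampleCov (φ := φ) (ε := ε) (p n) n ω).eigenvalues_nonneg i
    change min (max (-_) 0) 1 = 0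
    rw [max_eq_right (by linarith), min_eq_left zero_le_one]
  have h2 : (fun t => negativeTest t) =ᵐ[F] 0 :=
    (integral_eq_zero_iff_of_nonneg (fun t => le_min (le_max_right _ _) zero_le_one)
      (negativeTest.integrable F)).1 h1
  refine measure_mono_null (t := {t | ¬ negativeTest t = (0 : ℝ → ℝ) t}) (fun t ht h => ?_)
    (ae_iff.1 h2)
  have h3 : min (max (-t) 0) 1 = 0 := h
  have : 0 < min (max (-t) 0) 1 := lt_min (lt_max_of_lt_left (neg_pos.2 ht)) one_pos
  exact this.ne' h3

theorem entryMeasurable_dataMatrix (hε : ∀ i t, Measurable (ε i t)) (p n : ℕ) :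
    EntryMeasurable fun ω => dataMatrix φ ε p n ω :=
  fun i _ => Measurable.tsum fun _ => (hε i _).const_mul _

/-- Zero dimensions are admitted, with 0⁻¹ = 0, because dominated convergence needs the bound for
every n. -/
theorem abs_inv_mul_trace_rowRes_le {ι κ : Type*} [Fintype ι] [DecidableEq ι] [Fintype κ]
    [DecidableEq κ] {n : ℝ} (hn : 0 ≤ n) {x : ℝ} (hx : 0 < x) (X : Matrix ι κ ℝ) {p : ℝ}
    (hp : p = Fintype.card ι) : |p⁻¹ * (rowRes n x X).trace| ≤ x⁻¹ := by
  have hY : (n⁻¹ • (X * Xᵀ)).PosSemidef := by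
    have := posSemidef_self_mul_conjTranspose X
    rw [conjTranspose_eq_transpose_of_trivial] at this
    exact this.smul (inv_nonneg.2 hn)
  have h1 := (abs_trace_le (rowRes n x X)).trans
    (mul_le_mul_of_nonneg_left (norm_resolvent_le hY hx) (Nat.cast_nonneg _))
  have hp0 : 0 ≤ p := by rw [hp]; positivity
  rw [← hp] at h1
  rw [abs_mul, abs_of_nonneg (inv_nonneg.2 hp0)]
  calc p⁻¹ * |(rowRes n x X).trace| ≤ p⁻¹ * (p * x⁻¹) := by gcongr
    _ = p⁻¹ * p * x⁻¹ := by ring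
    _ ≤ 1 * x⁻¹ := by gcongr; exact inv_mul_le_one
    _ = x⁻¹ := one_mul _

/-- Almost sure convergence of a bounded quantity is convergence in mean, the mode in which all
later errors are measured. -/
theorem IsLSD.tendsto_integral_abs_sub (hF : IsLSD P φ ε p F)
    (hε : ∀ i t, Measurable (ε i t)) {x : ℝ} (hx : 0 < x) :
    Tendsto (fun n : ℕ => ∫ ω, |((p n : ℕ) : ℝ)⁻¹ *
      (rowRes n x (dataMatrix φ ε (p n) n ω)).trace - ∫ t, (t + x)⁻¹ ∂F| ∂P) atTop (𝓝 0) := by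
  set s := ∫ t, (t + x)⁻¹ ∂F with hs
  have hs' : ∫ t, resolventTest hx t ∂F = s := by
    refine integral_congr_ae ?_
    have : ∀ᵐ t ∂F, t ∉ Iio (0 : ℝ) := measure_eq_zero_iff_ae_notMem.1 hF.measure_Iio
    filter_upwards [this] with t ht
    change (max t 0 + x)⁻¹ = _
    rw [max_eq_left (not_lt.1 ht)]
  have h := tendsto_integral_of_dominated_convergence (μ := P)
    (F := fun (n : ℕ) ω => |((p n : ℕ) : ℝ)⁻¹ *
      (rowRes n x (dataMatrix φ ε (p n) n ω)).trace - s|) (f := fun _ => 0)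
    (fun _ => x⁻¹ + |s|) (fun n => ?_) (integrable_const _) (fun n => ?_) ?_
  · simpa using h
  · exact ((((entryMeasurable_dataMatrix hε (p n) n).rowRes n x).trace.const_mul _).sub
      measurable_const).abs.aestronglyMeasurable
  · refine Eventually.of_forall fun ω => ?_
    rw [Real.norm_eq_abs, abs_abs]
    refine (abs_sub _ _).trans (add_le_add_left ?_ _)
    exact abs_inv_mul_trace_rowRes_le (Nat.cast_nonneg _) hx _ (by simp)
  · filter_upwards [hF] with ω hω
    have := hω (resolventTest hx)
    simp only [integral_resolventTest_esd, hs'] at this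
    simpa using (this.sub_const s).abs

end EmpiricalSpectrum

/-! ### Mean estimates for the sample covariance matrix -/

section MeanEstimates

open Matrix
open scoped Matrix.Norms.L2Operator

variable {Ω : Type*} [MeasurableSpace Ω] {P : Measure Ω} [IsProbabilityMeasure P]
variable {ε : ℕ → ℤ → Ω → ℝ} {M : ℝ} {φ : ℕ → ℝ}

theorem entryMeasurable_noiseMatrix (hε : ∀ i t, Measurable (ε i t)) (p n : ℕ) :
    EntryMeasurable fun ω => noiseMatrix ε p n ω :=
  fun _ _ => hε _ _

/-- Replacing the linear process by its periodization changes the Stieltjes transform little. -/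
theorem integral_abs_sub_periodized_le (hε : IsNoise P (fun q : ℕ × ℤ => ε q.1 q.2) M)
    (hφ : Summable fun k => |φ k|) {x η : ℝ} (hx : 0 < x) (hη : 0 < η) (p n : ℕ) [NeZero n] :
    ∫ ω, |(p : ℝ)⁻¹ * (rowRes n x (dataMatrix φ ε p n ω)).trace -
        (p : ℝ)⁻¹ * (rowRes n x (noiseMatrix ε p n ω * filterMatrix φ n)).trace| ∂P ≤
      2⁻¹ * (η * (11 * (∑' k, |φ k|) ^ 2)) + η⁻¹ * (x⁻¹ ^ 4 * (4 * meanSqTail φ n)) := by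
  set L := ∑' k, |φ k| with hL
  set X : Ω → Matrix (Fin p) (Fin n) ℝ := fun ω => dataMatrix φ ε p n ω with hX
  set Y : Ω → Matrix (Fin p) (Fin n) ℝ := fun ω => noiseMatrix ε p n ω * filterMatrix φ n with hY
  have hn0 : (0 : ℝ) < n := Nat.cast_pos.2 (NeZero.pos n)
  have hXm : EntryMeasurable X := entryMeasurable_dataMatrix (fun i t => hε.meas (i, t)) p n
  have hYm : EntryMeasurable Y :=
    (entryMeasurable_noiseMatrix (fun i t => hε.meas (i, t)) p n).mul (.const _)
  have hXi : ∀ i t, Integrable (fun ω => X ω i t ^ 2) P ∧ ∫ ω, X ω i t ^ 2 ∂P ≤ L ^ 2 :=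
    fun i t => (linearProcess_L2 hε hφ i _).2
  have hDi : ∀ i t, Integrable (fun ω => (X ω i t - Y ω i t) ^ 2) P ∧
      ∫ ω, (X ω i t - Y ω i t) ^ 2 ∂P ≤ 4 * filterTail φ t ^ 2 :=
    fun i t => linearProcess_sub_L2 hε hφ p n i t
  set Q : Fin p → Fin n → Ω → ℝ := fun i t ω =>
    2⁻¹ * (η * (3 * X ω i t ^ 2 + 2 * (X ω i t - Y ω i t) ^ 2)) +
      η⁻¹ * (x⁻¹ ^ 4 * (X ω i t - Y ω i t) ^ 2) with hQ
  have hQi1 : ∀ i t, Integrable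
      (fun ω => 2⁻¹ * (η * (3 * X ω i t ^ 2 + 2 * (X ω i t - Y ω i t) ^ 2))) P := fun i t =>
    (((((hXi i t).1.const_mul 3).add ((hDi i t).1.const_mul 2)).const_mul η).const_mul _)
  have hQi2 : ∀ i t, Integrable
      (fun ω => η⁻¹ * (x⁻¹ ^ 4 * (X ω i t - Y ω i t) ^ 2)) P := fun i t =>
    ((hDi i t).1.const_mul _).const_mul _
  have hQi : ∀ i t, Integrable (Q i t) P := fun i t => (hQi1 i t).add (hQi2 i t)
  -- From X² + Y² ≤ 3X² + 2(X - Y)², E X² ≤ L² and E (X - Y)² ≤ 4L²: the constant is 3 + 8 = 11.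
  have hQb : ∀ i t, ∫ ω, Q i t ω ∂P ≤
      2⁻¹ * (η * (11 * L ^ 2)) + η⁻¹ * (x⁻¹ ^ 4 * (4 * filterTail φ t ^ 2)) := by
    intro i t
    have e := integral_add (hQi1 i t) (hQi2 i t)
    have e2 := integral_add ((hXi i t).1.const_mul 3) ((hDi i t).1.const_mul 2)
    simp only [hQ]
    rw [e, integral_const_mul, integral_const_mul, integral_const_mul, integral_const_mul, e2,
      integral_const_mul, integral_const_mul]
    have h1 := (hXi i t).2
    have h2 := (hDi i t).2
    have h3 : filterTail φ t ^ 2 ≤ L ^ 2 :=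
      pow_le_pow_left₀ (filterTail_nonneg _ _) (filterTail_le hφ t) 2
    gcongr
    linarith
  have hpt : ∀ ω, |(p : ℝ)⁻¹ * (rowRes n x (X ω)).trace - (p : ℝ)⁻¹ * (rowRes n x (Y ω)).trace| ≤
      (p : ℝ)⁻¹ * ((n : ℝ)⁻¹ * ∑ i, ∑ t, Q i t ω) := by
    intro ω
    rw [← mul_sub, abs_mul, abs_of_nonneg (by positivity : (0 : ℝ) ≤ (p : ℝ)⁻¹)]
    refine mul_le_mul_of_nonneg_left ((abs_trace_rowRes_sub_le hn0 hx hη _ _).trans ?_)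
      (by positivity)
    refine mul_le_mul_of_nonneg_left ?_ (by positivity)
    simp only [Finset.mul_sum, ← Finset.sum_add_distrib]
    refine Finset.sum_le_sum fun i _ => Finset.sum_le_sum fun t _ => ?_
    simp only [hQ]
    have h1 : (Y ω i t - X ω i t) ^ 2 = (X ω i t - Y ω i t) ^ 2 := by ring
    rw [h1]
    gcongr 2⁻¹ * (η * ?_) + _
    nlinarith [sq_nonneg (2 * X ω i t - Y ω i t), sq_nonneg (X ω i t - Y ω i t)]
  have hSi : Integrable (fun ω => (p : ℝ)⁻¹ * ((n : ℝ)⁻¹ * ∑ i, ∑ t, Q i t ω)) P :=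
    ((integrable_finsetSum _ fun i _ => integrable_finsetSum _ fun t _ => hQi i t).const_mul
      _).const_mul _
  refine (integral_mono_of_nonneg (Eventually.of_forall fun ω => abs_nonneg _) hSi
    (Eventually.of_forall hpt)).trans ?_
  rw [integral_const_mul, integral_const_mul,
    integral_finsetSum _ fun i _ => integrable_finsetSum _ fun t _ => hQi i t]
  set R := 2⁻¹ * (η * (11 * L ^ 2)) + η⁻¹ * (x⁻¹ ^ 4 * (4 * meanSqTail φ n)) with hR
  have hR0 : 0 ≤ R := by
    have : 0 ≤ meanSqTail φ n :=
      mul_nonneg (by positivity) (Finset.sum_nonneg fun t _ => sq_nonneg _)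
    positivity
  have hrow : ∀ i : Fin p, ∫ ω, ∑ t, Q i t ω ∂P ≤ n * R := by
    intro i
    rw [integral_finsetSum _ fun t _ => hQi i t]
    refine (Finset.sum_le_sum fun t _ => hQb i t).trans_eq ?_
    simp only [Finset.sum_add_distrib, ← Finset.mul_sum]
    rw [Fin.sum_univ_eq_sum_range (fun t => filterTail φ t ^ 2)]
    simp only [hR, meanSqTail, Finset.sum_const, Finset.card_univ, Fintype.card_fin, nsmul_eq_mul]
    field_simp
  calc (p : ℝ)⁻¹ * ((n : ℝ)⁻¹ * ∑ i : Fin p, ∫ ω, ∑ t, Q i t ω ∂P)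
      ≤ (p : ℝ)⁻¹ * ((n : ℝ)⁻¹ * ∑ _i : Fin p, n * R) := by
        gcongr with i
        exact hrow i
    _ = ((p : ℝ)⁻¹ * p) * R := by
        simp only [Finset.sum_const, Finset.card_univ, Fintype.card_fin, nsmul_eq_mul]
        field_simp
    _ ≤ 1 * R := by gcongr; exact inv_mul_le_one
    _ = R := one_mul R

/-- The approximate fixed point equation for the Stieltjes transform. -/
theorem abs_trace_testMatrix_sub_le_integral (hε : IsNoise P (fun q : ℕ × ℤ => ε q.1 q.2) M)
    (hφ : Summable fun k => |φ k|) {x c s L D K : ℝ} (hx : 0 < x) (hc : 0 < c) (hs : 0 < s)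
    (hL : L = ∑' k, |φ k|) (hD : D = L ^ 2 * x⁻¹ * (L ^ 2 + 1)) (hK : K = 1 + 2 * M * D ^ 2 + D)
    (p n : ℕ) [NeZero p] [NeZero n] (hpn : (p : ℝ) / n ≤ c + 1) :
    |(n : ℝ)⁻¹ * (testMatrix (c * s) ((filterMatrix φ n)ᵀ * filterMatrix φ n)).trace -
        (s⁻¹ - x)| ≤
      (c + 1) * (K * (√n)⁻¹) + (L ^ 2) ^ 2 * ((c + 1) *
        (∫ ω, |(p : ℝ)⁻¹ * (rowRes n x (noiseMatrix ε p n ω * filterMatrix φ n)).trace - s| ∂P) +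
          s * |(p : ℝ) / n - c|) +
      (1 + L ^ 2 * x⁻¹) / s * (x *
        (∫ ω, |(p : ℝ)⁻¹ * (rowRes n x (noiseMatrix ε p n ω * filterMatrix φ n)).trace - s| ∂P) +
          K * (√n)⁻¹) := by
  set C := filterMatrix φ n with hC
  set Γ := Cᵀ * C with hΓ
  have hn0 : (0 : ℝ) < n := Nat.cast_pos.2 (NeZero.pos n)
  have hp0 : (0 : ℝ) < p := Nat.cast_pos.2 (NeZero.pos p)
  have hL0 : 0 ≤ L := by
    rw [hL]
    exact tsum_nonneg fun k => abs_nonneg _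
  have hCn : ‖C‖ ≤ L := by
    rw [hL]
    exact norm_filterMatrix_le hφ n
  have hΓn : ‖Γ‖ ≤ L ^ 2 := by
    rw [hΓ, ← conjTranspose_eq_transpose_of_trivial, l2_opNorm_conjTranspose_mul_self, pow_two]
    exact mul_le_mul hCn hCn (norm_nonneg _) hL0
  have hΓp : Γ.PosSemidef := by
    rw [hΓ, ← conjTranspose_eq_transpose_of_trivial]
    exact posSemidef_conjTranspose_mul_self C
  set B := testMatrix (c * s) Γ with hB
  have hBn : ‖B‖ ≤ L ^ 2 := (norm_testMatrix_le (by positivity) hΓp).trans hΓn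
  have hZ : IsNoise P (fun q : Fin p × Fin n => ε q.1 (((q.2 : ℕ) : ℤ) + 1)) M := by
    have hinj : Function.Injective fun q : Fin p × Fin n =>
        (((q.1 : ℕ), ((q.2 : ℕ) : ℤ) + 1) : ℕ × ℤ) := by
      rintro ⟨i, j⟩ ⟨i', j'⟩ h
      simp only [Prod.mk.injEq, add_left_inj, Nat.cast_inj, Fin.val_inj] at h
      exact Prod.ext h.1 h.2
    exact ⟨fun q => hε.meas (_, _), hε.indep.precomp hinj, fun q => hε.mean (_, _),
      fun q => hε.var (_, _), fun q => hε.memLp (_, _), fun q => hε.fourth (_, _)⟩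
  set X : Ω → Matrix (Fin p) (Fin n) ℝ := fun ω => noiseMatrix ε p n ω * C with hX
  have hXm : EntryMeasurable X :=
    (entryMeasurable_noiseMatrix (fun i t => hε.meas (i, t)) p n).mul (.const _)
  have hone : ‖(1 : Matrix (Fin n) (Fin n) ℝ)‖ ≤ 1 := by simp
  -- The bound L² + 1 covers both matrices needed, the identity and the test matrix.
  have hDB : ∀ A : Matrix (Fin n) (Fin n) ℝ, ‖A‖ ≤ L ^ 2 + 1 → ‖C‖ ^ 2 * x⁻¹ * ‖A‖ ≤ D := by
    intro A hA
    rw [hD]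
    gcongr
  have hq : ∀ (A : Matrix (Fin n) (Fin n) ℝ), ‖A‖ ≤ L ^ 2 + 1 → ∀ i,
      Integrable (fun ω => |looForm n x (X ω) A i -
        (n : ℝ)⁻¹ * (colRes n x (X ω) * (A * Γ)).trace|) P ∧
      ∫ ω, |looForm n x (X ω) A i - (n : ℝ)⁻¹ * (colRes n x (X ω) * (A * Γ)).trace| ∂P ≤
        K * (√n)⁻¹ := by
    intro A hA i
    rw [hK]
    exact integral_abs_looForm_sub_le hZ hx (by simp) C A i (hDB A hA)
  have hqB := hq B (hBn.trans (by linarith))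
  have hq1 := hq 1 (hone.trans (by nlinarith [sq_nonneg L]))
  have hmi : Integrable (fun ω => |(p : ℝ)⁻¹ * (rowRes n x (X ω)).trace - s|) P := by
    refine Integrable.of_bound
      (((hXm.rowRes n x).trace.const_mul _).sub measurable_const).abs.aestronglyMeasurable
      (x⁻¹ + |s|) (Eventually.of_forall fun ω => ?_)
    rw [Real.norm_eq_abs, abs_abs]
    exact (abs_sub _ _).trans (add_le_add_left
      (abs_inv_mul_trace_rowRes_le hn0.le hx _ (by simp)) _)
  have hSB : Integrable (fun ω => ∑ i, |looForm n x (X ω) B i -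
      (n : ℝ)⁻¹ * (colRes n x (X ω) * (B * Γ)).trace|) P :=
    integrable_finsetSum _ fun i _ => (hqB i).1
  have hS1 : Integrable (fun ω => ∑ i, |looForm n x (X ω) 1 i -
      (n : ℝ)⁻¹ * (colRes n x (X ω) * (1 * Γ)).trace|) P :=
    integrable_finsetSum _ fun i _ => (hq1 i).1
  have hpt := fun ω => abs_trace_testMatrix_sub_le hx hs hc hΓ hΓn (X ω) (n := n) (p := p)
    (m := (p : ℝ)⁻¹ * (rowRes n x (X ω)).trace) (by simp) (by simp) hpn rfl
  have i1 := hSB.const_mul (n : ℝ)⁻¹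
  have i2 := ((hmi.const_mul (c + 1)).add (integrable_const (s * |(p : ℝ) / n - c|))).const_mul
    ((L ^ 2) ^ 2)
  have i3 := ((hmi.const_mul x).add (hS1.const_mul (p : ℝ)⁻¹)).const_mul
    ((1 + L ^ 2 * x⁻¹) / s)
  have hI := integral_mono (integrable_const _) ((i1.add i2).add i3) hpt
  have e1 := integral_add (i1.add i2) i3
  have e2 := integral_add i1 i2
  have e3 := integral_add (hmi.const_mul (c + 1)) (integrable_const (s * |(p : ℝ) / n - c|))
  have e4 := integral_add (hmi.const_mul x) (hS1.const_mul (p : ℝ)⁻¹)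
  simp only [Pi.add_apply] at hI e1 e2 e3 e4
  rw [e1, e2, integral_const_mul ((L ^ 2) ^ 2), integral_const_mul ((1 + L ^ 2 * x⁻¹) / s), e3, e4,
    integral_const_mul, integral_const_mul, integral_const_mul, integral_const_mul,
    integral_const_mul, integral_const, integral_const, probReal_univ, one_smul, one_smul,
    integral_finsetSum _ fun i _ => (hqB i).1, integral_finsetSum _ fun i _ => (hq1 i).1] at hI
  refine hI.trans ?_
  have b1 : ∑ i : Fin p, ∫ ω, |looForm n x (X ω) B i -
      (n : ℝ)⁻¹ * (colRes n x (X ω) * (B * Γ)).trace| ∂P ≤ p * (K * (√n)⁻¹) := by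
    refine (Finset.sum_le_sum fun i _ => (hqB i).2).trans_eq ?_
    simp
  have b2 : ∑ i : Fin p, ∫ ω, |looForm n x (X ω) 1 i -
      (n : ℝ)⁻¹ * (colRes n x (X ω) * (1 * Γ)).trace| ∂P ≤ p * (K * (√n)⁻¹) := by
    refine (Finset.sum_le_sum fun i _ => (hq1 i).2).trans_eq ?_
    simp
  have hK0 : 0 ≤ K * (√n)⁻¹ :=
    (integral_nonneg fun ω => abs_nonneg _).trans (hq1 ⟨0, NeZero.pos p⟩).2
  have b3 : (n : ℝ)⁻¹ * ∑ i : Fin p, ∫ ω, |looForm n x (X ω) B i -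
      (n : ℝ)⁻¹ * (colRes n x (X ω) * (B * Γ)).trace| ∂P ≤ (c + 1) * (K * (√n)⁻¹) := by
    calc _ ≤ (n : ℝ)⁻¹ * (p * (K * (√n)⁻¹)) := by gcongr
      _ = (p / n) * (K * (√n)⁻¹) := by ring
      _ ≤ _ := by gcongr
  have b4 : (p : ℝ)⁻¹ * ∑ i : Fin p, ∫ ω, |looForm n x (X ω) 1 i -
      (n : ℝ)⁻¹ * (colRes n x (X ω) * (1 * Γ)).trace| ∂P ≤ K * (√n)⁻¹ := by
    calc _ ≤ (p : ℝ)⁻¹ * (p * (K * (√n)⁻¹)) := by gcongr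
      _ = _ := by field_simp
  gcongr

end MeanEstimates

/-! ### Spectra of circulant matrices -/

section Circulant

open Matrix
open scoped Matrix.Norms.L2Operator

/-- The transfer function of the filter truncated at lag `n`. -/
noncomputable def truncatedTransfer (φ : ℕ → ℝ) (n : ℕ) (θ : ℝ) : ℂ :=
  ∑ k ∈ Finset.range n, (φ k : ℂ) * Complex.exp (Complex.I * (k : ℂ) * (θ : ℂ))

theorem sum_circulant_mul_pow {n : ℕ} [NeZero n] {ζ : ℂ} (hζ : ζ ^ n = 1) (φ : ℕ → ℝ)
    (j : Fin n) :
    ∑ t : Fin n, (φ ((t - j : Fin n) : ℕ) : ℂ) * ζ ^ (t : ℕ) =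
      ζ ^ (j : ℕ) * ∑ k ∈ Finset.range n, (φ k : ℂ) * ζ ^ k := by
  rw [← Fin.sum_univ_eq_sum_range (fun k => (φ k : ℂ) * ζ ^ k), ← Equiv.sum_comp (Equiv.addRight j),
    Finset.mul_sum]
  refine Finset.sum_congr rfl fun t _ => ?_
  simp only [Equiv.coe_addRight, add_sub_cancel_right]
  rw [Fin.val_add, ← pow_eq_pow_mod _ hζ, pow_add]
  ring

theorem sum_circulant_transpose_mul_pow {n : ℕ} [NeZero n] {ζ : ℂ} (hζ : ζ ^ n = 1) (φ : ℕ → ℝ)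
    (t : Fin n) :
    ∑ j : Fin n, (φ ((t - j : Fin n) : ℕ) : ℂ) * ζ ^ (j : ℕ) =
      ζ ^ (t : ℕ) * ∑ k ∈ Finset.range n, (φ k : ℂ) * (ζ⁻¹) ^ k := by
  have hζ0 : ζ ≠ 0 := by
    rintro rfl
    simp [zero_pow (NeZero.ne n)] at hζ
  rw [← Fin.sum_univ_eq_sum_range (fun k => (φ k : ℂ) * (ζ⁻¹) ^ k), ← (Equiv.subLeft t).sum_comp,
    Finset.mul_sum]
  refine Finset.sum_congr rfl fun k _ => ?_
  have h : ζ ^ (t : ℕ) = ζ ^ (k : ℕ) * ζ ^ ((t - k : Fin n) : ℕ) := by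
    rw [← pow_add]
    conv_lhs => rw [← sub_add_cancel t k]
    rw [Fin.val_add, ← pow_eq_pow_mod _ hζ, add_comm]
  simp only [Equiv.subLeft_apply, sub_sub_cancel]
  rw [h, inv_pow]
  field_simp

/-- The trace of the test matrix as a Riemann sum. -/
theorem trace_testMatrix_filterMatrix (φ : ℕ → ℝ) (n : ℕ) [NeZero n] {u : ℝ} (hu : 0 ≤ u) :
    (testMatrix u ((filterMatrix φ n)ᵀ * filterMatrix φ n)).trace =
      ∑ l ∈ Finset.range n, ‖truncatedTransfer φ n (2 * Real.pi * l / n)‖ ^ 2 /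
        (1 + u * ‖truncatedTransfer φ n (2 * Real.pi * l / n)‖ ^ 2) := by
  set C := filterMatrix φ n with hC
  set Γ := Cᵀ * C with hΓ
  have hΓp : Γ.PosSemidef := by
    rw [hΓ, ← conjTranspose_eq_transpose_of_trivial]
    exact posSemidef_conjTranspose_mul_self C
  have hdet := isUnit_det_one_add hu hΓp
  set ρ := Complex.exp (2 * Real.pi * Complex.I / n) with hρ
  have hprim : IsPrimitiveRoot ρ n := Complex.isPrimitiveRoot_exp n (NeZero.ne n)
  -- The Vandermonde matrix of the n-th roots of unity is the Fourier matrix; it diagonalizes every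
  -- circulant, with the truncated transfer function as eigenvalues.
  set U : Matrix (Fin n) (Fin n) ℂ := vandermonde fun t => ρ ^ (t : ℕ) with hU
  have hUdet : IsUnit U.det := by
    rw [isUnit_iff_ne_zero, hU, det_vandermonde_ne_zero_iff]
    intro s t h
    exact Fin.ext (hprim.pow_inj s.2 t.2 h)
  have hUapp : ∀ t l : Fin n, U t l = (ρ ^ (l : ℕ)) ^ (t : ℕ) := fun t l => by
    rw [hU, vandermonde_apply, pow_right_comm]
  have hroot : ∀ l : ℕ, (ρ ^ l) ^ n = 1 := fun l => by
    rw [pow_right_comm, hprim.pow_eq_one, one_pow]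
  set w : Fin n → ℂ := fun l => truncatedTransfer φ n (2 * Real.pi * (l : ℕ) / n) with hw
  have hpow : ∀ l k : ℕ, (ρ ^ l) ^ k =
      Complex.exp (Complex.I * k * ((2 * Real.pi * l / n : ℝ) : ℂ)) := fun l k => by
    rw [hρ, ← pow_mul, ← Complex.exp_nat_mul]
    congr 1
    push_cast
    ring
  have hwl : ∀ l : Fin n, ∑ k ∈ Finset.range n, (φ k : ℂ) * (ρ ^ (l : ℕ)) ^ k = w l := fun l => by
    simp only [hw, truncatedTransfer, hpow]
  have hwl' : ∀ l : Fin n, ∑ k ∈ Finset.range n, (φ k : ℂ) * ((ρ ^ (l : ℕ))⁻¹) ^ k =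
      (starRingEnd ℂ) (w l) := fun l => by
    rw [← hwl, map_sum]
    refine Finset.sum_congr rfl fun k _ => ?_
    rw [map_mul, Complex.conj_ofReal, inv_pow, hpow, ← Complex.exp_neg, ← Complex.exp_conj]
    congr 2
    rw [map_mul, map_mul, Complex.conj_I, Complex.conj_ofReal, map_natCast]
    ring
  set f := Complex.ofRealHom
  have hCU : C.map f * U = U * diagonal w := by
    ext j l
    rw [mul_apply, mul_diagonal, hUapp, ← hwl, ← sum_circulant_mul_pow (hroot l)]
    exact Finset.sum_congr rfl fun t _ => by rw [hUapp]; rfl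
  have hCtU : (C.map f)ᵀ * U = U * diagonal fun l => (starRingEnd ℂ) (w l) := by
    ext t l
    rw [mul_apply, mul_diagonal, hUapp, ← hwl', ← sum_circulant_transpose_mul_pow (hroot l)]
    exact Finset.sum_congr rfl fun t _ => by rw [hUapp]; rfl
  have hΓU : Γ.map f * U = U * diagonal fun l => ((‖w l‖ ^ 2 : ℝ) : ℂ) := by
    rw [hΓ, Matrix.map_mul, transpose_map, Matrix.mul_assoc, hCU, ← Matrix.mul_assoc, hCtU,
      Matrix.mul_assoc, diagonal_mul_diagonal]
    congr 3
    funext l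
    rw [mul_comm, Complex.mul_conj, Complex.normSq_eq_norm_sq]
  have hA : (1 + u • Γ).map f = 1 + (u : ℂ) • Γ.map f := by
    ext i j
    simp [f, Matrix.one_apply]
    split_ifs <;> simp
  have hT : (1 + u • Γ).map f * (testMatrix u Γ).map f = Γ.map f := by
    rw [← Matrix.map_mul, testMatrix, ← Matrix.mul_assoc, mul_nonsing_inv _ hdet, Matrix.one_mul]
  have hAdet : IsUnit ((1 + u • Γ).map f).det := by
    have := hdet.map f
    rwa [RingHom.map_det] at this
  have hAU : (1 + u • Γ).map f * U =
      U * diagonal fun l => ((1 + u * ‖w l‖ ^ 2 : ℝ) : ℂ) := by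
    rw [hA, Matrix.add_mul, smul_mul_assoc, hΓU, Matrix.one_mul]
    ext i j
    simp only [Matrix.add_apply, Matrix.smul_apply, mul_diagonal, smul_eq_mul]
    push_cast
    ring
  have key := trace_eq_sum_div hUdet hAdet hAU hΓU (fun l => by
    rw [Complex.ofReal_ne_zero]
    positivity) hT
  have htr : ((testMatrix u Γ).map f).trace = ((testMatrix u Γ).trace : ℂ) := by
    simp [trace, f]
  rw [htr] at key
  have := Fin.sum_univ_eq_sum_range (fun l => ‖truncatedTransfer φ n (2 * Real.pi * l / n)‖ ^ 2 /
        (1 + u * ‖truncatedTransfer φ n (2 * Real.pi * l / n)‖ ^ 2)) n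
  rw [← this]
  apply Complex.ofReal_injective
  rw [key]
  push_cast
  rfl

end Circulant

/-! ### Riemann sums -/

section RiemannSum

theorem tendsto_riemannSum {h : ℝ → ℝ} (hh : Continuous h) {T : ℝ} (hT : 0 < T) :
    Tendsto (fun n : ℕ => (n : ℝ)⁻¹ * ∑ l ∈ Finset.range n, h (T * l / n)) atTop
      (𝓝 (T⁻¹ * ∫ θ in (0 : ℝ)..T, h θ)) := by
  have hu := isCompact_Icc (a := (0 : ℝ)) (b := T) |>.uniformContinuousOn_of_continuous
    hh.continuousOn
  rw [Metric.uniformContinuousOn_iff_le] at hu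
  rw [Metric.tendsto_nhds]
  intro e he
  obtain ⟨δ, hδ, hδ'⟩ := hu (e / 2) (by positivity)
  have h1 : Tendsto (fun n : ℕ => T / n) atTop (𝓝 0) := tendsto_const_div_atTop_nhds_zero_nat T
  filter_upwards [h1.eventually (gt_mem_nhds hδ), eventually_gt_atTop 0] with n hn hn0
  have hn' : (0 : ℝ) < n := Nat.cast_pos.2 hn0
  set a : ℕ → ℝ := fun l => T * l / n with ha
  have hstep : ∀ l, a (l + 1) - a l = T / n := fun l => by
    simp only [ha]
    push_cast
    ring
  have hi : ∫ θ in (0 : ℝ)..T, h θ = ∑ l ∈ Finset.range n, ∫ θ in a l..a (l + 1), h θ := by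
    rw [intervalIntegral.sum_integral_adjacent_intervals fun k _ => hh.intervalIntegrable _ _]
    simp only [ha]
    rw [mul_div_cancel_right₀ T hn'.ne', Nat.cast_zero, mul_zero, zero_div]
  have hb : ∀ l ∈ Finset.range n,
      |T / n * h (a l) - ∫ θ in a l..a (l + 1), h θ| ≤ e / 2 * (T / n) := by
    intro l hl
    have hl' : (l : ℝ) + 1 ≤ n := by exact_mod_cast Finset.mem_range.1 hl
    have e1 : T / n * h (a l) - ∫ θ in a l..a (l + 1), h θ =
        ∫ θ in a l..a (l + 1), (h (a l) - h θ) := by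
      rw [intervalIntegral.integral_sub (by simp) (hh.intervalIntegrable _ _),
        intervalIntegral.integral_const, hstep, smul_eq_mul]
    have hle : a l ≤ a (l + 1) := by
      have := hstep l
      have : 0 < T / n := by positivity
      linarith
    have ha0 : 0 ≤ a l := by positivity
    have ha1 : a (l + 1) ≤ T := by
      simp only [ha]
      rw [div_le_iff₀ hn']
      push_cast
      exact mul_le_mul_of_nonneg_left hl' hT.le
    rw [e1, ← Real.norm_eq_abs]
    refine (intervalIntegral.norm_integral_le_of_norm_le_const (C := e / 2) fun θ hθ => ?_).trans_eq
      ?_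
    · rw [uIoc_of_le hle] at hθ
      have := hδ' (a l) ⟨ha0, hle.trans ha1⟩ θ ⟨ha0.trans hθ.1.le, hθ.2.trans ha1⟩ (by
        rw [Real.dist_eq, abs_sub_comm, abs_of_nonneg (by linarith [hθ.1])]
        have := hstep l
        linarith [hθ.2])
      rwa [Real.dist_eq] at this
    · rw [hstep, abs_of_pos (by positivity)]
  have e2 : (n : ℝ)⁻¹ * ∑ l ∈ Finset.range n, h (a l) - T⁻¹ * ∫ θ in (0 : ℝ)..T, h θ =
      T⁻¹ * ∑ l ∈ Finset.range n, (T / n * h (a l) - ∫ θ in a l..a (l + 1), h θ) := by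
    rw [Finset.sum_sub_distrib, ← Finset.mul_sum, ← hi]
    field_simp
  rw [Real.dist_eq, e2, abs_mul, abs_of_pos (inv_pos.2 hT)]
  calc T⁻¹ * |∑ l ∈ Finset.range n, (T / n * h (a l) - ∫ θ in a l..a (l + 1), h θ)|
      ≤ T⁻¹ * ∑ _l ∈ Finset.range n, e / 2 * (T / n) := by
        gcongr
        exact (Finset.abs_sum_le_sum_abs _ _).trans (Finset.sum_le_sum hb)
    _ = e / 2 := by
        rw [Finset.sum_const, Finset.card_range, nsmul_eq_mul]
        field_simp
    _ < e := by linarith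

end RiemannSum

/-! ### The limiting fixed point equation -/

section FixedPoint

open Matrix

theorem abs_div_one_add_sub_le {u a b : ℝ} (hu : 0 ≤ u) (ha : 0 ≤ a) (hb : 0 ≤ b) :
    |a / (1 + u * a) - b / (1 + u * b)| ≤ |a - b| := by
  have h1 : 1 ≤ 1 + u * a := by nlinarith [mul_nonneg hu ha]
  have h2 : 1 ≤ 1 + u * b := by nlinarith [mul_nonneg hu hb]
  have h3 : a / (1 + u * a) - b / (1 + u * b) = (a - b) * ((1 + u * a) * (1 + u * b))⁻¹ := by
    field_simp
    ring
  rw [h3, abs_mul, abs_of_pos (by positivity : 0 < ((1 + u * a) * (1 + u * b))⁻¹)]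
  exact mul_le_of_le_one_right (abs_nonneg _)
    (inv_le_one_of_one_le₀ (one_le_mul_of_one_le_of_one_le h1 h2))

variable {φ : ℕ → ℝ}

/-- The transfer function of the filter. -/
noncomputable def transfer (φ : ℕ → ℝ) (θ : ℝ) : ℂ :=
  ∑' k : ℕ, (φ k : ℂ) * Complex.exp (Complex.I * (k : ℂ) * (θ : ℂ))

theorem two_pi_mul_spectralDensity (θ : ℝ) :
    2 * Real.pi * spectralDensity φ θ = ‖transfer φ θ‖ ^ 2 := by
  rw [spectralDensity, transfer, ← mul_assoc, mul_one_div_cancel Real.two_pi_pos.ne', one_mul]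

theorem norm_transfer_term (k : ℕ) (θ : ℝ) :
    ‖(φ k : ℂ) * Complex.exp (Complex.I * (k : ℂ) * (θ : ℂ))‖ = |φ k| := by
  have : Complex.I * (k : ℂ) * (θ : ℂ) = ((k * θ : ℝ) : ℂ) * Complex.I := by
    push_cast
    ring
  rw [norm_mul, this, Complex.norm_exp_ofReal_mul_I, mul_one, Complex.norm_real, Real.norm_eq_abs]

theorem norm_truncatedTransfer_le (hφ : Summable fun k => |φ k|) (n : ℕ) (θ : ℝ) :
    ‖truncatedTransfer φ n θ‖ ≤ ∑' k, |φ k| := by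
  refine (norm_sum_le _ _).trans ?_
  simp only [norm_transfer_term]
  exact hφ.sum_le_tsum _ fun k _ => abs_nonneg _

theorem norm_transfer_le (hφ : Summable fun k => |φ k|) (θ : ℝ) :
    ‖transfer φ θ‖ ≤ ∑' k, |φ k| := by
  refine (norm_tsum_le_tsum_norm ?_).trans_eq ?_
  · simpa only [norm_transfer_term] using hφ
  · simp only [norm_transfer_term]

theorem norm_truncatedTransfer_sub_le (hφ : Summable fun k => |φ k|) (n : ℕ) (θ : ℝ) :
    ‖truncatedTransfer φ n θ - transfer φ θ‖ ≤ ∑' k, |φ (k + n)| := by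
  have hs : Summable fun k : ℕ => (φ k : ℂ) * Complex.exp (Complex.I * (k : ℂ) * (θ : ℂ)) := by
    refine Summable.of_norm ?_
    simpa only [norm_transfer_term] using hφ
  have h1 := hs.sum_add_tsum_nat_add n
  rw [norm_sub_rev, transfer, truncatedTransfer, ← h1, add_sub_cancel_left]
  refine (norm_tsum_le_tsum_norm ?_).trans_eq ?_
  · simpa only [norm_transfer_term] using (summable_nat_add_iff n).2 hφ
  · simp only [norm_transfer_term]

theorem abs_sq_norm_truncatedTransfer_sub_le (hφ : Summable fun k => |φ k|) (n : ℕ) (θ : ℝ) :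
    |‖truncatedTransfer φ n θ‖ ^ 2 - ‖transfer φ θ‖ ^ 2| ≤
      2 * (∑' k, |φ k|) * ∑' k, |φ (k + n)| := by
  have h1 := norm_truncatedTransfer_le hφ n θ
  have h2 := norm_transfer_le hφ θ
  have h3 := (abs_norm_sub_norm_le _ _).trans (norm_truncatedTransfer_sub_le hφ n θ)
  rw [sq_sub_sq, abs_mul, abs_of_nonneg (by positivity)]
  exact mul_le_mul (by linarith) h3 (abs_nonneg _) ((by positivity : (0 : ℝ) ≤
    ‖truncatedTransfer φ n θ‖ + ‖transfer φ θ‖).trans (by linarith))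

/-- The truncated transfer functions converge uniformly, so the summand, which itself varies with n,
may be replaced by its limit before taking the Riemann sum. -/
theorem tendsto_mean_truncatedTransfer (hφ : Summable fun k => |φ k|)
    (hf : Continuous (spectralDensity φ)) {u : ℝ} (hu : 0 ≤ u) :
    Tendsto (fun n : ℕ => (n : ℝ)⁻¹ * ∑ l ∈ Finset.range n,
      ‖truncatedTransfer φ n (2 * Real.pi * l / n)‖ ^ 2 /
        (1 + u * ‖truncatedTransfer φ n (2 * Real.pi * l / n)‖ ^ 2)) atTop
      (𝓝 ((2 * Real.pi)⁻¹ * ∫ θ in (0 : ℝ)..(2 * Real.pi),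
        ‖transfer φ θ‖ ^ 2 / (1 + u * ‖transfer φ θ‖ ^ 2))) := by
  have hv : Continuous fun θ => ‖transfer φ θ‖ ^ 2 := by
    simp only [← two_pi_mul_spectralDensity]
    fun_prop
  have h1 := tendsto_riemannSum (h := fun θ => ‖transfer φ θ‖ ^ 2 / (1 + u * ‖transfer φ θ‖ ^ 2))
    (hv.div (by fun_prop) fun θ => by positivity) Real.two_pi_pos
  have h2 : Tendsto (fun n : ℕ => 2 * (∑' k, |φ k|) * ∑' k, |φ (k + n)|) atTop (𝓝 0) := by
    simpa using (tendsto_sum_nat_add fun k => |φ k|).const_mul (2 * (∑' k, |φ k|))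
  refine h1.congr_dist (squeeze_zero' (Eventually.of_forall fun n => dist_nonneg)
    (Eventually.of_forall fun n => ?_) h2)
  have hC : 0 ≤ 2 * (∑' k, |φ k|) * ∑' k, |φ (k + n)| :=
    mul_nonneg (mul_nonneg zero_le_two (tsum_nonneg fun k => abs_nonneg _))
      (tsum_nonneg fun k => abs_nonneg _)
  rw [dist_comm, Real.dist_eq, ← mul_sub, ← Finset.sum_sub_distrib, abs_mul,
    abs_of_nonneg (by positivity : (0 : ℝ) ≤ (n : ℝ)⁻¹)]
  calc _ ≤ (n : ℝ)⁻¹ * ∑ _l ∈ Finset.range n, 2 * (∑' k, |φ k|) * ∑' k, |φ (k + n)| := by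
        refine mul_le_mul_of_nonneg_left ((Finset.abs_sum_le_sum_abs _ _).trans
          (Finset.sum_le_sum fun l _ => ?_)) (by positivity)
        exact (abs_div_one_add_sub_le hu (by positivity) (by positivity)).trans
          (abs_sq_norm_truncatedTransfer_sub_le hφ n _)
    _ = ((n : ℝ)⁻¹ * n) * (2 * (∑' k, |φ k|) * ∑' k, |φ (k + n)|) := by
        rw [Finset.sum_const, Finset.card_range, nsmul_eq_mul]
        ring
    _ ≤ 1 * (2 * (∑' k, |φ k|) * ∑' k, |φ (k + n)|) := by
        gcongr
        exact inv_mul_le_one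
    _ = _ := one_mul _

variable {Ω : Type*} [MeasurableSpace Ω] {P : Measure Ω} [IsProbabilityMeasure P]
variable {ε : ℕ → ℤ → Ω → ℝ} {M : ℝ}

theorem integral_abs_periodized_sub_le (hε : IsNoise P (fun q : ℕ × ℤ => ε q.1 q.2) M)
    (hφ : Summable fun k => |φ k|) {x η : ℝ} (hx : 0 < x) (hη : 0 < η) (s : ℝ) (p n : ℕ)
    [NeZero n] :
    ∫ ω, |(p : ℝ)⁻¹ * (rowRes n x (noiseMatrix ε p n ω * filterMatrix φ n)).trace - s| ∂P ≤
      ∫ ω, |(p : ℝ)⁻¹ * (rowRes n x (dataMatrix φ ε p n ω)).trace - s| ∂P +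
      (2⁻¹ * (η * (11 * (∑' k, |φ k|) ^ 2)) + η⁻¹ * (x⁻¹ ^ 4 * (4 * meanSqTail φ n))) := by
  have hmeas : ∀ i t, Measurable (ε i t) := fun i t => hε.meas (i, t)
  have hX := ((entryMeasurable_dataMatrix (φ := φ) hmeas p n).rowRes n x).trace.const_mul (p : ℝ)⁻¹
  have hY := (((entryMeasurable_noiseMatrix hmeas p n).mul
    (.const (filterMatrix φ n))).rowRes n x).trace.const_mul (p : ℝ)⁻¹
  have hi : ∀ {g : Ω → ℝ}, Measurable g → (∀ ω, |g ω| ≤ x⁻¹) → Integrable g P := fun hg hb =>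
    Integrable.of_bound hg.aestronglyMeasurable x⁻¹ (Eventually.of_forall hb)
  have iX := hi hX fun ω => abs_inv_mul_trace_rowRes_le (Nat.cast_nonneg n) hx _ (by simp)
  have iY := hi hY fun ω => abs_inv_mul_trace_rowRes_le (Nat.cast_nonneg n) hx _ (by simp)
  refine le_trans ?_ (add_le_add le_rfl (integral_abs_sub_periodized_le hε hφ hx hη p n))
  have e := integral_add (iX.sub (integrable_const s)).abs (iX.sub iY).abs
  simp only [Pi.sub_apply] at e
  rw [← e]
  refine integral_mono (iY.sub (integrable_const s)).abs
    ((iX.sub (integrable_const s)).abs.add (iX.sub iY).abs) fun ω => ?_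
  simp only
  rw [add_comm, abs_sub_comm ((p : ℝ)⁻¹ * (rowRes n x (dataMatrix φ ε p n ω)).trace)
    ((p : ℝ)⁻¹ * (rowRes n x (noiseMatrix ε p n ω * filterMatrix φ n)).trace)]
  exact abs_sub_le _ _ _

/-- The Stieltjes transform of the limiting spectral distribution inverts `g` on the negative
half line. -/
theorem IsLSD.gMap_integral_inv_add {p : ℕ → ℕ} {F : Measure ℝ} [IsProbabilityMeasure F]
    (hF : IsLSD P φ ε p F) (hε : IsNoise P (fun q : ℕ × ℤ => ε q.1 q.2) M)
    (hφ : Summable fun k => |φ k|) (hf : Continuous (spectralDensity φ))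
    (hpos : ∀ θ ∈ Icc 0 (2 * Real.pi), 0 < 2 * Real.pi * spectralDensity φ θ)
    {c : ℝ} (hc : 0 < c) (hp : Tendsto (fun n : ℕ => (p n : ℝ) / (n : ℝ)) atTop (𝓝 c))
    {x : ℝ} (hx : 0 < x) :
    gMap (spectralDensity φ) c (∫ t, (t + x)⁻¹ ∂F) = -x := by
  set s := ∫ t, (t + x)⁻¹ ∂F with hs
  have hs0 : 0 < s := integral_inv_add_pos F hF.measure_Iio hx
  obtain ⟨L, hL⟩ : ∃ L, L = ∑' k, |φ k| := ⟨_, rfl⟩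
  obtain ⟨D, hD⟩ : ∃ D, D = L ^ 2 * x⁻¹ * (L ^ 2 + 1) := ⟨_, rfl⟩
  obtain ⟨K, hK⟩ : ∃ K, K = 1 + 2 * M * D ^ 2 + D := ⟨_, rfl⟩
  set A := (2 * Real.pi)⁻¹ * ∫ θ in (0 : ℝ)..(2 * Real.pi),
        ‖transfer φ θ‖ ^ 2 / (1 + c * s * ‖transfer φ θ‖ ^ 2) with hA
  have hlim := ((tendsto_mean_truncatedTransfer hφ hf (by positivity : 0 ≤ c * s)).sub_const
    (s⁻¹ - x)).abs
  rw [← hA] at hlim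
  have hmean := hF.tendsto_integral_abs_sub (fun i t => hε.meas (i, t)) hx
  rw [← hs] at hmean
  have hsqrt : Tendsto (fun n : ℕ => K * (√(n : ℝ))⁻¹) atTop (𝓝 0) := by
    have := (tendsto_inv_atTop_zero.comp
      (Real.tendsto_sqrt_atTop.comp tendsto_natCast_atTop_atTop)).const_mul K
    simpa using this
  have hpc : Tendsto (fun n : ℕ => |(p n : ℝ) / n - c|) atTop (𝓝 0) := by
    simpa using (hp.sub_const c).abs
  -- Let n → ∞ with η fixed: every error term vanishes except the part of the periodization error
  -- proportional to η, which is removed afterwards by η → 0.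
  have hη : ∀ η : ℝ, 0 < η → |A - (s⁻¹ - x)| ≤
      η * (((L ^ 2) ^ 2 * (c + 1) + (1 + L ^ 2 * x⁻¹) / s * x) * (2⁻¹ * (11 * L ^ 2))) := by
    intro η hη
    have hE : Tendsto (fun n : ℕ => ∫ ω, |((p n : ℕ) : ℝ)⁻¹ *
        (rowRes n x (dataMatrix φ ε (p n) n ω)).trace - s| ∂P +
        (2⁻¹ * (η * (11 * L ^ 2)) + η⁻¹ * (x⁻¹ ^ 4 * (4 * meanSqTail φ n)))) atTop
        (𝓝 (2⁻¹ * (η * (11 * L ^ 2)))) := by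
      have := hmean.add ((((tendsto_meanSqTail hφ).const_mul 4).const_mul (x⁻¹ ^ 4)).const_mul η⁻¹
        |>.const_add (2⁻¹ * (η * (11 * L ^ 2))))
      simpa using this
    have hR := ((hsqrt.const_mul (c + 1)).add (((hE.const_mul (c + 1)).add
      (hpc.const_mul s)).const_mul ((L ^ 2) ^ 2))).add
      (((hE.const_mul x).add hsqrt).const_mul ((1 + L ^ 2 * x⁻¹) / s))
    refine (le_of_tendsto_of_tendsto hlim hR ?_).trans_eq (by ring)
    filter_upwards [eventually_gt_atTop 0, hp.eventually (lt_mem_nhds hc),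
      hp.eventually (gt_mem_nhds (lt_add_one c))] with n hn hpn hpn'
    have hn0 : (0 : ℝ) < n := Nat.cast_pos.2 hn
    have : NeZero n := ⟨hn.ne'⟩
    have : NeZero (p n) := ⟨fun h => by simp [h] at hpn⟩
    have h1 := abs_trace_testMatrix_sub_le_integral hε hφ hx hc hs0 hL hD hK (p n) n hpn'.le
    rw [trace_testMatrix_filterMatrix φ n (by positivity)] at h1
    refine h1.trans ?_
    have h2 := integral_abs_periodized_sub_le hε hφ hx hη s (p n) n
    rw [← hL] at h2
    have h3 : 0 ≤ (1 + L ^ 2 * x⁻¹) / s := by positivity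
    gcongr
  have hAs : A = s⁻¹ - x := by
    have h0 : |A - (s⁻¹ - x)| ≤ 0 := by
      refine ge_of_tendsto (x := 𝓝[>] (0 : ℝ)) ?_ (eventually_mem_nhdsWithin.mono fun η h => hη η h)
      refine tendsto_nhdsWithin_of_tendsto_nhds ?_
      have : Continuous fun η : ℝ =>
        η * (((L ^ 2) ^ 2 * (c + 1) + (1 + L ^ 2 * x⁻¹) / s * x) * (2⁻¹ * (11 * L ^ 2))) := by
        fun_prop
      simpa using this.tendsto 0
    have := abs_nonpos_iff.1 h0
    linarith
  have hint : ∫ θ in (0 : ℝ)..(2 * Real.pi), 1 / (c * s + 1 / (2 * Real.pi * spectralDensity φ θ)) =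
      ∫ θ in (0 : ℝ)..(2 * Real.pi), ‖transfer φ θ‖ ^ 2 / (1 + c * s * ‖transfer φ θ‖ ^ 2) := by
    refine intervalIntegral.integral_congr fun θ hθ => ?_
    rw [uIcc_of_le Real.two_pi_pos.le] at hθ
    have h1 := hpos θ hθ
    rw [← two_pi_mul_spectralDensity]
    have h2 : 0 < c * s := by positivity
    generalize 2 * Real.pi * spectralDensity φ θ = v at h1 ⊢
    field_simp
    ring
  rw [gMap, hint, one_div (2 * Real.pi), ← hA, hAs]
  ring

end FixedPoint

/-! ### Assembly of the theorem from the fixed-point equation and the spectral description -/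

theorem proposition1 {Ω : Type*} [MeasurableSpace Ω] (P : Measure Ω) [IsProbabilityMeasure P]
    -- the noise: independent, centred, unit variance, bounded fourth moments
    (ε : ℕ → ℤ → Ω → ℝ)
    (hε_meas : ∀ i t, Measurable (ε i t))
    (hε_indep : iIndepFun (fun (q : ℕ × ℤ) => ε q.1 q.2) P)
    (hε_mean : ∀ i t, ∫ ω, ε i t ω ∂P = 0)
    (hε_var : ∀ i t, ∫ ω, (ε i t ω) ^ 2 ∂P = 1)
    (hε_L4 : ∀ i t, MemLp (ε i t) 4 P)
    (hε_fourth : ∃ M : ℝ, ∀ i t, ∫ ω, (ε i t ω) ^ 4 ∂P ≤ M)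
    -- the linear filter and its spectral density
    (φ : ℕ → ℝ) (hφ : Summable fun k => |φ k|)
    (hf : ContDiff ℝ (⊤ : ℕ∞) (spectralDensity φ))
    (a b : ℝ)
    (ha : IsLeast ((fun θ => 2 * Real.pi * spectralDensity φ θ) '' Icc 0 (2 * Real.pi)) a)
    (hb : IsGreatest ((fun θ => 2 * Real.pi * spectralDensity φ θ) '' Icc 0 (2 * Real.pi)) b)
    (ha_pos : 0 < a)
    -- the asymptotic regime
    (p : ℕ → ℕ) (c : ℝ) (hc : 0 < c)
    (hp : Tendsto (fun n : ℕ => (p n : ℝ) / (n : ℝ)) atTop (𝓝 c))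
    -- the limiting spectral distribution
    (F : Measure ℝ) [IsProbabilityMeasure F] (hF : IsLSD P φ ε p F) :
    ∃ (x₁ x₂ : ℝ) (h : ℝ → ℝ),
      0 ≤ x₁ ∧ x₁ < x₂ ∧
      (∀ x, 0 ≤ h x) ∧ (∀ x, x ∉ Icc x₁ x₂ → h x = 0) ∧
      (c ≠ 1 → ContinuousOn h (Icc x₁ x₂)) ∧
      (c = 1 → ContinuousOn h (Icc x₁ x₂ \ {0})) ∧
      (volume.withDensity fun x => ENNReal.ofReal (h x)).support = Icc x₁ x₂ ∧
      (c ≤ 1 → F = volume.withDensity fun x => ENNReal.ofReal (h x)) ∧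
      (1 < c → F = ENNReal.ofReal (1 - 1 / c) • Measure.dirac 0 +
        volume.withDensity fun x => ENNReal.ofReal (h x)) ∧
      (1 < c → ∃ s₁ ∈ Iio (-1 / (a * c)), ∃ s₂ ∈ Ioo (-1 / (b * c)) 0,
        (∀ s ∈ Iio (-1 / (a * c)), s ≠ s₁ →
          gMap (spectralDensity φ) c s < gMap (spectralDensity φ) c s₁) ∧
        (∀ s ∈ Ioo (-1 / (b * c)) 0, s ≠ s₂ →
          gMap (spectralDensity φ) c s₂ < gMap (spectralDensity φ) c s) ∧
        (∀ s ∈ gDomain a b c,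
          (IsLocalExtr (gMap (spectralDensity φ) c) s ↔ s = s₁ ∨ s = s₂)) ∧
        x₁ = gMap (spectralDensity φ) c s₁ ∧ x₂ = gMap (spectralDensity φ) c s₂) ∧
      (c < 1 → ∃ s₁ ∈ Ioi (0 : ℝ), ∃ s₂ ∈ Ioo (-1 / (b * c)) 0,
        (∀ s ∈ Ioi (0 : ℝ), s ≠ s₁ →
          gMap (spectralDensity φ) c s < gMap (spectralDensity φ) c s₁) ∧
        (∀ s ∈ Ioo (-1 / (b * c)) 0, s ≠ s₂ →
          gMap (spectralDensity φ) c s₂ < gMap (spectralDensity φ) c s) ∧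
        (∀ s ∈ gDomain a b c,
          (IsLocalExtr (gMap (spectralDensity φ) c) s ↔ s = s₁ ∨ s = s₂)) ∧
        x₁ = gMap (spectralDensity φ) c s₁ ∧ x₂ = gMap (spectralDensity φ) c s₂) := by
  obtain ⟨M, hM⟩ := hε_fourth
  have hε : IsNoise P (fun q : ℕ × ℤ => ε q.1 q.2) M :=
    ⟨fun q => hε_meas _ _, hε_indep, fun q => hε_mean _ _, fun q => hε_var _ _,
      fun q => hε_L4 _ _, fun q => hM _ _⟩
  have hpos : ∀ θ ∈ Icc 0 (2 * Real.pi), 0 < 2 * Real.pi * spectralDensity φ θ := fun θ hθ =>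
    ha_pos.trans_le (ha.2 ⟨θ, hθ, rfl⟩)
  exact exists_density_of_fixedPoint (hf.of_le (by exact_mod_cast le_top)) ha hb ha_pos hc F
    hF.measure_Iio fun x hx => hF.gMap_integral_inv_add hε hφ hf.continuous hpos hc hp hx
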